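/- **Setting.** Let $k$ be a field, $\hat G$ a finite group with a homomorphism $\pi:\hat G\to\{\pm1\}$, and $\hat H\le\hat G$ a subgroup on which $\pi$ is surjective (so $\pi$ is surjective on $\hat G$); put $G=\ker\pi$, $H=\hat H\cap G$. Let $\hat\alpha\in Z^3(B\hat G,k^\times_\pi)$ be a normalized 3-cocycle, $\hat G$ acting on $k^\times$ by $\lambda\mapsto\lambda^{\pi(\omega)}$, that is, $$\hat\alpha([\omega_4\omega_3|\omega_2|\omega_1])\,\hat\alpha([\omega_4|\omega_3|\omega_2\omega_1])=\hat\alpha([\omega_3|\omega_2|\omega_1])^{\pi(\omega_4)}\,\hat\alpha([\omega_4|\omega_3\omega_2|\omega_1])\,\hat\alpha([\omega_4|\omega_3|\omega_2]).$$ For a category, functor or isomorphism of functors, the left superscript ${}^{\epsilon}(-)$ means nothing if $\epsilon=1$ and passage to opposites if $\epsilon=-1$; for an isomorphism $u$, ${}^{\epsilon}u^{\epsilon}$ is $u$ if $\epsilon=1$ and $(u^{-1})^{\mathrm{op}}$ if $\epsilon=-1$. **Real 2-representations.** An $\hat\alpha$-twisted linear Real 2-representation $\rho$ of $G$ (with Real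 structure $\hat G$) on a $k$-linear category $V$ consists of $k$-linear equivalences $\rho(\omega):{}^{\pi(\omega)}V\to V$ for $\omega\in\hat G$, natural isomorphisms $\psi_{\omega_2,\omega_1}:\rho(\omega_2)\circ{}^{\pi(\omega_2)}\rho(\omega_1)\Rightarrow\rho(\omega_2\omega_1)$ and $\psi_e:\rho(e)\Rightarrow 1_V$ with $$\hat\alpha([\omega_3|\omega_2|\omega_1])\;\psi_{\omega_3\omega_2,\omega_1}\bigl(\psi_{\omega_3,\omega_2}\circ{}^{\pi(\omega_3\omega_2)}\rho(\omega_1)\bigr)=\psi_{\omega_3,\omega_2\omega_1}\bigl(\rho(\omega_3)\circ{}^{\pi(\omega_3)}\psi_{\omega_2,\omega_1}^{\pi(\omega_3)}\bigr),$$ $\psi_{e,\omega}=\psi_e\circ\rho(\omega)$ and $\psi_{\omega,e}=\rho(\omega)\circ{}^{\pi(\omega)}\psi_e^{\pi(\omega)}$. **Loop groupoid and transgression.** $\Lambda_\pi^{\mathrm{ref}}B\hat G$ is the groupoid with objects $g\in G$ and morphisms $\omega:g\to\omega g^{\pi(\omega)}\omega^{-1}$, $\omega\in\hat G$, composed by multiplication.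 It carries the 2-cocycle $\theta=\tau_\pi^{\mathrm{ref}}(\hat\alpha)$, $$\theta([\omega_2|\omega_1]\gamma)=\hat\alpha([\gamma|\gamma^{-1}|\gamma])^{\delta}\left(\frac{\hat\alpha([\omega_1\gamma^{-\pi(\omega_1)}\omega_1^{-1}|\omega_1\gamma^{\pi(\omega_1)}\omega_1^{-1}|\omega_1])\,\hat\alpha([\omega_1|\gamma^{-\pi(\omega_1)}|\gamma^{\pi(\omega_1)}])}{\hat\alpha([\omega_1\gamma^{-\pi(\omega_1)}\omega_1^{-1}|\omega_1|\gamma^{\pi(\omega_1)}])}\right)^{\frac{\pi(\omega_2)-1}{2}}\frac{\hat\alpha([\omega_2|\omega_1|\gamma^{\varepsilon}])\,\hat\alpha([\omega_2\omega_1\gamma^{\varepsilon}(\omega_2\omega_1)^{-1}|\omega_2|\omega_1])}{\hat\alpha([\omega_2|\omega_1\gamma^{\varepsilon}\omega_1^{-1}|\omega_1])},$$ where $\varepsilon=\pi(\omega_2\omega_1)$, and $\delta=1$ if $\pi(\omega_1)=\pi(\omega_2)=-1$ and $\delta=0$ otherwise. A $\theta$-twisted representation of a groupoid is a family of $k$-vector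 spaces $E_x$ with linear maps $E(f):E_x\to E_y$ for $f:x\to y$ such that $E(\mathrm{id})=\mathrm{id}$ and $E(f_2)E(f_1)=\theta([f_2|f_1])E(f_2f_1)$. An isomorphism is a family of linear isomorphisms that commute with all the $E(f)$. **Real categorical character.** $\mathbb{T}\mathrm{r}_\rho(g)=\mathrm{Hom}(1_V,\rho(g))$ for $g\in G$, and $\omega$ acts by $\beta_{g,\omega}$: with $g'=\omega g^{\pi(\omega)}\omega^{-1}$, $\beta_{g,\omega}(\phi)$ is the composite $$1_V\Rightarrow\rho(\omega)\rho(\omega^{-1})\Rightarrow\rho(\omega)\rho(g^{\pi(\omega)})\rho(\omega^{-1})\Rightarrow\rho(\omega g^{\pi(\omega)})\rho(\omega^{-1})\Rightarrow\rho(g')\rho(\omega)\rho(\omega^{-1})\Rightarrow\rho(g')$$ (superscripts suppressed). Here the first and last arrows come from the isomorphism $\psi_e\psi_{\omega,\omega^{-1}}:\rho(\omega)\rho(\omega^{-1})\Rightarrow1_V$ (its inverse, resp. itself), the third and fourth arrows are $\psi_{\omega,g^{\pi(\omega)}}$ and $\psi_{g',\omega}^{-1}$, and the second arrow inserts $\phi$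 if $\pi(\omega)=1$ and the opposite of $\phi^\flat$ if $\pi(\omega)=-1$, where $\phi^\flat$ is the composite $\rho(g^{-1})\Rightarrow\rho(g^{-1})\rho(g)\Rightarrow1_V$ of $\rho(g^{-1})(\phi)$ and $\psi_e\psi_{g^{-1},g}$. **Real induction.** Fix representatives $\{\sigma_q\}$ of the cosets $q\in\hat G/\hat H$, and let $\rho$ be an $\hat\alpha_{|\hat H}$-twisted linear Real 2-representation of $H$ on $V$. $\mathrm{RInd}_{\hat H}^{\hat G}(\rho)$ lives on $\prod_q{}^{\pi(\sigma_q)}V$. The $(j,i)$ entry of $\omega$ is ${}^{\pi(\sigma_j)}\rho(\eta)$ if $\omega\sigma_i=\sigma_j\eta$ with $\eta\in\hat H$, and $0$ otherwise. If $\omega_1\sigma_i=\sigma_j\eta_1$ and $\omega_2\sigma_j=\sigma_l\eta_2$, the $(l,i)$ entry of the composition isomorphism for $(\omega_2,\omega_1)$ is $$\frac{\hat\alpha([\omega_2|\sigma_j|\eta_1])}{\hat\alpha([\omega_2|\omega_1|\sigma_i])\,\hat\alpha([\sigma_l|\eta_2|\eta_1])}\;{}^{\pi(\sigma_l)}\psi_{\eta_2,\eta_1}^{\pi(\sigma_l)},$$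 and the unit isomorphism has entries ${}^{\pi(\sigma_i)}\psi_e^{\pi(\sigma_i)}$. **Twisted induction.** For a $\theta_{|\Lambda_\pi^{\mathrm{ref}}B\hat H}$-twisted representation $E$ of $\Lambda_\pi^{\mathrm{ref}}B\hat H$, the fibre over $g$ of $\mathrm{Ind}(E)=\mathrm{Ind}_{\Lambda_\pi^{\mathrm{ref}}B\hat H}^{\Lambda_\pi^{\mathrm{ref}}B\hat G}(E)$ is spanned by symbols $s\otimes v$, linear in $v$, with $h\in H$, $s:h\to g$ a morphism of $\Lambda_\pi^{\mathrm{ref}}B\hat G$ and $v\in E_h$, modulo $s\otimes E(a)v=\theta([s|a])\,sa\otimes v$ for morphisms $a$ of $\Lambda_\pi^{\mathrm{ref}}B\hat H$; a morphism $f$ acts by $s\otimes v\mapsto\theta([f|s])\,fs\otimes v$. **Theorem.** $\mathrm{RInd}_{\hat H}^{\hat G}(\rho)$ is an $\hat\alpha$-twisted linear Real 2-representation of $G$; $\mathbb{T}\mathrm{r}(\rho)$ is a $\tau_\pi^{\mathrm{ref}}(\hat\alpha_{|\hat H})$-twisted representation of $\Lambda_\pi^{\mathrm{ref}}B\hat H$;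 $\mathbb{T}\mathrm{r}(\mathrm{RInd}_{\hat H}^{\hat G}(\rho))$ and $\mathrm{Ind}_{\Lambda_\pi^{\mathrm{ref}}B\hat H}^{\Lambda_\pi^{\mathrm{ref}}B\hat G}(\mathbb{T}\mathrm{r}(\rho))$ are $\tau_\pi^{\mathrm{ref}}(\hat\alpha)$-twisted representations of $\Lambda_\pi^{\mathrm{ref}}B\hat G$; and there is a canonical isomorphism of $\tau_\pi^{\mathrm{ref}}(\hat\alpha)$-twisted representations $$\mathbb{T}\mathrm{r}(\mathrm{RInd}_{\hat H}^{\hat G}(\rho))\;\simeq\;\mathrm{Ind}_{\Lambda_\pi^{\mathrm{ref}}B\hat H}^{\Lambda_\pi^{\mathrm{ref}}B\hat G}(\mathbb{T}\mathrm{r}(\rho)).$$ Canonical means: for every $g\in G$ and every coset $q$ fixed by $g$, with $h_q=\sigma_q^{-1}g^{\pi(\sigma_q)}\sigma_q\in H$, and every $v\in\mathbb{T}\mathrm{r}_\rho(h_q)$, the element $\sigma_q\otimes v$ corresponds to the natural transformation $1\Rightarrow\mathrm{RInd}_{\hat H}^{\hat G}(\rho)(g)$ whose $q$-component is $v:1_V\Rightarrow\rho(h_q)$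 if $\pi(\sigma_q)=1$ and the opposite of $v^\flat:\rho(h_q^{-1})\Rightarrow1_V$ if $\pi(\sigma_q)=-1$, and whose other components vanish. -/

import Mathlib

open CategoryTheory

universe w v u v₁ u₁ v₂ u₂ v₃ u₃

namespace RealTwoRep

/-! ## Signed categories -/

/-- For a sign `ε`, the category `Signed ε C` is `C` if `ε = 1` and the opposite of `C` if
`ε = -1`. -/
structure Signed (ε : ℤˣ) (C : Type u) : Type u where
  un : C

/-- Morphisms of `Signed ε C`: a morphism `x ⟶ y` if `ε = 1` and a morphism `y ⟶ x` if `ε = -1`.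
Exactly one of the two fields carries data, the other one has a contradictory hypothesis. -/
@[ext]
structure SHom (ε : ℤˣ) {C : Type u} [Category.{v} C] (x y : C) : Type v where
  pos : ε = 1 → (x ⟶ y)
  neg : ε = -1 → (y ⟶ x)

section SignedCategory

variable {C : Type u} [Category.{v} C]

instance signedCategory (ε : ℤˣ) : Category.{v} (Signed ε C) where
  Hom x y := SHom ε x.un y.un
  id x := ⟨fun _ => 𝟙 x.un, fun _ => 𝟙 x.un⟩
  comp f g := ⟨fun h => f.pos h ≫ g.pos h, fun h => g.neg h ≫ f.neg h⟩
  id_comp f := by ext h <;> simp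
  comp_id f := by ext h <;> simp
  assoc f g h := by ext h <;> simp

variable {ε : ℤˣ}

@[ext]
theorem Signed.hom_ext {x y : Signed ε C} (f g : x ⟶ y) (hp : ∀ h, f.pos h = g.pos h)
    (hn : ∀ h, f.neg h = g.neg h) : f = g :=
  SHom.ext (funext hp) (funext hn)

@[simp] theorem Signed.id_pos (x : Signed ε C) (h : ε = 1) : (𝟙 x : x ⟶ x).pos h = 𝟙 x.un := rfl
@[simp] theorem Signed.id_neg (x : Signed ε C) (h : ε = -1) : (𝟙 x : x ⟶ x).neg h = 𝟙 x.un := rfl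
@[simp] theorem Signed.comp_pos {x y z : Signed ε C} (f : x ⟶ y) (g : y ⟶ z) (h : ε = 1) :
    (f ≫ g).pos h = f.pos h ≫ g.pos h := rfl
@[simp] theorem Signed.comp_neg {x y z : Signed ε C} (f : x ⟶ y) (g : y ⟶ z) (h : ε = -1) :
    (f ≫ g).neg h = g.neg h ≫ f.neg h := rfl

/-- An isomorphism `e` of `C`, read in `Signed ε C`: it is `e` if `ε = 1` and the opposite of
`e⁻¹` if `ε = -1`. -/
@[simps]
def Signed.iso (ε : ℤˣ) {x y : C} (e : x ≅ y) : (⟨x⟩ : Signed ε C) ≅ ⟨y⟩ where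
  hom := ⟨fun _ => e.hom, fun _ => e.inv⟩
  inv := ⟨fun _ => e.inv, fun _ => e.hom⟩
  hom_inv_id := by ext h <;> simp
  inv_hom_id := by ext h <;> simp

end SignedCategory

section SignedLinear

variable {k : Type w} [Field k] {C : Type u} [Category.{v} C] [Preadditive C] [Linear k C]
variable {ε : ℤˣ}

instance sHomAddCommGroup (x y : C) : AddCommGroup (SHom ε x y) where
  add f g := ⟨fun h => f.pos h + g.pos h, fun h => f.neg h + g.neg h⟩
  zero := ⟨fun _ => 0, fun _ => 0⟩
  neg f := ⟨fun h => -f.pos h, fun h => -f.neg h⟩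
  nsmul n f := ⟨fun h => n • f.pos h, fun h => n • f.neg h⟩
  zsmul n f := ⟨fun h => n • f.pos h, fun h => n • f.neg h⟩
  add_assoc a b c := SHom.ext (funext fun _ => add_assoc _ _ _) (funext fun _ => add_assoc _ _ _)
  zero_add a := SHom.ext (funext fun _ => zero_add _) (funext fun _ => zero_add _)
  add_zero a := SHom.ext (funext fun _ => add_zero _) (funext fun _ => add_zero _)
  add_comm a b := SHom.ext (funext fun _ => add_comm _ _) (funext fun _ => add_comm _ _)
  neg_add_cancel a :=
    SHom.ext (funext fun _ => neg_add_cancel _) (funext fun _ => neg_add_cancel _)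
  nsmul_zero f := SHom.ext (funext fun _ => zero_nsmul _) (funext fun _ => zero_nsmul _)
  nsmul_succ n f := SHom.ext (funext fun _ => succ_nsmul _ _) (funext fun _ => succ_nsmul _ _)
  zsmul_zero' f := SHom.ext (funext fun _ => zero_zsmul _) (funext fun _ => zero_zsmul _)
  zsmul_succ' n f := SHom.ext (funext fun _ => SubNegMonoid.zsmul_succ' _ _)
    (funext fun _ => SubNegMonoid.zsmul_succ' _ _)
  zsmul_neg' n f := SHom.ext (funext fun _ => SubNegMonoid.zsmul_neg' _ _)
    (funext fun _ => SubNegMonoid.zsmul_neg' _ _)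

instance sHomModule (x y : C) : Module k (SHom ε x y) where
  smul c f := ⟨fun h => c • f.pos h, fun h => c • f.neg h⟩
  one_smul _ := SHom.ext (funext fun _ => one_smul _ _) (funext fun _ => one_smul _ _)
  mul_smul _ _ _ := SHom.ext (funext fun _ => mul_smul _ _ _) (funext fun _ => mul_smul _ _ _)
  smul_zero _ := SHom.ext (funext fun _ => smul_zero _) (funext fun _ => smul_zero _)
  smul_add _ _ _ := SHom.ext (funext fun _ => smul_add _ _ _) (funext fun _ => smul_add _ _ _)
  add_smul _ _ _ := SHom.ext (funext fun _ => add_smul _ _ _) (funext fun _ => add_smul _ _ _)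
  zero_smul _ := SHom.ext (funext fun _ => zero_smul _ _) (funext fun _ => zero_smul _ _)

instance signedPreadditive : Preadditive (Signed ε C) where
  homGroup x y := sHomAddCommGroup x.un y.un
  add_comp _ _ _ _ _ _ := SHom.ext (funext fun _ => Preadditive.add_comp _ _ _ _ _ _)
    (funext fun _ => Preadditive.comp_add _ _ _ _ _ _)
  comp_add _ _ _ _ _ _ := SHom.ext (funext fun _ => Preadditive.comp_add _ _ _ _ _ _)
    (funext fun _ => Preadditive.add_comp _ _ _ _ _ _)

instance signedLinear : Linear k (Signed ε C) where
  homModule x y := sHomModule x.un y.un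
  smul_comp _ _ _ _ _ _ := SHom.ext (funext fun _ => Linear.smul_comp _ _ _ _ _ _)
    (funext fun _ => Linear.comp_smul _ _ _ _ _ _)
  comp_smul _ _ _ _ _ _ := SHom.ext (funext fun _ => Linear.comp_smul _ _ _ _ _ _)
    (funext fun _ => Linear.smul_comp _ _ _ _ _ _)

@[simp] theorem Signed.add_pos {x y : Signed ε C} (f g : x ⟶ y) (h : ε = 1) :
    (f + g).pos h = f.pos h + g.pos h := rfl
@[simp] theorem Signed.add_neg {x y : Signed ε C} (f g : x ⟶ y) (h : ε = -1) :
    (f + g).neg h = f.neg h + g.neg h := rfl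
@[simp] theorem Signed.smul_pos (c : k) {x y : Signed ε C} (f : x ⟶ y) (h : ε = 1) :
    (c • f).pos h = c • f.pos h := rfl
@[simp] theorem Signed.smul_neg (c : k) {x y : Signed ε C} (f : x ⟶ y) (h : ε = -1) :
    (c • f).neg h = c • f.neg h := rfl

/-- A product of preadditive categories is preadditive. -/
instance piPreadditive {ι : Type u₁} (D : ι → Type u₂) [∀ i, Category.{v₂} (D i)]
    [∀ i, Preadditive (D i)] : Preadditive (∀ i, D i) where
  homGroup x y := inferInstanceAs (AddCommGroup (∀ i, x i ⟶ y i))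
  add_comp _ _ _ _ _ _ := funext fun _ => Preadditive.add_comp _ _ _ _ _ _
  comp_add _ _ _ _ _ _ := funext fun _ => Preadditive.comp_add _ _ _ _ _ _

/-- A product of `k`-linear categories is `k`-linear. -/
instance piLinear {ι : Type u₁} (D : ι → Type u₂) [∀ i, Category.{v₂} (D i)]
    [∀ i, Preadditive (D i)] [∀ i, Linear k (D i)] : Linear k (∀ i, D i) where
  homModule x y := inferInstanceAs (Module k (∀ i, x i ⟶ y i))
  smul_comp _ _ _ _ _ _ := funext fun _ => Linear.smul_comp _ _ _ _ _ _
  comp_smul _ _ _ _ _ _ := funext fun _ => Linear.comp_smul _ _ _ _ _ _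

end SignedLinear

/-! ## Signed functors -/

section SignedFunctors

variable {C : Type u₁} [Category.{v₁} C] {D : Type u₂} [Category.{v₂} D]
  {E : Type u₃} [Category.{v₃} E]

/-- The functor `F` if `ε = 1`, its opposite if `ε = -1`. -/
@[simps]
def Signed.functor (ε : ℤˣ) (F : C ⥤ D) : Signed ε C ⥤ Signed ε D where
  obj x := ⟨F.obj x.un⟩
  map f := ⟨fun h => F.map (f.pos h), fun h => F.map (f.neg h)⟩
  map_id x := by ext h <;> simp
  map_comp f g := by ext h <;> simp

/-- The identification of `Signed (ε₂ * ε₁) C` with `Signed ε₂ (Signed ε₁ C)`. -/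
@[simps]
def Signed.split {ε ε₂ ε₁ : ℤˣ} (h : ε = ε₂ * ε₁) : Signed ε C ⥤ Signed ε₂ (Signed ε₁ C) where
  obj x := ⟨⟨x.un⟩⟩
  map f :=
    ⟨fun h₂ => ⟨fun h₁ => f.pos (by simp [h, h₁, h₂]), fun h₁ => f.neg (by simp [h, h₁, h₂])⟩,
     fun h₂ => ⟨fun h₁ => f.neg (by simp [h, h₁, h₂]), fun h₁ => f.pos (by simp [h, h₁, h₂])⟩⟩
  map_id x := by ext h <;> simp
  map_comp f g := by ext h <;> simp

theorem eq_neg_one_of_ne {ε : ℤˣ} (h : ¬ ε = 1) : ε = -1 :=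
  (Int.units_eq_one_or ε).resolve_left h

/-- The inverse identification of `Signed ε₂ (Signed ε₁ C)` with `Signed (ε₂ * ε₁) C`. -/
@[simps]
def Signed.merge {ε ε₂ ε₁ : ℤˣ} (h : ε = ε₂ * ε₁) : Signed ε₂ (Signed ε₁ C) ⥤ Signed ε C where
  obj x := ⟨x.un.un⟩
  map f :=
    ⟨fun h' => if h₂ : ε₂ = 1 then (f.pos h₂).pos (by simpa [h₂, h'] using h.symm)
        else (f.neg (eq_neg_one_of_ne h₂)).neg (by
          simpa [eq_neg_one_of_ne h₂, h', neg_eq_iff_eq_neg] using h.symm),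
     fun h' => if h₂ : ε₂ = 1 then (f.pos h₂).neg (by simpa [h₂, h'] using h.symm)
        else (f.neg (eq_neg_one_of_ne h₂)).pos (by
          simpa [eq_neg_one_of_ne h₂, h', neg_eq_iff_eq_neg] using h.symm)⟩
  map_id x := by ext h <;> simp
  map_comp f g := by
    ext h' <;> by_cases h₂ : ε₂ = 1 <;> simp [h₂]

/-- `Signed 1 C` is `C`; this is the identity `1`-morphism of `C`, as a signed functor. -/
@[simps]
def Signed.unit {ε : ℤˣ} (h : ε = 1) : Signed ε C ⥤ C where
  obj x := x.un
  map f := f.pos h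

/-- Composition of covariant and contravariant functors: for `G : {}^{ε₁}C ⥤ D` and
`F : {}^{ε₂}D ⥤ E` this is `F ∘ {}^{ε₂}G : {}^{ε₂ ε₁}C ⥤ E`. -/
@[simps!]
def sComp {ε ε₂ ε₁ : ℤˣ} (h : ε = ε₂ * ε₁) (F : Signed ε₂ D ⥤ E) (G : Signed ε₁ C ⥤ D) :
    Signed ε C ⥤ E :=
  Signed.split h ⋙ Signed.functor ε₂ G ⋙ F

end SignedFunctors

/-! ## Real `2`-representations on `k`-linear categories -/

section RealTwoReps

variable {k : Type w} [Field k] {Γ : Type u₁} [Group Γ] {π : Γ →* ℤˣ}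

/-- The data of a twisted Real `2`-representation of `ker π`, with Real structure
`π : Γ →* ℤˣ`, on a `k`-linear category `V`: a `k`-linear functor
`act ω : {}^{π ω}V ⥤ V` for each `ω`, natural isomorphisms
`psi ω₂ ω₁ ω : act ω₂ ∘ {}^{π ω₂}(act ω₁) ≅ act ω` whenever `ω₂ ω₁ = ω`, and a natural isomorphism
`psiE : act 1 ≅ 1_V`. -/
structure RealTwoRepData (k : Type w) [Field k] {Γ : Type u₁} [Group Γ] (π : Γ →* ℤˣ)
    (V : Type u) [Category.{v} V] [Preadditive V] [Linear k V] where
  act (ω : Γ) : Signed (π ω) V ⥤ V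
  act_additive (ω : Γ) : (act ω).Additive
  act_linear (ω : Γ) : (act ω).Linear k
  psi (ω₂ ω₁ ω : Γ) (h : ω₂ * ω₁ = ω) :
    sComp (show π ω = π ω₂ * π ω₁ by rw [← h, map_mul]) (act ω₂) (act ω₁) ≅ act ω
  psiE : act 1 ≅ Signed.unit (map_one π)

namespace RealTwoRepData

variable {V : Type u} [Category.{v} V] [Preadditive V] [Linear k V] (ρ : RealTwoRepData k π V)

attribute [instance] act_additive act_linear

/-- The value of `ρ(ω)` on the object `x`. -/
abbrev obj (ω : Γ) (x : V) : V := (ρ.act ω).obj ⟨x⟩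

/-- The component at `x` of `ψ_{ω₂,ω₁}`. -/
def psiApp (ω₂ ω₁ ω : Γ) (h : ω₂ * ω₁ = ω) (x : V) : ρ.obj ω₂ (ρ.obj ω₁ x) ≅ ρ.obj ω x :=
  (ρ.psi ω₂ ω₁ ω h).app ⟨x⟩

/-- The component at `x` of `ψ_e`. -/
def psiEApp (x : V) : ρ.obj 1 x ≅ x :=
  ρ.psiE.app ⟨x⟩

/-- The effect of `{}^{ε}(-)^{ε}` followed by `ρ(ω)`, `ε = π(ω)`, on isomorphisms: `ρ(ω)` is applied
to `e` if `π(ω) = 1` and to `e⁻¹` if `π(ω) = -1`. -/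
def actIso (ω : Γ) {x y : V} (e : x ≅ y) : ρ.obj ω x ≅ ρ.obj ω y :=
  (ρ.act ω).mapIso (Signed.iso (π ω) e)

/-- The identification of `ρ(ω)(x)` and `ρ(ω')(x')` for equal arguments. -/
def castIso {ω ω' : Γ} {x x' : V} (h : ω = ω') (hx : x = x') : ρ.obj ω x ≅ ρ.obj ω' x' :=
  eqToIso (by subst h hx; rfl)

/-- The laws of an `α`-twisted Real `2`-representation. -/
structure IsTwisted (α : Γ → Γ → Γ → kˣ) : Prop where
  isEquivalence (ω : Γ) : (ρ.act ω).IsEquivalence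
  assoc (ω₃ ω₂ ω₁ : Γ) (x : V) :
    (α ω₃ ω₂ ω₁ : k) • ((ρ.psiApp ω₃ ω₂ (ω₃ * ω₂) rfl (ρ.obj ω₁ x)).hom ≫
        (ρ.psiApp (ω₃ * ω₂) ω₁ (ω₃ * ω₂ * ω₁) rfl x).hom) =
      (ρ.actIso ω₃ (ρ.psiApp ω₂ ω₁ (ω₂ * ω₁) rfl x)).hom ≫
        (ρ.psiApp ω₃ (ω₂ * ω₁) (ω₃ * ω₂ * ω₁) (mul_assoc _ _ _).symm x).hom
  unit_left (ω : Γ) (x : V) : ρ.psiApp 1 ω ω (one_mul ω) x = ρ.psiEApp (ρ.obj ω x)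
  unit_right (ω : Γ) (x : V) : ρ.psiApp ω 1 ω (mul_one ω) x = ρ.actIso ω (ρ.psiEApp x)

end RealTwoRepData

end RealTwoReps

/-! ## Cocycles and the unoriented loop groupoid -/

section Loops

/-- Normalized `π`-twisted `3`-cocycles on `BΓ` with values in `kˣ`, on which `Γ` acts through `π`
by inversion. The value on the simplex `[ω₃ | ω₂ | ω₁]` is `α ω₃ ω₂ ω₁`. -/
structure ThreeCocycle (k : Type w) [Field k] {Γ : Type u₁} [Group Γ] (π : Γ →* ℤˣ) where
  toFun : Γ → Γ → Γ → kˣ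
  cocycle (ω₄ ω₃ ω₂ ω₁ : Γ) :
    toFun (ω₄ * ω₃) ω₂ ω₁ * toFun ω₄ ω₃ (ω₂ * ω₁) =
      toFun ω₃ ω₂ ω₁ ^ ((π ω₄ : ℤˣ) : ℤ) * toFun ω₄ (ω₃ * ω₂) ω₁ * toFun ω₄ ω₃ ω₂
  one_left (b a : Γ) : toFun 1 b a = 1
  one_mid (c a : Γ) : toFun c 1 a = 1
  one_right (c b : Γ) : toFun c b 1 = 1

variable {k : Type w} [Field k] {Γ : Type u₁} [Group Γ]

/-- Restriction of a `3`-cocycle to a subgroup. -/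
@[simps]
def ThreeCocycle.restrict {π : Γ →* ℤˣ} (α : ThreeCocycle k π) (H : Subgroup Γ) :
    ThreeCocycle k (π.comp H.subtype) where
  toFun c b a := α.toFun c b a
  cocycle d c b a := α.cocycle d c b a
  one_left b a := α.one_left b a
  one_mid c a := α.one_mid c a
  one_right c b := α.one_right c b

/-- Objects of the unoriented loop groupoid of `BΓ`: the loops of degree one. -/
@[ext]
structure Loop (π : Γ →* ℤˣ) : Type u₁ where
  el : Γ
  deg : π el = 1

/-- Real conjugation `γ ↦ ω γ^{π(ω)} ω⁻¹`. -/
def realConj (π : Γ →* ℤˣ) (ω γ : Γ) : Γ := ω * γ ^ ((π ω : ℤˣ) : ℤ) * ω⁻¹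

theorem realConj_one (π : Γ →* ℤˣ) (γ : Γ) : realConj π 1 γ = γ := by simp [realConj]

theorem realConj_mul (π : Γ →* ℤˣ) (ω₂ ω₁ γ : Γ) :
    realConj π (ω₂ * ω₁) γ = realConj π ω₂ (realConj π ω₁ γ) := by
  rcases Int.units_eq_one_or (π ω₂) with h₂ | h₂ <;>
    rcases Int.units_eq_one_or (π ω₁) with h₁ | h₁ <;>
    simp [realConj, h₁, h₂, mul_assoc]

theorem realConj_deg (π : Γ →* ℤˣ) (ω : Γ) {γ : Γ} (h : π γ = 1) : π (realConj π ω γ) = 1 := by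
  simp [realConj, h]

/-- The unoriented loop groupoid of `BΓ`: a morphism `γ₁ ⟶ γ₂` is an element `ω` of `Γ` with
`γ₂ = ω γ₁^{π(ω)} ω⁻¹`. The composition of `ω₁` followed by `ω₂` is `ω₂ ω₁`. -/
instance loopGroupoid (π : Γ →* ℤˣ) : Groupoid.{u₁} (Loop π) where
  Hom γ₁ γ₂ := {ω : Γ // realConj π ω γ₁.el = γ₂.el}
  id γ := ⟨1, realConj_one π γ.el⟩
  comp f g := ⟨g.1 * f.1, by rw [realConj_mul, f.2, g.2]⟩
  id_comp f := Subtype.ext (mul_one _)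
  comp_id f := Subtype.ext (one_mul _)
  assoc f g h := Subtype.ext (mul_assoc _ _ _).symm
  inv {γ₁ _} f := ⟨f.1⁻¹, (congrArg _ f.2.symm).trans (by
    rw [← realConj_mul, inv_mul_cancel, realConj_one])⟩
  inv_comp f := Subtype.ext (mul_inv_cancel f.1)
  comp_inv f := Subtype.ext (inv_mul_cancel f.1)

/-- The canonical functor from the unoriented loop groupoid of a subgroup. -/
def loopInclusion (π : Γ →* ℤˣ) (H : Subgroup Γ) : Loop (π.comp H.subtype) ⥤ Loop π where
  obj γ := ⟨γ.el, γ.deg⟩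
  map f := ⟨f.1, by
    have := congrArg Subtype.val f.2
    simpa [realConj] using this⟩
  map_id _ := rfl
  map_comp _ _ := rfl

/-- Normalized `2`-cocycles on a category with values in `kˣ`. The value on the simplex
`[f₂ | f₁]` is `θ f₂ f₁`. -/
structure TwoCocycle (k : Type w) [Field k] (C : Type u) [Category.{v} C] where
  toFun {x y z : C} (f₂ : y ⟶ z) (f₁ : x ⟶ y) : kˣ
  cocycle {x y z t : C} (f₃ : z ⟶ t) (f₂ : y ⟶ z) (f₁ : x ⟶ y) :
    toFun f₃ f₂ * toFun (f₂ ≫ f₃) f₁ = toFun f₃ (f₁ ≫ f₂) * toFun f₂ f₁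
  id_left {x y : C} (f : x ⟶ y) : toFun (𝟙 y) f = 1
  id_right {x y : C} (f : x ⟶ y) : toFun f (𝟙 x) = 1

/-- The value of the reflection twisted loop transgression of `α` on `[ω₂ | ω₁]γ`. -/
def transgressionFun (π : Γ →* ℤˣ) (α : Γ → Γ → Γ → kˣ) (ω₂ ω₁ γ : Γ) : kˣ :=
  α γ γ⁻¹ γ ^ (if π ω₂ = -1 ∧ π ω₁ = -1 then 1 else 0 : ℕ) *
    (α (ω₁ * γ ^ (-((π ω₁ : ℤˣ) : ℤ)) * ω₁⁻¹) (ω₁ * γ ^ ((π ω₁ : ℤˣ) : ℤ) * ω₁⁻¹) ω₁ *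
        α ω₁ (γ ^ (-((π ω₁ : ℤˣ) : ℤ))) (γ ^ ((π ω₁ : ℤˣ) : ℤ)) /
        α (ω₁ * γ ^ (-((π ω₁ : ℤˣ) : ℤ)) * ω₁⁻¹) ω₁ (γ ^ ((π ω₁ : ℤˣ) : ℤ))) ^
      ((((π ω₂ : ℤˣ) : ℤ) - 1) / 2) *
    (α ω₂ ω₁ (γ ^ ((π (ω₂ * ω₁) : ℤˣ) : ℤ)) *
        α (ω₂ * ω₁ * γ ^ ((π (ω₂ * ω₁) : ℤˣ) : ℤ) * (ω₂ * ω₁)⁻¹) ω₂ ω₁ /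
        α ω₂ (ω₁ * γ ^ ((π (ω₂ * ω₁) : ℤˣ) : ℤ) * ω₁⁻¹) ω₁)

theorem ThreeCocycle.additive {π : Γ →* ℤˣ} (α : ThreeCocycle k π) (d c b a : Γ) :
    Additive.ofMul (α.toFun (d * c) b a) + Additive.ofMul (α.toFun d c (b * a)) =
      ((π d : ℤˣ) : ℤ) • Additive.ofMul (α.toFun c b a) + Additive.ofMul (α.toFun d (c * b) a) +
        Additive.ofMul (α.toFun d c b) := by
  have h := congrArg Additive.ofMul (α.cocycle d c b a)
  simpa only [ofMul_mul, ofMul_zpow] using h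

set_option linter.unusedSimpArgs false in
set_option linter.flexible false in
theorem transgressionFun_cocycle (π : Γ →* ℤˣ) (α : ThreeCocycle k π) (c b a g : Γ)
    (hg : π g = 1) :
    transgressionFun π α.toFun c b (realConj π a g) * transgressionFun π α.toFun (c * b) a g =
      transgressionFun π α.toFun c (b * a) g * transgressionFun π α.toFun b a g := by
  apply Additive.ofMul.injective
  rcases Int.units_eq_one_or (π a) with ha | ha <;>
    rcases Int.units_eq_one_or (π b) with hb | hb <;>
    rcases Int.units_eq_one_or (π c) with hc | hc
  · have r₁ := α.additive (c * b * a * g * (c * b * a)⁻¹) c b a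
    have r₂ := α.additive c (b * a * g * (b * a)⁻¹) b a
    have r₃ := α.additive c b (a * g * a⁻¹) a
    have r₄ := α.additive c b a g
    simp [transgressionFun, realConj, ha, hb, hc, hg, mul_assoc, α.one_left, α.one_mid, α.one_right] at *
    linear_combination (norm := module) r₂ - r₁ - r₃ + r₄
  · have r₁ := α.additive (c * b * a * g⁻¹ * (c * b * a)⁻¹) c b a
    have r₂ := α.additive c (b * a * g⁻¹ * (b * a)⁻¹) b a
    have r₃ := α.additive c b (a * g⁻¹ * a⁻¹) a
    have r₄ := α.additive c b a g⁻¹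
    have s₁ := α.additive (b * a * g⁻¹ * (b * a)⁻¹) (b * a * g * (b * a)⁻¹) b a
    have s₂ := α.additive (b * a * g⁻¹ * (b * a)⁻¹) b (a * g * a⁻¹) a
    have s₃ := α.additive (b * a * g⁻¹ * (b * a)⁻¹) b a g
    have s₄ := α.additive b (a * g⁻¹ * a⁻¹) (a * g * a⁻¹) a
    have s₅ := α.additive b (a * g⁻¹ * a⁻¹) a g
    have s₆ := α.additive b a g⁻¹ g
    simp [transgressionFun, realConj, ha, hb, hc, hg, mul_assoc, α.one_left, α.one_mid, α.one_right] at *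
    linear_combination (norm := module) r₂ - r₁ - r₃ + r₄ + s₁ - s₂ + s₃ + s₄ - s₅ + s₆
  · have r₁ := α.additive (c * b * a * g⁻¹ * (c * b * a)⁻¹) c b a
    have r₂ := α.additive c (b * a * g⁻¹ * (b * a)⁻¹) b a
    have r₃ := α.additive c b (a * g⁻¹ * a⁻¹) a
    have r₄ := α.additive c b a g⁻¹
    simp [transgressionFun, realConj, ha, hb, hc, hg, mul_assoc, α.one_left, α.one_mid, α.one_right] at *
    linear_combination (norm := module) r₂ - r₁ - r₃ + r₄
  · have r₁ := α.additive (c * b * a * g * (c * b * a)⁻¹) c b a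
    have r₂ := α.additive c (b * a * g * (b * a)⁻¹) b a
    have r₃ := α.additive c b (a * g * a⁻¹) a
    have r₄ := α.additive c b a g
    have s₁ := α.additive (b * a * g * (b * a)⁻¹) (b * a * g⁻¹ * (b * a)⁻¹) b a
    have s₂ := α.additive (b * a * g * (b * a)⁻¹) b (a * g⁻¹ * a⁻¹) a
    have s₃ := α.additive (b * a * g * (b * a)⁻¹) b a g⁻¹
    have s₄ := α.additive b (a * g * a⁻¹) (a * g⁻¹ * a⁻¹) a
    have s₅ := α.additive b (a * g * a⁻¹) a g⁻¹
    have s₆ := α.additive b a g g⁻¹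
    have t₁ := α.additive (a * g * a⁻¹) (a * g⁻¹ * a⁻¹) (a * g * a⁻¹) a
    have t₂ := α.additive (a * g * a⁻¹) (a * g⁻¹ * a⁻¹) a g
    have t₃ := α.additive (a * g * a⁻¹) a g⁻¹ g
    have t₄ := α.additive a g g⁻¹ g
    simp [transgressionFun, realConj, ha, hb, hc, hg, mul_assoc, α.one_left, α.one_mid, α.one_right] at *
    linear_combination (norm := module) r₂ - r₁ - r₃ + r₄ + s₁ - s₂ + s₃ + s₄ - s₅ + s₆ - t₁ + t₂ - t₃ + t₄
  · have r₁ := α.additive (c * b * a * g⁻¹ * (c * b * a)⁻¹) c b a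
    have r₂ := α.additive c (b * a * g⁻¹ * (b * a)⁻¹) b a
    have r₃ := α.additive c b (a * g⁻¹ * a⁻¹) a
    have r₄ := α.additive c b a g⁻¹
    simp [transgressionFun, realConj, ha, hb, hc, hg, mul_assoc, α.one_left, α.one_mid, α.one_right] at *
    linear_combination (norm := module) r₂ - r₁ - r₃ + r₄
  · have r₁ := α.additive (c * b * a * g * (c * b * a)⁻¹) c b a
    have r₂ := α.additive c (b * a * g * (b * a)⁻¹) b a
    have r₃ := α.additive c b (a * g * a⁻¹) a
    have r₄ := α.additive c b a g
    have s₁ := α.additive (b * a * g * (b * a)⁻¹) (b * a * g⁻¹ * (b * a)⁻¹) b a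
    have s₂ := α.additive (b * a * g * (b * a)⁻¹) b (a * g⁻¹ * a⁻¹) a
    have s₃ := α.additive (b * a * g * (b * a)⁻¹) b a g⁻¹
    have s₄ := α.additive b (a * g * a⁻¹) (a * g⁻¹ * a⁻¹) a
    have s₅ := α.additive b (a * g * a⁻¹) a g⁻¹
    have s₆ := α.additive b a g g⁻¹
    simp [transgressionFun, realConj, ha, hb, hc, hg, mul_assoc, α.one_left, α.one_mid, α.one_right] at *
    linear_combination (norm := module) r₂ - r₁ - r₃ + r₄ + s₁ - s₂ + s₃ + s₄ - s₅ + s₆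
  · have r₁ := α.additive (c * b * a * g * (c * b * a)⁻¹) c b a
    have r₂ := α.additive c (b * a * g * (b * a)⁻¹) b a
    have r₃ := α.additive c b (a * g * a⁻¹) a
    have r₄ := α.additive c b a g
    simp [transgressionFun, realConj, ha, hb, hc, hg, mul_assoc, α.one_left, α.one_mid, α.one_right] at *
    linear_combination (norm := module) r₂ - r₁ - r₃ + r₄
  · have r₁ := α.additive (c * b * a * g⁻¹ * (c * b * a)⁻¹) c b a
    have r₂ := α.additive c (b * a * g⁻¹ * (b * a)⁻¹) b a
    have r₃ := α.additive c b (a * g⁻¹ * a⁻¹) a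
    have r₄ := α.additive c b a g⁻¹
    have s₁ := α.additive (b * a * g⁻¹ * (b * a)⁻¹) (b * a * g * (b * a)⁻¹) b a
    have s₂ := α.additive (b * a * g⁻¹ * (b * a)⁻¹) b (a * g * a⁻¹) a
    have s₃ := α.additive (b * a * g⁻¹ * (b * a)⁻¹) b a g
    have s₄ := α.additive b (a * g⁻¹ * a⁻¹) (a * g * a⁻¹) a
    have s₅ := α.additive b (a * g⁻¹ * a⁻¹) a g
    have s₆ := α.additive b a g⁻¹ g
    have t₁ := α.additive (a * g⁻¹ * a⁻¹) (a * g * a⁻¹) (a * g⁻¹ * a⁻¹) a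
    have t₂ := α.additive (a * g⁻¹ * a⁻¹) (a * g * a⁻¹) a g⁻¹
    have t₃ := α.additive (a * g⁻¹ * a⁻¹) a g g⁻¹
    have t₄ := α.additive a g⁻¹ g g⁻¹
    have u₁ := α.additive g g⁻¹ g g⁻¹
    simp [transgressionFun, realConj, ha, hb, hc, hg, mul_assoc, α.one_left, α.one_mid, α.one_right] at *
    linear_combination (norm := module) r₂ - r₁ - r₃ + r₄ + s₁ - s₂ + s₃ + s₄ - s₅ + s₆ - t₁ + t₂ - t₃ + t₄ + u₁

/-- The reflection twisted loop transgression of a `3`-cocycle on `BΓ`, a `2`-cocycle on the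
unoriented loop groupoid. -/
def transgression {π : Γ →* ℤˣ} (α : ThreeCocycle k π) : TwoCocycle k (Loop π) where
  toFun {γ _ _} f₂ f₁ := transgressionFun π α.toFun f₂.1 f₁.1 γ.el
  cocycle {γ _ _ _} f₃ f₂ f₁ := by
    have h := transgressionFun_cocycle π α f₃.1 f₂.1 f₁.1 γ.el γ.deg
    rwa [show realConj π f₁.1 γ.el = _ from f₁.2] at h
  id_left f := by
    change transgressionFun π α.toFun 1 f.1 _ = 1
    simp [transgressionFun, α.one_left, α.one_mid]
  id_right f := by
    change transgressionFun π α.toFun f.1 1 _ = 1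
    simp [transgressionFun, α.one_left, α.one_mid, α.one_right]

end Loops

/-! ## Twisted representations of groupoids and their induction -/

section GroupoidReps

/-- A family of vector spaces indexed by the objects of `C`, with a linear map for each
morphism. -/
structure BundleData (k : Type w) [Field k] (C : Type u) [Category.{v} C] where
  fib : C → ModuleCat.{v₁} k
  map {x y : C} (f : x ⟶ y) : fib x →ₗ[k] fib y

variable {k : Type w} [Field k]

/-- The laws of a `θ`-twisted representation (a `θ`-twisted vector bundle) of `C`. -/
structure BundleData.IsTwisted {C : Type u} [Category.{v} C] (E : BundleData.{w, v, u, v₁} k C)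
    (θ : TwoCocycle k C) : Prop where
  map_id (x : C) : E.map (𝟙 x) = LinearMap.id
  map_comp {x y z : C} (f₂ : y ⟶ z) (f₁ : x ⟶ y) :
    E.map f₂ ∘ₗ E.map f₁ = (θ.toFun f₂ f₁ : k) • E.map (f₁ ≫ f₂)

/-- Isomorphisms of (twisted) representations. -/
structure BundleData.Iso {C : Type u} [Category.{v} C] (E : BundleData.{w, v, u, v₁} k C)
    (E' : BundleData.{w, v, u, v₂} k C) where
  equiv (x : C) : E.fib x ≃ₗ[k] E'.fib x
  comm {x y : C} (f : x ⟶ y) (e : E.fib x) : equiv y (E.map f e) = E'.map f (equiv x e)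

variable {C : Type u₁} [Category.{v₁} C] {D : Type u₂} [Category.{v₂} D]

open scoped DirectSum Classical in
/-- The relations `s ⊗ a v = θ(s, F a) (s ∘ F a) ⊗ v` in the direct sum of copies `s ⊗ E y` of
`E y`, over all objects `y` of `C` and all morphisms `s : F y ⟶ x`. -/
noncomputable def indRel (F : C ⥤ D) (θ : TwoCocycle k D) (E : BundleData.{w, v₁, u₁, v₃} k C)
    (x : D) : Submodule k (⨁ p : (y : C) × (F.obj y ⟶ x), E.fib p.1) :=
  Submodule.span k {z | ∃ (y y' : C) (a : y ⟶ y') (s : F.obj y' ⟶ x) (v : E.fib y),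
    z = DirectSum.lof k _ (fun p : (y : C) × (F.obj y ⟶ x) => E.fib p.1) ⟨y', s⟩ (E.map a v) -
      (θ.toFun s (F.map a) : k) •
        DirectSum.lof k _ (fun p : (y : C) × (F.obj y ⟶ x) => E.fib p.1) ⟨y, F.map a ≫ s⟩ v}

open scoped DirectSum Classical in
/-- Translation by `f`, `s ⊗ v ↦ θ(f, s) (f ∘ s) ⊗ v`, before passing to the quotient. -/
noncomputable def indPreMap (F : C ⥤ D) (θ : TwoCocycle k D) (E : BundleData.{w, v₁, u₁, v₃} k C)
    {x x' : D} (f : x ⟶ x') :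
    (⨁ p : (y : C) × (F.obj y ⟶ x), E.fib p.1) →ₗ[k]
      (⨁ p : (y : C) × (F.obj y ⟶ x'), E.fib p.1) :=
  DirectSum.toModule k _ _ fun p => (θ.toFun f p.2 : k) •
    DirectSum.lof k _ (fun p : (y : C) × (F.obj y ⟶ x') => E.fib p.1) ⟨p.1, p.2 ≫ f⟩

theorem indRel_le (F : C ⥤ D) (θ : TwoCocycle k D) (E : BundleData.{w, v₁, u₁, v₃} k C)
    {x x' : D} (f : x ⟶ x') :
    indRel F θ E x ≤ (indRel F θ E x').comap (indPreMap F θ E f) := by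
  classical
  refine Submodule.span_le.2 ?_
  rintro z ⟨y, y', a, s, v, rfl⟩
  have h : DirectSum.lof k _ (fun p : (y : C) × (F.obj y ⟶ x') => E.fib p.1)
      ⟨y, (F.map a ≫ s) ≫ f⟩ v =
      DirectSum.lof k _ (fun p : (y : C) × (F.obj y ⟶ x') => E.fib p.1)
        ⟨y, F.map a ≫ s ≫ f⟩ v := by
    rw [Category.assoc]
  have hc := congrArg (Units.val : kˣ → k) (θ.cocycle f s (F.map a))
  simp only [Units.val_mul] at hc
  have key : indPreMap F θ E f
      (DirectSum.lof k _ (fun p : (y : C) × (F.obj y ⟶ x) => E.fib p.1) ⟨y', s⟩ (E.map a v) -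
      (θ.toFun s (F.map a) : k) •
        DirectSum.lof k _ (fun p : (y : C) × (F.obj y ⟶ x) => E.fib p.1) ⟨y, F.map a ≫ s⟩ v) =
      (θ.toFun f s : k) •
        (DirectSum.lof k _ (fun p : (y : C) × (F.obj y ⟶ x') => E.fib p.1) ⟨y', s ≫ f⟩
            (E.map a v) -
          (θ.toFun (s ≫ f) (F.map a) : k) •
            DirectSum.lof k _ (fun p : (y : C) × (F.obj y ⟶ x') => E.fib p.1)
              ⟨y, F.map a ≫ s ≫ f⟩ v) := by
    simp only [indPreMap, map_sub, map_smul, DirectSum.toModule_lof, LinearMap.smul_apply,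
      smul_sub, smul_smul, hc, h]
    rw [mul_comm]
  simp only [Submodule.comap_coe, Set.mem_preimage, SetLike.mem_coe]
  rw [key]
  exact Submodule.smul_mem _ _ (Submodule.subset_span ⟨y, y', a, s ≫ f, v, rfl⟩)

open scoped DirectSum in
/-- Twisted induction along a functor `F`, that is, `k^θ[D] ⊗_{k^θ[C]} E`: the fibre over `x` is
spanned by symbols `s ⊗ v` with `s : F y ⟶ x` and `v ∈ E y`, modulo
`s ⊗ a v = θ(s, F a) (s ∘ F a) ⊗ v`, and a morphism `f` acts by `s ⊗ v ↦ θ(f, s) (f ∘ s) ⊗ v`. -/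
noncomputable def ind (F : C ⥤ D) (θ : TwoCocycle k D) (E : BundleData.{w, v₁, u₁, v₃} k C) :
    BundleData.{w, v₂, u₂, max v₃ u₁ v₂} k D where
  fib x := ModuleCat.of k
    ((⨁ p : (y : C) × (F.obj y ⟶ x), E.fib p.1) ⧸ indRel F θ E x)
  map f := Submodule.mapQ _ _ (indPreMap F θ E f) (indRel_le F θ E f)

open scoped Classical in
/-- The element `s ⊗ v` of the induced representation. -/
noncomputable def indMk (F : C ⥤ D) (θ : TwoCocycle k D) (E : BundleData.{w, v₁, u₁, v₃} k C)
    {x : D} {y : C} (s : F.obj y ⟶ x) (v : E.fib y) : (ind F θ E).fib x :=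
  Submodule.Quotient.mk (DirectSum.lof k _
    (fun p : (y : C) × (F.obj y ⟶ x) => E.fib p.1) ⟨y, s⟩ v)

end GroupoidReps

/-! ## The Real categorical character -/

section Character

variable {k : Type w} [Field k] {Γ : Type u₁} [Group Γ] {π : Γ →* ℤˣ}
  {V : Type u} [Category.{v} V] [Preadditive V] [Linear k V]

namespace RealTwoRepData

variable (ρ : RealTwoRepData k π V)

/-- The categorical trace of `ρ(g)`, the vector space of natural transformations from `1_V` to
`ρ(g)`. -/
abbrev Tr (g : Loop π) : Type (max u v) := (Signed.unit (C := V) g.deg ⟶ ρ.act g.el)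

/-- The component `x ⟶ ρ(g)(x)` at `x` of an element of the categorical trace. -/
def trApp {g : Loop π} (φ : ρ.Tr g) (x : V) : x ⟶ ρ.obj g.el x := φ.app ⟨x⟩

/-- The cap `ρ(ω) ∘ {}^{π(ω)}ρ(ω⁻¹) ≅ 1_V`. -/
def cap (ω ω' : Γ) (h : ω * ω' = 1) (x : V) : ρ.obj ω (ρ.obj ω' x) ≅ x :=
  ρ.psiApp ω ω' 1 h x ≪≫ ρ.psiEApp x

/-- A morphism `x ⟶ y` of `V`, read in `Signed ε V` with `ε = 1`. -/
def posHom {ε : ℤˣ} (h : ε = 1) {x y : V} (f : x ⟶ y) : (⟨x⟩ : Signed ε V) ⟶ ⟨y⟩ :=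
  ⟨fun _ => f, fun h' => absurd (h.symm.trans h') (by decide)⟩

/-- Bending an element `φ : 1_V ⟹ ρ(g)` of the categorical trace into a transformation
`ρ(g⁻¹) ⟹ 1_V`, namely `ρ(g⁻¹) ⟹ ρ(g⁻¹) ∘ ρ(g) ⟹ 1_V`. -/
def bend {g : Loop π} (φ : ρ.Tr g) (x : V) : ρ.obj g.el⁻¹ x ⟶ x :=
  (ρ.act g.el⁻¹).map (posHom (by rw [map_inv, g.deg, inv_one]) (ρ.trApp φ x)) ≫
    (ρ.cap g.el⁻¹ g.el (inv_mul_cancel _) x).hom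

/-- An element `φ` of the categorical trace of `ρ(g)`, viewed as a transformation
`1 ⟹ {}^{ε}ρ(g^ε)` of endofunctors of `{}^{ε}V`: it is `φ` if `ε = 1`, and the opposite of the
bent transformation `ρ(g⁻¹) ⟹ 1_V` if `ε = -1`. -/
def signedTr (ε : ℤˣ) {g : Loop π} (p : Γ) (hp : p = g.el ^ (ε : ℤ)) (φ : ρ.Tr g) (x : V) :
    (⟨x⟩ : Signed ε V) ⟶ ⟨ρ.obj p x⟩ :=
  ⟨fun h => ρ.trApp φ x ≫ (ρ.castIso (by rw [hp, h]; simp) rfl).hom,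
   fun h => (ρ.castIso (by rw [hp, h]; simp) rfl).hom ≫ ρ.bend φ x⟩

/-- The morphism `{}^{ε₂}ρ(ω₁)(f)` of `Signed ε₂ V`. -/
def innerMap {ε ε₂ : ℤˣ} (ω₁ : Γ) (h : ε = ε₂ * π ω₁) {x y : V}
    (f : (⟨x⟩ : Signed ε V) ⟶ ⟨y⟩) : (⟨ρ.obj ω₁ x⟩ : Signed ε₂ V) ⟶ ⟨ρ.obj ω₁ y⟩ :=
  (Signed.functor ε₂ (ρ.act ω₁)).map ((Signed.split h).map f)

theorem psiApp_naturality (ω₂ ω₁ ω : Γ) (h : ω₂ * ω₁ = ω) (h' : π ω = π ω₂ * π ω₁) {x y : V}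
    (f : (⟨x⟩ : Signed (π ω) V) ⟶ ⟨y⟩) :
    (ρ.act ω₂).map (ρ.innerMap ω₁ h' f) ≫ (ρ.psiApp ω₂ ω₁ ω h y).hom =
      (ρ.psiApp ω₂ ω₁ ω h x).hom ≫ (ρ.act ω).map f :=
  (ρ.psi ω₂ ω₁ ω h).hom.naturality f

theorem psiEApp_naturality {x y : V} (f : (⟨x⟩ : Signed (π 1) V) ⟶ ⟨y⟩) :
    (ρ.act 1).map f ≫ (ρ.psiEApp y).hom = (ρ.psiEApp x).hom ≫ f.pos (map_one π) :=
  ρ.psiE.hom.naturality f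

theorem cap_naturality (ω ω' : Γ) (h : ω * ω' = 1) (h' : π 1 = π ω * π ω') {x y : V}
    (f : x ⟶ y) :
    (ρ.act ω).map (ρ.innerMap ω' h' (posHom (map_one π) f)) ≫ (ρ.cap ω ω' h y).hom =
      (ρ.cap ω ω' h x).hom ≫ f := by
  have h₁ := ρ.psiApp_naturality ω ω' 1 h h' (posHom (map_one π) f)
  have h₂ := ρ.psiEApp_naturality (posHom (map_one π) f)
  simp only [cap, Iso.trans_hom, Category.assoc]
  rw [← Category.assoc, h₁, Category.assoc, h₂]
  rfl

theorem castIso_naturality {p q : Γ} (h : p = q) {x y : V} (f : x ⟶ y) (hp : π p = 1)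
    (hq : π q = 1) :
    (ρ.act p).map (posHom hp f) ≫ (ρ.castIso h rfl).hom =
      (ρ.castIso h rfl).hom ≫ (ρ.act q).map (posHom hq f) := by
  subst h
  simp [castIso]

theorem trApp_naturality {g : Loop π} (φ : ρ.Tr g) {x y : V} (f : x ⟶ y) :
    f ≫ ρ.trApp φ y = ρ.trApp φ x ≫ (ρ.act g.el).map (posHom g.deg f) :=
  φ.naturality (posHom g.deg f : (⟨x⟩ : Signed (π g.el) V) ⟶ ⟨y⟩)

set_option linter.unusedSectionVars false in
theorem posHom_comp {ε : ℤˣ} (h : ε = 1) {x y z : V} (f : x ⟶ y) (g : y ⟶ z) :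
    (posHom h (f ≫ g) : (⟨x⟩ : Signed ε V) ⟶ ⟨z⟩) = posHom h f ≫ posHom h g := by
  ext h'
  · rfl
  · exact absurd (h.symm.trans h') (by decide)

theorem innerMap_pos {ε ε₂ : ℤˣ} (p : Γ) (hp : π p = 1) (h : ε = ε₂ * π p) {x y : V}
    (f : (⟨x⟩ : Signed ε V) ⟶ ⟨y⟩) :
    ρ.innerMap p h f =
      ⟨fun h' => (ρ.act p).map (posHom hp (f.pos (by rw [h, hp, h', mul_one]))),
        fun h' => (ρ.act p).map (posHom hp (f.neg (by rw [h, hp, h', mul_one])))⟩ := by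
  ext h'
  · refine congrArg (ρ.act p).map ?_
    ext h''
    · rfl
    · exact absurd (hp.symm.trans h'') (by decide)
  · refine congrArg (ρ.act p).map ?_
    ext h''
    · rfl
    · exact absurd (hp.symm.trans h'') (by decide)

theorem bend_naturality {g : Loop π} (φ : ρ.Tr g) {x y : V} (f : x ⟶ y)
    (hg : π g.el⁻¹ = 1) :
    (ρ.act g.el⁻¹).map (posHom hg f) ≫ ρ.bend φ y = ρ.bend φ x ≫ f := by
  have h₁ := ρ.cap_naturality g.el⁻¹ g.el (inv_mul_cancel _) (by rw [← map_mul, inv_mul_cancel]) f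
  have h₂ : (posHom hg f : (⟨x⟩ : Signed (π g.el⁻¹) V) ⟶ ⟨y⟩) ≫ posHom hg (ρ.trApp φ y) =
      posHom hg (ρ.trApp φ x) ≫ ρ.innerMap g.el (by rw [← map_mul, inv_mul_cancel])
        (posHom (map_one π) f) := by
    rw [← posHom_comp, trApp_naturality, posHom_comp]
    congr 1
    rw [ρ.innerMap_pos g.el g.deg]
    ext h'
    · rfl
    · exact absurd (hg.symm.trans h') (by decide)
  simp only [bend, Category.assoc]
  rw [← h₁, ← Category.assoc, ← Category.assoc, ← Functor.map_comp, ← Functor.map_comp, h₂]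

theorem signedTr_naturality {ε : ℤˣ} {g : Loop π} (p : Γ) (hp : p = g.el ^ (ε : ℤ))
    (hp' : π p = 1) (φ : ρ.Tr g) {x y : Signed ε V} (A : x ⟶ y) :
    A ≫ ρ.signedTr ε p hp φ y.un = (ρ.signedTr ε p hp φ x.un : x ⟶ _) ≫
      (⟨fun h => (ρ.act p).map (posHom hp' (A.pos h)),
        fun h => (ρ.act p).map (posHom hp' (A.neg h))⟩ :
          (⟨ρ.obj p x.un⟩ : Signed ε V) ⟶ ⟨ρ.obj p y.un⟩) := by
  ext h
  · simp only [Signed.comp_pos, signedTr, Category.assoc]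
    rw [← Category.assoc, trApp_naturality, Category.assoc, castIso_naturality _ _ _ g.deg hp']
  · simp only [Signed.comp_neg, signedTr, Category.assoc]
    rw [← bend_naturality ρ φ (A.neg h) (by rw [map_inv, g.deg, inv_one]), ← Category.assoc,
      ← Category.assoc, castIso_naturality]

theorem loop_zpow_deg (g : Loop π) (n : ℤ) : π (g.el ^ n) = 1 := by
  rw [map_zpow, g.deg, one_zpow]

/-- The component at `x` of `β_{g,ω}(φ)`, where `g' = ω g^{π(ω)} ω⁻¹`:
`1 ⟹ ρ(ω) ρ(ω⁻¹) ⟹ ρ(ω) ρ(g^{π(ω)}) ρ(ω⁻¹) ⟹ ρ(ω g^{π(ω)}) ρ(ω⁻¹) ⟹ ρ(g') ρ(ω) ρ(ω⁻¹) ⟹ ρ(g')`.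
-/
def betaApp {g g' : Loop π} (ω : Γ) (hω : realConj π ω g.el = g'.el) (φ : ρ.Tr g) (x : V) :
    x ⟶ ρ.obj g'.el x :=
  (ρ.cap ω ω⁻¹ (mul_inv_cancel _) x).inv ≫
    (ρ.act ω).map (ρ.signedTr (π ω) (g.el ^ ((π ω : ℤˣ) : ℤ)) rfl φ (ρ.obj ω⁻¹ x)) ≫
    (ρ.psiApp ω (g.el ^ ((π ω : ℤˣ) : ℤ)) (ω * g.el ^ ((π ω : ℤˣ) : ℤ)) rfl
      (ρ.obj ω⁻¹ x)).hom ≫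
    (ρ.psiApp g'.el ω (ω * g.el ^ ((π ω : ℤˣ) : ℤ)) (by
      rw [← hω, realConj, inv_mul_cancel_right]) (ρ.obj ω⁻¹ x)).inv ≫
    (ρ.actIso g'.el (ρ.cap ω ω⁻¹ (mul_inv_cancel _) x)).hom

theorem betaApp_naturality {g g' : Loop π} (ω : Γ) (hω : realConj π ω g.el = g'.el)
    (φ : ρ.Tr g) {x y : V} (f : (⟨x⟩ : Signed (π g'.el) V) ⟶ ⟨y⟩) :
    f.pos g'.deg ≫ ρ.betaApp ω hω φ y = ρ.betaApp ω hω φ x ≫ (ρ.act g'.el).map f := by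
  have hp' : π (g.el ^ ((π ω : ℤˣ) : ℤ)) = 1 := loop_zpow_deg g _
  have hg' : g'.el * ω = ω * g.el ^ ((π ω : ℤˣ) : ℤ) := by
    rw [← hω, realConj, inv_mul_cancel_right]
  have h₀ : π 1 = π ω * π ω⁻¹ := by rw [← map_mul, mul_inv_cancel]
  generalize hp : g.el ^ ((π ω : ℤˣ) : ℤ) = p at hp' hg'
  have hc : π (ω * p) = π ω := by rw [map_mul, hp', mul_one]
  let A : (⟨ρ.obj ω⁻¹ x⟩ : Signed (π ω) V) ⟶ ⟨ρ.obj ω⁻¹ y⟩ :=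
    ρ.innerMap ω⁻¹ h₀ (posHom (map_one π) (f.pos g'.deg))
  let A' : (⟨ρ.obj ω⁻¹ x⟩ : Signed (π (ω * p)) V) ⟶ ⟨ρ.obj ω⁻¹ y⟩ :=
    ⟨fun h => A.pos (hc.symm.trans h), fun h => A.neg (hc.symm.trans h)⟩
  have e₁ := ρ.cap_naturality ω ω⁻¹ (mul_inv_cancel _) h₀ (f.pos g'.deg)
  have e₁' : f.pos g'.deg ≫ (ρ.cap ω ω⁻¹ (mul_inv_cancel _) y).inv =
      (ρ.cap ω ω⁻¹ (mul_inv_cancel _) x).inv ≫ (ρ.act ω).map A := by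
    rw [Iso.comp_inv_eq, Category.assoc, Iso.eq_inv_comp, e₁]
  have e₂ := ρ.signedTr_naturality p hp.symm hp' φ A
  have e₃ := ρ.psiApp_naturality ω p (ω * p) rfl (map_mul _ _ _) A'
  have e₃' : ρ.innerMap p (map_mul π ω p) A' =
      (⟨fun h => (ρ.act p).map (posHom hp' (A.pos h)),
        fun h => (ρ.act p).map (posHom hp' (A.neg h))⟩ :
          (⟨ρ.obj p (ρ.obj ω⁻¹ x)⟩ : Signed (π ω) V) ⟶ ⟨ρ.obj p (ρ.obj ω⁻¹ y)⟩) :=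
    ρ.innerMap_pos p hp' _ A'
  have hd : π (ω * p) = π g'.el * π ω := by rw [← map_mul, hg']
  have e₄ := ρ.psiApp_naturality g'.el ω (ω * p) hg' hd A'
  have e₄' : (ρ.act (ω * p)).map A' ≫ (ρ.psiApp g'.el ω (ω * p) hg' (ρ.obj ω⁻¹ y)).inv =
      (ρ.psiApp g'.el ω (ω * p) hg' (ρ.obj ω⁻¹ x)).inv ≫
        (ρ.act g'.el).map (ρ.innerMap ω hd A') := by
    rw [Iso.comp_inv_eq, Category.assoc, Iso.eq_inv_comp, e₄]
  have e₅ : ρ.innerMap ω hd A' ≫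
        (Signed.iso (π g'.el) (ρ.cap ω ω⁻¹ (mul_inv_cancel _) y)).hom =
      (Signed.iso (π g'.el) (ρ.cap ω ω⁻¹ (mul_inv_cancel _) x)).hom ≫ f := by
    ext h
    · exact e₁
    · exact absurd (g'.deg.symm.trans h) (by decide)
  have e₅' : (ρ.act g'.el).map (ρ.innerMap ω hd A') ≫
        (ρ.actIso g'.el (ρ.cap ω ω⁻¹ (mul_inv_cancel _) y)).hom =
      (ρ.actIso g'.el (ρ.cap ω ω⁻¹ (mul_inv_cancel _) x)).hom ≫ (ρ.act g'.el).map f := by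
    have := congrArg (ρ.act g'.el).map e₅
    rw [Functor.map_comp, Functor.map_comp] at this
    exact this
  rw [e₃'] at e₃
  subst hp
  simp only [betaApp, Category.assoc]
  rw [← e₅', ← reassoc_of% e₄', ← reassoc_of% e₃, ← Functor.map_comp_assoc, reassoc_of% e₁',
    ← Functor.map_comp_assoc]
  congr 3

/-- The component form of an element of the categorical trace determines it. -/
theorem tr_ext {g : Loop π} {φ φ' : ρ.Tr g} (h : ∀ x, ρ.trApp φ x = ρ.trApp φ' x) : φ = φ' := by
  ext ⟨x⟩
  exact h x

theorem trApp_add {g : Loop π} (φ φ' : ρ.Tr g) (x : V) :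
    ρ.trApp (φ + φ') x = ρ.trApp φ x + ρ.trApp φ' x := rfl

theorem trApp_smul {g : Loop π} (c : k) (φ : ρ.Tr g) (x : V) :
    ρ.trApp (c • φ) x = c • ρ.trApp φ x := rfl

theorem posHom_add {ε : ℤˣ} (h : ε = 1) {x y : V} (f g : x ⟶ y) :
    (posHom h (f + g) : (⟨x⟩ : Signed ε V) ⟶ ⟨y⟩) = posHom h f + posHom h g := by
  ext h'
  · rfl
  · exact absurd (h.symm.trans h') (by decide)

theorem posHom_smul {ε : ℤˣ} (h : ε = 1) (c : k) {x y : V} (f : x ⟶ y) :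
    (posHom h (c • f) : (⟨x⟩ : Signed ε V) ⟶ ⟨y⟩) = c • posHom h f := by
  ext h'
  · rfl
  · exact absurd (h.symm.trans h') (by decide)

theorem signedTr_add (ε : ℤˣ) {g : Loop π} (p : Γ) (hp : p = g.el ^ (ε : ℤ)) (φ φ' : ρ.Tr g)
    (x : V) : ρ.signedTr ε p hp (φ + φ') x = ρ.signedTr ε p hp φ x + ρ.signedTr ε p hp φ' x := by
  ext h
  · simp [signedTr, trApp_add]
  · simp [signedTr, bend, trApp_add, posHom_add]

theorem signedTr_smul (ε : ℤˣ) {g : Loop π} (p : Γ) (hp : p = g.el ^ (ε : ℤ)) (c : k)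
    (φ : ρ.Tr g) (x : V) : ρ.signedTr ε p hp (c • φ) x = c • ρ.signedTr ε p hp φ x := by
  ext h
  · simp [signedTr, trApp_smul]
  · simp [signedTr, bend, trApp_smul, posHom_smul]

/-- The map `β_{g,ω}` of categorical traces, where `g' = ω g^{π(ω)} ω⁻¹`. -/
def beta {g g' : Loop π} (ω : Γ) (hω : realConj π ω g.el = g'.el) : ρ.Tr g →ₗ[k] ρ.Tr g' where
  toFun φ := ⟨fun x => ρ.betaApp ω hω φ x.un, fun _ _ f => ρ.betaApp_naturality ω hω φ f⟩
  map_add' φ φ' := ρ.tr_ext fun x => by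
    change ρ.betaApp ω hω (φ + φ') x = ρ.betaApp ω hω φ x + ρ.betaApp ω hω φ' x
    simp [betaApp, signedTr_add]
  map_smul' c φ := ρ.tr_ext fun x => by
    change ρ.betaApp ω hω (c • φ) x = c • ρ.betaApp ω hω φ x
    simp [betaApp, signedTr_smul]

/-- The Real categorical character of `ρ`: over the loop `g` the categorical trace of `ρ(g)`, on
which the morphism `ω` of loops acts by `β_{g,ω}`. -/
def realCatChar : BundleData.{w, u₁, u₁, max u v} k (Loop π) where
  fib g := ModuleCat.of k (ρ.Tr g)
  map f := ρ.beta f.1 f.2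

end RealTwoRepData
end Character

/-! ## Linearity of signed functors -/

section SignedFunctorsLinear

variable {k : Type w} [Field k] {C : Type u₁} [Category.{v₁} C] [Preadditive C] [Linear k C]
  {D : Type u₂} [Category.{v₂} D] [Preadditive D] [Linear k D]

instance signedFunctor_additive (ε : ℤˣ) (F : C ⥤ D) [F.Additive] :
    (Signed.functor ε F).Additive where
  map_add {_ _ _ _} := Signed.hom_ext _ _ (fun _ => F.map_add) (fun _ => F.map_add)

instance signedFunctor_linear (ε : ℤˣ) (F : C ⥤ D) [F.Additive] [F.Linear k] :
    (Signed.functor ε F).Linear k where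
  map_smul {_ _} _ c := Signed.hom_ext _ _ (fun _ => F.map_smul c _) (fun _ => F.map_smul c _)

instance split_additive {ε ε₂ ε₁ : ℤˣ} (h : ε = ε₂ * ε₁) :
    (Signed.split (C := C) h).Additive where
  map_add {_ _ _ _} := rfl

instance split_linear {ε ε₂ ε₁ : ℤˣ} (h : ε = ε₂ * ε₁) :
    (Signed.split (C := C) h).Linear k where
  map_smul {_ _} _ _ := rfl

instance merge_additive {ε ε₂ ε₁ : ℤˣ} (h : ε = ε₂ * ε₁) :
    (Signed.merge (C := C) h).Additive where
  map_add {_ _ _ _} := by ext h' <;> by_cases h₂ : ε₂ = 1 <;> simp [h₂] <;> rfl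

instance merge_linear {ε ε₂ ε₁ : ℤˣ} (h : ε = ε₂ * ε₁) :
    (Signed.merge (C := C) h).Linear k where
  map_smul {_ _} _ _ := by ext h' <;> by_cases h₂ : ε₂ = 1 <;> simp [h₂] <;> rfl

/-- An isomorphism multiplied by a unit of `k`. -/
@[simps]
def smulIso (c : kˣ) {x y : C} (e : x ≅ y) : x ≅ y where
  hom := (c : k) • e.hom
  inv := ((c⁻¹ : kˣ) : k) • e.inv
  hom_inv_id := by simp [smul_smul]
  inv_hom_id := by simp [smul_smul]

theorem smul_square (c : k) {x y z t : C} (f : x ⟶ y) (g : y ⟶ z) (f' : x ⟶ t) (g' : t ⟶ z)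
    (h : f ≫ g = f' ≫ g') : f ≫ (c • g) = (c • f') ≫ g' := by
  rw [Linear.comp_smul, Linear.smul_comp, h]

end SignedFunctorsLinear

/-! ## Real induction -/

section Induction

theorem Signed.merge_functor_split {C : Type u₁} [Category.{v₁} C] {D : Type u₂} [Category.{v₂} D]
    {c a b s t e m r : ℤˣ} (hc : c = a * b) (hr : r = b * s) (hr' : r = t * e) (hm : m = a * t)
    (hm' : c * s = m * e) (F : Signed e C ⥤ D) {x y : Signed s C}
    (f : (⟨x⟩ : Signed c (Signed s C)) ⟶ ⟨y⟩) :
    (Signed.merge hm).map ((Signed.functor a (Signed.merge hr ⋙ Signed.split hr' ⋙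
      Signed.functor t F)).map ((Signed.split hc).map f)) =
      (Signed.functor m F).map ((Signed.split hm').map ((Signed.merge rfl).map f)) := by
  subst hc hm hr
  rcases Int.units_eq_one_or a with rfl | rfl <;> rcases Int.units_eq_one_or b with rfl | rfl <;>
    rcases Int.units_eq_one_or s with rfl | rfl <;> rcases Int.units_eq_one_or t with rfl | rfl <;>
    ext h <;> rfl

variable {k : Type w} [Field k] {Γ : Type u₁} [Group Γ] {π : Γ →* ℤˣ} {H : Subgroup Γ}
  {V : Type u} [Category.{v} V] [Preadditive V] [Linear k V]

/-- For a transversal `σ` of `Γ ⧸ H` and `ω i = j`, the element `η` of `H` with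
`ω σ_i = σ_j η`. -/
def trans (σ : Γ ⧸ H → Γ) (hσ : ∀ q, (σ q : Γ ⧸ H) = q) (ω : Γ) (i j : Γ ⧸ H) (h : ω • i = j) :
    H :=
  ⟨(σ j)⁻¹ * (ω * σ i), by
    rw [← QuotientGroup.eq, hσ j, ← h]
    conv_lhs => rw [← hσ i]
    rfl⟩

theorem trans_mul (σ : Γ ⧸ H → Γ) (hσ : ∀ q, (σ q : Γ ⧸ H) = q) (ω₂ ω₁ ω : Γ) (hω : ω₂ * ω₁ = ω)
    (i j l : Γ ⧸ H) (h₁ : ω₁ • i = j) (h₂ : ω₂ • j = l) (h : ω • i = l) :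
    trans σ hσ ω₂ j l h₂ * trans σ hσ ω₁ i j h₁ = trans σ hσ ω i l h := by
  apply Subtype.ext
  simp [trans, ← hω, mul_assoc]

theorem trans_one (σ : Γ ⧸ H → Γ) (hσ : ∀ q, (σ q : Γ ⧸ H) = q) (i j : Γ ⧸ H)
    (h : (1 : Γ) • i = j) : trans σ hσ 1 i j h = 1 := by
  apply Subtype.ext
  have : i = j := by rw [← h, one_smul]
  subst this
  simp [trans]

theorem trans_deg (σ : Γ ⧸ H → Γ) (hσ : ∀ q, (σ q : Γ ⧸ H) = q) (ω : Γ) (i j : Γ ⧸ H)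
    (h : ω • i = j) :
    π ω * π (σ i) = π (σ j) * (π.comp H.subtype) (trans σ hσ ω i j h) := by
  rw [MonoidHom.comp_apply, ← map_mul, ← map_mul]
  simp [trans]

/-- The category underlying the Real induction: the product over `q ∈ Γ ⧸ H` of the categories
`{}^{π(σ_q)}V`. -/
abbrev RIndCat (π : Γ →* ℤˣ) (V : Type u) (σ : Γ ⧸ H → Γ) : Type (max u₁ u) :=
  ∀ q : Γ ⧸ H, Signed (π (σ q)) V

namespace RealTwoRepData

variable (ρ : RealTwoRepData k (π.comp H.subtype) V) (σ : Γ ⧸ H → Γ)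
  (hσ : ∀ q, (σ q : Γ ⧸ H) = q)

/-- The `(j, i)` entry of the action of `ω` on the Real induction, where `ω i = j`. It is
`{}^{π(σ_j)}ρ(η)`, where `ω σ_i = σ_j η`. -/
def rindEntry (ω : Γ) (i j : Γ ⧸ H) (h : ω • i = j) :
    Signed (π ω) (Signed (π (σ i)) V) ⥤ Signed (π (σ j)) V :=
  Signed.merge rfl ⋙ Signed.split (trans_deg σ hσ ω i j h) ⋙
    Signed.functor (π (σ j)) (ρ.act (trans σ hσ ω i j h))

/-- The action of `ω` on the Real induction. -/
def rindAct (ω : Γ) : Signed (π ω) (RIndCat π V σ) ⥤ RIndCat π V σ :=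
  Functor.pi' fun j => Signed.functor (π ω) (Pi.eval (fun q => Signed (π (σ q)) V) (ω⁻¹ • j)) ⋙
    ρ.rindEntry σ hσ ω (ω⁻¹ • j) j (smul_inv_smul ω j)

theorem rindAct_map (ω : Γ) {x y : RIndCat π V σ} (f : (⟨x⟩ : Signed (π ω) (RIndCat π V σ)) ⟶ ⟨y⟩)
    (j : Γ ⧸ H) : (ρ.rindAct σ hσ ω).map f j =
      (ρ.rindEntry σ hσ ω (ω⁻¹ • j) j (smul_inv_smul ω j)).map
        ⟨fun h => f.pos h (ω⁻¹ • j), fun h => f.neg h (ω⁻¹ • j)⟩ := rfl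

instance rindEntry_additive (ω : Γ) (i j : Γ ⧸ H) (h : ω • i = j) :
    (ρ.rindEntry σ hσ ω i j h).Additive := by
  unfold rindEntry; infer_instance

instance rindEntry_linear (ω : Γ) (i j : Γ ⧸ H) (h : ω • i = j) :
    (ρ.rindEntry σ hσ ω i j h).Linear k := by
  unfold rindEntry; infer_instance

instance rindAct_additive (ω : Γ) : (ρ.rindAct σ hσ ω).Additive where
  map_add {x y f g} := funext fun j => by
    have := (ρ.rindEntry σ hσ ω (ω⁻¹ • j) j (smul_inv_smul ω j)).map_add
      (X := ⟨x.un (ω⁻¹ • j)⟩) (Y := ⟨y.un (ω⁻¹ • j)⟩)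
      (f := ⟨fun h => f.pos h (ω⁻¹ • j), fun h => f.neg h (ω⁻¹ • j)⟩)
      (g := ⟨fun h => g.pos h (ω⁻¹ • j), fun h => g.neg h (ω⁻¹ • j)⟩)
    exact this

instance rindAct_linear (ω : Γ) : (ρ.rindAct σ hσ ω).Linear k where
  map_smul {x y} f c := funext fun j => by
    have := (ρ.rindEntry σ hσ ω (ω⁻¹ • j) j (smul_inv_smul ω j)).map_smul c
      (X := ⟨x.un (ω⁻¹ • j)⟩) (Y := ⟨y.un (ω⁻¹ • j)⟩)
      ⟨fun h => f.pos h (ω⁻¹ • j), fun h => f.neg h (ω⁻¹ • j)⟩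
    exact this

/-- The composition isomorphism of the `(l, i)` entries, where `ω₁ i = j` and `ω₂ j = l`. -/
def rindPsiApp (α : ThreeCocycle k π) (ω₂ ω₁ ω : Γ) (hω : ω₂ * ω₁ = ω) (i i' j l : Γ ⧸ H)
    (h₁ : ω₁ • i = j) (h₂ : ω₂ • j = l) (h' : ω • i' = l) (hi : i = i') (x : RIndCat π V σ) :
    (⟨ρ.obj (trans σ hσ ω₂ j l h₂) (ρ.obj (trans σ hσ ω₁ i j h₁) (x i).un)⟩ :
      Signed (π (σ l)) V) ≅ ⟨ρ.obj (trans σ hσ ω i' l h') (x i').un⟩ :=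
  smulIso (α.toFun ω₂ (σ j) (trans σ hσ ω₁ i j h₁ : Γ) /
      (α.toFun ω₂ ω₁ (σ i) *
        α.toFun (σ l) (trans σ hσ ω₂ j l h₂ : Γ) (trans σ hσ ω₁ i j h₁ : Γ)))
    (Signed.iso (π (σ l))
      (ρ.psiApp (trans σ hσ ω₂ j l h₂) (trans σ hσ ω₁ i j h₁) (trans σ hσ ω i l (hi ▸ h'))
          (trans_mul σ hσ ω₂ ω₁ ω hω i j l h₁ h₂ (hi ▸ h')) (x i).un ≪≫
        ρ.castIso (by subst hi; rfl) (by rw [hi])))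

theorem psi_signed_naturality {π' : H →* ℤˣ} (ρ : RealTwoRepData k π' V) (η₂ η₁ η : H)
    (hη : η₂ * η₁ = η) {s m m' : ℤˣ} (hm : m = s * π' η₂) (hm' : m' = m * π' η₁)
    (hn : m' = s * π' η)
    {x y : V} (f : (⟨x⟩ : Signed m' V) ⟶ ⟨y⟩) :
    (ρ.innerMap η₂ hm (ρ.innerMap η₁ hm' f) ≫ (Signed.iso s (ρ.psiApp η₂ η₁ η hη y)).hom :
        (⟨ρ.obj η₂ (ρ.obj η₁ x)⟩ : Signed s V) ⟶ ⟨ρ.obj η y⟩) =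
      (Signed.iso s (ρ.psiApp η₂ η₁ η hη x)).hom ≫ ρ.innerMap η hn f := by
  have hd : π' η = π' η₂ * π' η₁ := by rw [← hη, map_mul]
  ext h
  · exact ρ.psiApp_naturality η₂ η₁ η hη hd ((Signed.split hn).map f |>.pos h)
  · have := ρ.psiApp_naturality η₂ η₁ η hη hd ((Signed.split hn).map f |>.neg h)
    simp only [Signed.comp_neg, Signed.iso_hom_neg]
    rw [Iso.inv_comp_eq, ← Category.assoc, Iso.eq_comp_inv]
    exact this

theorem rindPsiApp_naturality (α : ThreeCocycle k π) (ω₂ ω₁ ω : Γ) (hω : ω₂ * ω₁ = ω)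
    (hd : π ω = π ω₂ * π ω₁) (i i' j l : Γ ⧸ H)
    (h₁ : ω₁ • i = j) (h₂ : ω₂ • j = l) (h' : ω • i' = l) (hi : i = i') {x y : RIndCat π V σ}
    (f : (⟨x⟩ : Signed (π ω) (RIndCat π V σ)) ⟶ ⟨y⟩) :
    (ρ.rindEntry σ hσ ω₂ j l h₂).map
        ((Signed.functor (π ω₂) (ρ.rindEntry σ hσ ω₁ i j h₁)).map ((Signed.split hd).map
          (⟨fun h => f.pos h i, fun h => f.neg h i⟩ : (⟨x i⟩ : Signed (π ω) _) ⟶ ⟨y i⟩))) ≫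
        (ρ.rindPsiApp σ hσ α ω₂ ω₁ ω hω i i' j l h₁ h₂ h' hi y).hom =
      (ρ.rindPsiApp σ hσ α ω₂ ω₁ ω hω i i' j l h₁ h₂ h' hi x).hom ≫
        (ρ.rindEntry σ hσ ω i' l h').map
          (⟨fun h => f.pos h i', fun h => f.neg h i'⟩ : (⟨x i'⟩ : Signed (π ω) _) ⟶ ⟨y i'⟩) := by
  subst hi
  have e₁ := Signed.merge_functor_split hd rfl (trans_deg σ hσ ω₁ i j h₁) rfl
    (show π ω * π (σ i) = π ω₂ * π (σ j) * (π.comp H.subtype) (trans σ hσ ω₁ i j h₁) by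
      rw [hd, mul_assoc, trans_deg σ hσ ω₁ i j h₁, mul_assoc]) (ρ.act (trans σ hσ ω₁ i j h₁))
    (⟨fun h => f.pos h i, fun h => f.neg h i⟩ : (⟨x i⟩ : Signed (π ω) _) ⟶ ⟨y i⟩)
  have e₂ := ρ.psi_signed_naturality (trans σ hσ ω₂ j l h₂) (trans σ hσ ω₁ i j h₁)
    (trans σ hσ ω i l h') (trans_mul σ hσ ω₂ ω₁ ω hω i j l h₁ h₂ h')
    (trans_deg σ hσ ω₂ j l h₂)
    (show π ω * π (σ i) = π ω₂ * π (σ j) * (π.comp H.subtype) (trans σ hσ ω₁ i j h₁) by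
      rw [hd, mul_assoc, trans_deg σ hσ ω₁ i j h₁, mul_assoc]) (trans_deg σ hσ ω i l h')
    ((Signed.merge rfl).map
      (⟨fun h => f.pos h i, fun h => f.neg h i⟩ : (⟨x i⟩ : Signed (π ω) _) ⟶ ⟨y i⟩))
  have e₃ : (ρ.rindEntry σ hσ ω₂ j l h₂).map
        ((Signed.functor (π ω₂) (ρ.rindEntry σ hσ ω₁ i j h₁)).map ((Signed.split hd).map
          (⟨fun h => f.pos h i, fun h => f.neg h i⟩ : (⟨x i⟩ : Signed (π ω) _) ⟶ ⟨y i⟩))) =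
      ρ.innerMap (trans σ hσ ω₂ j l h₂) (trans_deg σ hσ ω₂ j l h₂)
        ((Signed.functor _ (ρ.act (trans σ hσ ω₁ i j h₁))).map _) :=
    congrArg (ρ.innerMap (trans σ hσ ω₂ j l h₂) (trans_deg σ hσ ω₂ j l h₂)) e₁
  have e₄ : ∀ z : RIndCat π V σ, (ρ.rindPsiApp σ hσ α ω₂ ω₁ ω hω i i j l h₁ h₂ h' rfl z).hom =
      ((α.toFun ω₂ (σ j) (trans σ hσ ω₁ i j h₁ : Γ) /
        (α.toFun ω₂ ω₁ (σ i) *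
          α.toFun (σ l) (trans σ hσ ω₂ j l h₂ : Γ) (trans σ hσ ω₁ i j h₁ : Γ)) : kˣ) : k) •
        (Signed.iso (π (σ l)) (ρ.psiApp (trans σ hσ ω₂ j l h₂) (trans σ hσ ω₁ i j h₁)
          (trans σ hσ ω i l h') (trans_mul σ hσ ω₂ ω₁ ω hω i j l h₁ h₂ h') (z i).un)).hom := by
    intro z
    simp only [rindPsiApp, smulIso_hom, castIso, eqToIso_refl, Iso.trans_refl]
  rw [e₄, e₄]
  exact (congrArg (· ≫ _) e₃).trans (smul_square _ _ _ _ _ e₂)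

/-- The unit isomorphism of the `(j, i)` entry of the action of `1`, where `i = j`. -/
def rindPsiEApp (i j : Γ ⧸ H) (h : (1 : Γ) • i = j) (hi : i = j) (x : RIndCat π V σ) :
    (⟨ρ.obj (trans σ hσ 1 i j h) (x i).un⟩ : Signed (π (σ j)) V) ≅ x j :=
  Signed.iso (π (σ j)) (ρ.castIso (trans_one σ hσ i j h) (by rw [hi]) ≪≫ ρ.psiEApp (x j).un)

theorem psiE_signed_naturality {π' : H →* ℤˣ} (ρ : RealTwoRepData k π' V) (η : H) (hη : η = 1)
    {s m : ℤˣ} (hm : m = s * π' η) (hm' : m = s) {x y : V} (f : (⟨x⟩ : Signed m V) ⟶ ⟨y⟩) :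
    ρ.innerMap η hm f ≫ (Signed.iso s (ρ.castIso hη rfl ≪≫ ρ.psiEApp y)).hom =
      (Signed.iso s (ρ.castIso hη rfl ≪≫ ρ.psiEApp x)).hom ≫
        (⟨fun h => f.pos (hm'.trans h), fun h => f.neg (hm'.trans h)⟩ :
          (⟨x⟩ : Signed s V) ⟶ ⟨y⟩) := by
  subst hη
  simp only [castIso, eqToIso_refl, Iso.refl_trans]
  ext h
  · exact ρ.psiEApp_naturality (((Signed.split hm).map f).pos h)
  · have := ρ.psiEApp_naturality (((Signed.split hm).map f).neg h)
    simp only [Signed.comp_neg, Signed.iso_hom_neg]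
    rw [Iso.inv_comp_eq, ← Category.assoc, Iso.eq_comp_inv]
    exact this

theorem rindPsiEApp_naturality (i j : Γ ⧸ H) (h : (1 : Γ) • i = j) (hi : i = j)
    {x y : RIndCat π V σ} (f : (⟨x⟩ : Signed (π 1) (RIndCat π V σ)) ⟶ ⟨y⟩) :
    (ρ.rindEntry σ hσ 1 i j h).map
        (⟨fun h => f.pos h i, fun h => f.neg h i⟩ : (⟨x i⟩ : Signed (π 1) _) ⟶ ⟨y i⟩) ≫
        (ρ.rindPsiEApp σ hσ i j h hi y).hom =
      (ρ.rindPsiEApp σ hσ i j h hi x).hom ≫ f.pos (map_one π) j := by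
  subst hi
  have hm : π 1 * π (σ i) = π (σ i) := by rw [map_one, one_mul]
  refine (ρ.psiE_signed_naturality _ (trans_one σ hσ i i h) (trans_deg σ hσ 1 i i h) hm
    ((Signed.merge rfl).map (⟨fun h => f.pos h i, fun h => f.neg h i⟩ :
      (⟨x i⟩ : Signed (π 1) _) ⟶ ⟨y i⟩))).trans (congrArg (_ ≫ ·) ?_)
  have h₁ : (π 1 : ℤˣ) = 1 := map_one π
  refine Signed.hom_ext _ _ (fun h' => ?_) (fun h' => ?_)
  · exact dif_pos h₁
  · exact dif_pos h₁

/-- The Real induction of `ρ` from `H` to `Γ`, with respect to the transversal `σ`. -/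
def rind (α : ThreeCocycle k π) : RealTwoRepData k π (RIndCat π V σ) where
  act := ρ.rindAct σ hσ
  act_additive := ρ.rindAct_additive σ hσ
  act_linear := ρ.rindAct_linear σ hσ
  psi ω₂ ω₁ ω h := NatIso.ofComponents
    (fun x => Pi.isoMk fun l => ρ.rindPsiApp σ hσ α ω₂ ω₁ ω h (ω₁⁻¹ • ω₂⁻¹ • l) (ω⁻¹ • l)
      (ω₂⁻¹ • l) l (smul_inv_smul _ _) (smul_inv_smul _ _) (smul_inv_smul _ _)
      (by rw [← h, mul_inv_rev, mul_smul]) x.un)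
    (fun {_ _} f => funext fun l => ρ.rindPsiApp_naturality σ hσ α ω₂ ω₁ ω h
      (by rw [← h, map_mul]) (ω₁⁻¹ • ω₂⁻¹ • l) (ω⁻¹ • l)
      (ω₂⁻¹ • l) l (smul_inv_smul _ _) (smul_inv_smul _ _) (smul_inv_smul _ _)
      (by rw [← h, mul_inv_rev, mul_smul]) f)
  psiE := NatIso.ofComponents
    (fun x => Pi.isoMk fun l => ρ.rindPsiEApp σ hσ ((1 : Γ)⁻¹ • l) l (smul_inv_smul _ _)
      (by rw [inv_one, one_smul]) x.un)
    (fun {_ _} f => funext fun l => ρ.rindPsiEApp_naturality σ hσ ((1 : Γ)⁻¹ • l) l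
      (smul_inv_smul _ _) (by rw [inv_one, one_smul]) f)

end RealTwoRepData
end Induction

/-! ## The summands of the categorical trace of a Real induction -/

section Summands

variable {k : Type w} [Field k] {Γ : Type u₁} [Group Γ] {π : Γ →* ℤˣ} {H : Subgroup Γ}
  {V : Type u} [Category.{v} V] [Preadditive V] [Linear k V]
  (σ : Γ ⧸ H → Γ) (hσ : ∀ q, (σ q : Γ ⧸ H) = q)

/-- For a coset `q` fixed by the loop `g`, the loop `σ_q⁻¹ g^{π(σ_q)} σ_q` of `BH`. -/
def fixedLoop (g : Loop π) (q : Γ ⧸ H) (hq : g.el • q = q) : Loop (π.comp H.subtype) where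
  el := trans σ hσ g.el q q hq ^ ((π (σ q) : ℤˣ) : ℤ)
  deg := by
    have h := trans_deg (π := π) σ hσ g.el q q hq
    rw [g.deg, one_mul, left_eq_mul] at h
    rw [map_zpow, h, one_zpow]

/-- The representative `σ_q`, as a morphism from `σ_q⁻¹ g^{π(σ_q)} σ_q` to `g` in the unoriented
loop groupoid of `BΓ`. -/
def fixedLoopHom (g : Loop π) (q : Γ ⧸ H) (hq : g.el • q = q) :
    (loopInclusion π H).obj (fixedLoop σ hσ g q hq) ⟶ g :=
  ⟨σ q, by
    rcases Int.units_eq_one_or (π (σ q)) with h | h <;>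
      simp [realConj, loopInclusion, fixedLoop, trans, h, mul_assoc]⟩

/-- For a coset `q` fixed by the loop `g`, the natural transformation `T` from `1` to
`RInd(ρ)(g)` is concentrated in the summand `q`, and there it is `v` if `π(σ_q) = 1` and the
opposite of the bent transformation of `v` if `π(σ_q) = -1`. -/
structure IsSummandOf (ρ : RealTwoRepData k (π.comp H.subtype) V) (α : ThreeCocycle k π)
    (g : Loop π) (q : Γ ⧸ H) (hq : g.el • q = q) (v : ρ.Tr (fixedLoop σ hσ g q hq))
    (T : (ρ.rind σ hσ α).Tr g) : Prop where
  diagonal (x : RIndCat π V σ) (hq' : g.el⁻¹ • q = q) :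
    ((ρ.rind σ hσ α).trApp T x q ≫
        (Signed.iso (π (σ q)) (ρ.castIso
          (x := (x (g.el⁻¹ • q)).un) (x' := (x q).un)
          (show trans σ hσ g.el (g.el⁻¹ • q) q (smul_inv_smul _ _) = trans σ hσ g.el q q hq by
            simp only [hq']) (by rw [hq']))).hom :
        x q ⟶ ⟨ρ.obj (trans σ hσ g.el q q hq) (x q).un⟩) =
      ρ.signedTr (π (σ q)) (trans σ hσ g.el q q hq) (by
        rcases Int.units_eq_one_or (π (σ q)) with h | h <;> simp [fixedLoop, h]) v (x q).un
  off_diagonal (x : RIndCat π V σ) (r : Γ ⧸ H) (hr : r ≠ q) : (ρ.rind σ hσ α).trApp T x r = 0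

end Summands

end RealTwoRep

open RealTwoRep

namespace RealTwoRep

/-! ## Signed functors and equivalences -/

section SignedEquivalences

variable {C : Type u₁} [Category.{v₁} C] {D : Type u₂} [Category.{v₂} D]

/-! Both sides have the same fibre over a loop `g`, namely the product of the traces of `ρ` at the
loops `h_q`, over the cosets `q` fixed by `g`. In the Real induction, `g` acts by a matrix of
functors whose `(j, i)` entry vanishes unless `g i = j`. A natural transformation from the identity
therefore lives on the fixed cosets only (`trApp_rind_eq_zero`), and its component at a fixed `q` is
a natural transformation `1 ⟹ ρ(η)` of endofunctors of `V` or of its opposite, with `η = σ_q⁻¹ g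
σ_q`. Bending turns this into an element of the trace at `h_q = η^{π(σ_q)}`, and bending is a
bijection (`exists_eq_summandEntry`, `summandSum_bijective`). In the induced representation, every
morphism from a loop of `H` to `g` factors uniquely through one of the `σ_q : h_q ⟶ g`
(`isTransversal_fixedLoopHom`), so the symbols `σ_q ⊗ v` give coordinates (`indCoord_bijective`).

What remains is to compare scalars. The definition of `β_{g,ω}` as a five-term composite is awkward
because of the caps at both ends. Since every object is isomorphic to some `ρ(ω)(y)`, the element `T
= β_{g,ω}(φ)` is determined by one equation without caps, `ψ_{g',ω} ∘ T = ψ_{ω,p} ∘ ρ(ω)(φ)` with `p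
= g^{π(ω)}`, where `φ` is bent if `π(ω) = -1` (`trApp_beta`, `eq_beta_of_act`). Every statement
about `β` then becomes a manipulation of `ψ` in which each use of associativity contributes one
value of `α`.

Bending produces two scalars: `flipFactor`, from bending back (`innerMap_signedTr_cap`), and
`bendFactor`, from exchanging bending with `β` (`signedTr_beta`). The transgression is `bendFactor`
times the usual three-term transgression (`transgressionFun_eq`), and this is exactly the scalar in
`β_{ω₂} β_{ω₁}` (`beta_beta`). That the Real induction satisfies twisted associativity is the
alternating sum of four cocycle identities, in which a coset representative moves past three group
elements (`rindFactor_cocycle`). Finally, `f` carries the summand of `v` at `q` to the summand of `η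
v` at `f q`, where `f σ_q = σ_{fq} η`, with scalar `θ(f, σ_q) / θ(σ_{fq}, η)` (`beta_summand`). The
defining relation of the induced representation yields the same scalar. -/

theorem faithful_of_signed (ε : ℤˣ) (F : C ⥤ D) [(Signed.functor ε F).Faithful] : F.Faithful where
  map_injective {x y} f f' h := by
    rcases Int.units_eq_one_or ε with rfl | rfl
    · let a (f : x ⟶ y) : (⟨x⟩ : Signed 1 C) ⟶ ⟨y⟩ := ⟨fun _ => f, fun h => absurd h (by decide)⟩
      have : a f = a f' := (Signed.functor 1 F).map_injective
        (Signed.hom_ext _ _ (fun _ => h) (fun h' => absurd h' (by decide)))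
      exact congrArg (fun a : SHom 1 x y => a.pos rfl) this
    · let a (f : x ⟶ y) : (⟨y⟩ : Signed (-1) C) ⟶ ⟨x⟩ :=
        ⟨fun h => absurd h (by decide), fun _ => f⟩
      have : a f = a f' := (Signed.functor (-1) F).map_injective
        (Signed.hom_ext _ _ (fun h' => absurd h' (by decide)) (fun _ => h))
      exact congrArg (fun a : SHom (-1) y x => a.neg rfl) this

theorem full_of_signed (ε : ℤˣ) (F : C ⥤ D) [(Signed.functor ε F).Full] : F.Full where
  map_surjective {x y} f := by
    rcases Int.units_eq_one_or ε with rfl | rfl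
    · obtain ⟨a, ha⟩ := (Signed.functor 1 F).map_surjective
        (show (Signed.functor 1 F).obj ⟨x⟩ ⟶ (Signed.functor 1 F).obj ⟨y⟩ from
          ⟨fun _ => f, fun h => absurd h (by decide)⟩)
      exact ⟨a.pos rfl, congrArg (fun a : SHom 1 (F.obj x) (F.obj y) => a.pos rfl) ha⟩
    · obtain ⟨a, ha⟩ := (Signed.functor (-1) F).map_surjective
        (show (Signed.functor (-1) F).obj ⟨y⟩ ⟶ (Signed.functor (-1) F).obj ⟨x⟩ from
          ⟨fun h => absurd h (by decide), fun _ => f⟩)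
      exact ⟨a.neg rfl, congrArg (fun a : SHom (-1) (F.obj y) (F.obj x) => a.neg rfl) ha⟩

instance unit_isEquivalence {ε : ℤˣ} (h : ε = 1) : (Signed.unit (C := C) h).IsEquivalence where
  faithful := ⟨fun {_ _} f f' hf => Signed.hom_ext _ _ (fun _ => hf)
    (fun h' => absurd (h.symm.trans h') (by decide))⟩
  full := ⟨fun {_ _} f => ⟨⟨fun _ => f, fun h' => absurd (h.symm.trans h') (by decide)⟩, rfl⟩⟩
  essSurj := ⟨fun x => ⟨⟨x⟩, ⟨Iso.refl _⟩⟩⟩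

instance split_isEquivalence {ε ε₂ ε₁ : ℤˣ} (h : ε = ε₂ * ε₁) :
    (Signed.split (C := C) h).IsEquivalence where
  faithful := ⟨fun {_ _} f f' hf => by
    subst h
    rcases Int.units_eq_one_or ε₂ with rfl | rfl <;> rcases Int.units_eq_one_or ε₁ with rfl | rfl
    · exact Signed.hom_ext _ _ (fun _ => congrArg (fun a => (SHom.pos (SHom.pos a rfl) rfl)) hf)
        (fun h' => absurd h' (by decide))
    · exact Signed.hom_ext _ _ (fun h' => absurd h' (by decide))
        (fun _ => congrArg (fun a => (SHom.neg (SHom.pos a rfl) rfl)) hf)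
    · exact Signed.hom_ext _ _ (fun h' => absurd h' (by decide))
        (fun _ => congrArg (fun a => (SHom.pos (SHom.neg a rfl) rfl)) hf)
    · exact Signed.hom_ext _ _ (fun _ => congrArg (fun a => (SHom.neg (SHom.neg a rfl) rfl)) hf)
        (fun h' => absurd h' (by decide))⟩
  full := ⟨fun {x y} f => ⟨(Signed.merge h).map
      (X := (Signed.split h).obj x) (Y := (Signed.split h).obj y) f, by
    subst h
    rcases Int.units_eq_one_or ε₂ with rfl | rfl <;>
      rcases Int.units_eq_one_or ε₁ with rfl | rfl <;> ext h₂ h₁ <;> first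
        | rfl | exact absurd h₂ (by decide)⟩⟩
  essSurj := ⟨fun x => ⟨⟨x.un.un⟩, ⟨Iso.refl _⟩⟩⟩

end SignedEquivalences

namespace RealTwoRepData

variable {k : Type w} [Field k] {Γ : Type u₁} [Group Γ] {π : Γ →* ℤˣ}
  {V : Type u} [Category.{v} V] [Preadditive V] [Linear k V] (ρ : RealTwoRepData k π V)

/-- After precomposition with the equivalence `Signed.split`, the isomorphisms `ψ` and `ψ_e`
identify this composite with the identity `1`-morphism; two out of three gives the claim. No
coherence law enters, only the existence of the isomorphisms. -/
theorem functor_comp_act_isEquivalence (ω₂ ω₁ : Γ) (h : ω₂ * ω₁ = 1) :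
    (Signed.functor (π ω₂) (ρ.act ω₁) ⋙ ρ.act ω₂).IsEquivalence := by
  have : (Signed.split (C := V) (show π 1 = π ω₂ * π ω₁ by rw [← h, map_mul]) ⋙
      Signed.functor (π ω₂) (ρ.act ω₁) ⋙ ρ.act ω₂).IsEquivalence :=
    Functor.isEquivalence_of_iso (ρ.psi ω₂ ω₁ 1 h ≪≫ ρ.psiE).symm
  exact Functor.isEquivalence_of_comp_left
    (Signed.split (C := V) (show π 1 = π ω₂ * π ω₁ by rw [← h, map_mul])) _

instance act_faithful (ω : Γ) : (ρ.act ω).Faithful := by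
  have := ρ.functor_comp_act_isEquivalence ω⁻¹ ω (inv_mul_cancel ω)
  have : (Signed.functor (π ω⁻¹) (ρ.act ω)).Faithful := Functor.Faithful.of_comp _ (ρ.act ω⁻¹)
  exact faithful_of_signed (π ω⁻¹) _

instance act_full (ω : Γ) : (ρ.act ω).Full := by
  have := ρ.functor_comp_act_isEquivalence ω⁻¹ ω (inv_mul_cancel ω)
  have : (Signed.functor (π ω⁻¹) (ρ.act ω)).Full :=
    Functor.Full.of_comp_faithful _ (ρ.act ω⁻¹)
  exact full_of_signed (π ω⁻¹) _

/-- The functors of a Real `2`-representation are automatically equivalences. -/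
instance act_isEquivalence (ω : Γ) : (ρ.act ω).IsEquivalence where
  essSurj := ⟨fun x => ⟨⟨ρ.obj ω⁻¹ x⟩, ⟨ρ.cap ω ω⁻¹ (mul_inv_cancel ω) x⟩⟩⟩

/-! ## Bookkeeping for signed morphisms -/

@[simp]
theorem innerMap_comp {ε ε₂ : ℤˣ} (ω : Γ) (h : ε = ε₂ * π ω) {x y z : V}
    (f : (⟨x⟩ : Signed ε V) ⟶ ⟨y⟩) (f' : (⟨y⟩ : Signed ε V) ⟶ ⟨z⟩) :
    ρ.innerMap ω h (f ≫ f') = ρ.innerMap ω h f ≫ ρ.innerMap ω h f' := by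
  simp only [innerMap, Functor.map_comp]
  exact Functor.map_comp _ _ _

@[simp]
theorem innerMap_smul {ε ε₂ : ℤˣ} (ω : Γ) (h : ε = ε₂ * π ω) {x y : V} (c : k)
    (f : (⟨x⟩ : Signed ε V) ⟶ ⟨y⟩) : ρ.innerMap ω h (c • f) = c • ρ.innerMap ω h f := by
  simp only [innerMap, Functor.map_smul]
  exact Functor.map_smul _ _ _

theorem innerMap_iso {ε ε₂ : ℤˣ} (ω : Γ) (h : ε = ε₂ * π ω) {x y : V} (e : x ≅ y) :
    ρ.innerMap ω h (Signed.iso ε e).hom = (Signed.iso ε₂ (ρ.actIso ω e)).hom := by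
  subst h
  ext h' <;> refine congrArg (ρ.act ω).map ?_ <;> ext h'' <;> rfl

/-- In sign `1` this is naturality of `ψ`. In sign `-1` all arrows are reversed and `ψ` is replaced
by its inverse, which is the same naturality square read from the opposite corner. -/
theorem innerMap_naturality (η₂ η₁ η : Γ) (hη : η₂ * η₁ = η) {s m m' : ℤˣ} (hm : m = s * π η₂)
    (hm' : m' = m * π η₁) (hn : m' = s * π η) {x y : V} (f : (⟨x⟩ : Signed m' V) ⟶ ⟨y⟩) :
    (ρ.innerMap η₂ hm (ρ.innerMap η₁ hm' f) ≫ (Signed.iso s (ρ.psiApp η₂ η₁ η hη y)).hom :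
        (⟨ρ.obj η₂ (ρ.obj η₁ x)⟩ : Signed s V) ⟶ ⟨ρ.obj η y⟩) =
      (Signed.iso s (ρ.psiApp η₂ η₁ η hη x)).hom ≫ ρ.innerMap η hn f := by
  have hd : π η = π η₂ * π η₁ := by rw [← hη, map_mul]
  ext h
  · exact ρ.psiApp_naturality η₂ η₁ η hη hd ((Signed.split hn).map f |>.pos h)
  · have := ρ.psiApp_naturality η₂ η₁ η hη hd ((Signed.split hn).map f |>.neg h)
    simp only [Signed.comp_neg, Signed.iso_hom_neg]
    rw [Iso.inv_comp_eq, ← Category.assoc, Iso.eq_comp_inv]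
    exact this

/-- The twisted associativity law, for arbitrary names of the products and read in `Signed s V`. -/
theorem IsTwisted.signed_assoc {ρ : RealTwoRepData k π V} {α : Γ → Γ → Γ → kˣ}
    (hρ : ρ.IsTwisted α) (s : ℤˣ) {c b a cb ba m : Γ} (hcb : c * b = cb) (hba : b * a = ba)
    (h : cb * a = m) (h' : c * ba = m) (x : V) :
    ((α c b a ^ (s : ℤ) : kˣ) : k) • ((Signed.iso s (ρ.psiApp c b cb hcb (ρ.obj a x))).hom ≫
        (Signed.iso s (ρ.psiApp cb a m h x)).hom) =
      (Signed.iso s (ρ.actIso c (ρ.psiApp b a ba hba x))).hom ≫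
        (Signed.iso s (ρ.psiApp c ba m h' x)).hom := by
  subst hcb hba h
  have H := hρ.assoc c b a x
  rcases Int.units_eq_one_or s with rfl | rfl
  · ext h₁
    · simpa using H
    · exact absurd h₁ (by decide)
  · ext h₁
    · exact absurd h₁ (by decide)
    -- In sign `-1` the law is obtained by inverting both sides as isomorphisms, which also inverts
    -- the scalar.
    · have H' : smulIso (α c b a) (ρ.psiApp c b (c * b) rfl (ρ.obj a x) ≪≫
            ρ.psiApp (c * b) a (c * b * a) rfl x) =
          ρ.actIso c (ρ.psiApp b a (b * a) rfl x) ≪≫ ρ.psiApp c (b * a) (c * b * a) h' x :=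
        Iso.ext (by simpa using H)
      simpa using congrArg Iso.inv H'

end RealTwoRepData

/-! ## Reversing signed morphisms -/

section Flip

variable {C : Type u} [Category.{v} C] {e e' : ℤˣ}

/-- A morphism of `Signed (-e) C`, read backwards as a morphism of `Signed e C`. -/
def Signed.flip (h : e' = -e) {x y : C} (f : (⟨x⟩ : Signed e' C) ⟶ ⟨y⟩) :
    (⟨y⟩ : Signed e C) ⟶ ⟨x⟩ :=
  ⟨fun h' => f.neg (by rw [h, h']), fun h' => f.pos (by rw [h, h', neg_neg])⟩

theorem Signed.flip_injective (h : e' = -e) {x y : C} :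
    Function.Injective (Signed.flip (C := C) h (x := x) (y := y)) := by
  intro f f' hf
  refine Signed.hom_ext _ _ (fun h' => ?_) (fun h' => ?_)
  · exact congrArg (fun a : SHom e y x => a.neg (by rw [← neg_eq_iff_eq_neg.2 h, h'])) hf
  · exact congrArg (fun a : SHom e y x => a.pos (by rw [← neg_eq_iff_eq_neg.2 h, h', neg_neg])) hf

theorem Signed.flip_comp (h : e' = -e) {x y z : C} (f : (⟨x⟩ : Signed e' C) ⟶ ⟨y⟩)
    (f' : (⟨y⟩ : Signed e' C) ⟶ ⟨z⟩) : flip h (f ≫ f') = flip h f' ≫ flip h f := rfl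

theorem Signed.flip_iso (h : e' = -e) {x y : C} (E : x ≅ y) :
    flip h (Signed.iso e' E).hom = (Signed.iso e E).inv := rfl

theorem Signed.flip_smul {k : Type w} [Field k] [Preadditive C] [Linear k C] (h : e' = -e) {x y : C}
    (c : k) (f : (⟨x⟩ : Signed e' C) ⟶ ⟨y⟩) : flip h (c • f) = c • flip h f := rfl

end Flip

namespace RealTwoRepData

variable {k : Type w} [Field k] {Γ : Type u₁} [Group Γ] {π : Γ →* ℤˣ}
  {V : Type u} [Category.{v} V] [Preadditive V] [Linear k V] (ρ : RealTwoRepData k π V)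

theorem flip_innerMap {e e' s s' : ℤˣ} (ω : Γ) (h : e = s * π ω) (h' : e' = s' * π ω)
    (he : e' = -e) (hs : s' = -s) {x y : V} (f : (⟨x⟩ : Signed e' V) ⟶ ⟨y⟩) :
    Signed.flip hs (ρ.innerMap ω h' f) = ρ.innerMap ω h (Signed.flip he f) := by
  ext h₁ <;> refine congrArg (ρ.act ω).map ?_ <;> ext h₂ <;> rfl

set_option linter.unusedSectionVars false in
theorem iso_hom_eq_posHom {ε : ℤˣ} (h : ε = 1) {x y : V} (E : x ≅ y) :
    (Signed.iso ε E).hom = posHom h E.hom := by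
  ext h'
  · rfl
  · exact absurd (h.symm.trans h') (by decide)

/-! ## A characterization of the action on the categorical character -/

/-- An element of a categorical trace is determined by its components at the objects
`ρ(ω)(y)`. -/
theorem tr_ext_act {g : Loop π} {φ φ' : ρ.Tr g} (ω : Γ)
    (h : ∀ y, ρ.trApp φ (ρ.obj ω y) = ρ.trApp φ' (ρ.obj ω y)) : φ = φ' := by
  refine ρ.tr_ext fun x => ?_
  -- The cap exhibits `x` as isomorphic to an object of the form `ρ(ω)(y)`, and naturality
  -- transports the equality along it.
  have h₁ := ρ.trApp_naturality φ (ρ.cap ω ω⁻¹ (mul_inv_cancel ω) x).hom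
  have h₂ := ρ.trApp_naturality φ' (ρ.cap ω ω⁻¹ (mul_inv_cancel ω) x).hom
  rw [h, ← h₂] at h₁
  exact (cancel_epi _).1 h₁

/-- The cap-free equation that characterizes `β_{g,ω}(φ)`. At the object `ρ(ω)(y)` the cap has the
form `ρ(ω)(A)` because `ρ(ω)` is full. Naturality of `φ` (bent if necessary), of `ψ_{ω,p}` and of
`ψ_{g',ω}` along `A` carries the cap at the end of the composite to the beginning, where it cancels.
No zigzag relation between the two caps of `ω` and `ω⁻¹` is needed, so no twisted law is used. -/
theorem trApp_beta {g g' : Loop π} (ω : Γ) (hω : realConj π ω g.el = g'.el) (φ : ρ.Tr g) {p m : Γ}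
    (hp : p = g.el ^ ((π ω : ℤˣ) : ℤ)) (hm : g'.el * ω = m) (hm' : ω * p = m) (y : V) :
    ρ.trApp (ρ.beta ω hω φ) (ρ.obj ω y) ≫ (ρ.psiApp g'.el ω m hm y).hom =
      (ρ.act ω).map (ρ.signedTr (π ω) p hp φ y) ≫ (ρ.psiApp ω p m hm' y).hom := by
  subst hp hm'
  have hp' : π (g.el ^ ((π ω : ℤˣ) : ℤ)) = 1 := loop_zpow_deg g _
  set c := ρ.cap ω ω⁻¹ (mul_inv_cancel ω) (ρ.obj ω y) with hc
  obtain ⟨A, hA⟩ := (ρ.act ω).map_surjective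
    (X := ⟨ρ.obj ω⁻¹ (ρ.obj ω y)⟩) (Y := ⟨y⟩) c.hom
  have hs : π (ω * g.el ^ ((π ω : ℤˣ) : ℤ)) = π ω := by rw [map_mul, hp', mul_one]
  -- The same morphism as `A`, indexed by the sign of `ω g^{π(ω)}`, which equals that of `ω` because
  -- `g` has degree one.
  let A' : (⟨ρ.obj ω⁻¹ (ρ.obj ω y)⟩ : Signed (π (ω * g.el ^ ((π ω : ℤˣ) : ℤ))) V) ⟶ ⟨y⟩ :=
    ⟨fun h => A.pos (hs.symm.trans h), fun h => A.neg (hs.symm.trans h)⟩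
  have e₂ := ρ.signedTr_naturality _ rfl hp' φ A
  have e₃ := ρ.psiApp_naturality ω _ _ rfl (map_mul _ _ _) A'
  rw [ρ.innerMap_pos _ hp' _ A'] at e₃
  have hd : π (ω * g.el ^ ((π ω : ℤˣ) : ℤ)) = π g'.el * π ω := by rw [← map_mul, hm]
  have e₄ := ρ.psiApp_naturality g'.el ω _ hm hd A'
  have e₅ : ρ.innerMap ω hd A' = (Signed.iso (π g'.el) c).hom := by
    ext h
    · refine Eq.trans (congrArg (ρ.act ω).map ?_) hA
      ext h' <;> rfl
    · exact absurd (g'.deg.symm.trans h) (by decide)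
  rw [e₅] at e₄
  change ρ.betaApp ω hω φ (ρ.obj ω y) ≫ _ = _
  simp only [betaApp, Category.assoc, ← hc]
  have e₆ : (ρ.actIso g'.el c).hom ≫ (ρ.psiApp g'.el ω _ hm y).hom = _ := e₄
  rw [e₆, Iso.inv_hom_id_assoc, ← e₃, Iso.inv_comp_eq, ← hA, ← Functor.map_comp_assoc,
    ← Functor.map_comp_assoc]
  exact congrArg (fun a => (ρ.act ω).map a ≫ _) e₂.symm

/-- The uniqueness half of the characterization in `trApp_beta`: `ψ` is invertible, and components
at objects `ρ(ω)(y)` suffice. -/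
theorem eq_beta_of_act {g g' : Loop π} (ω : Γ) (hω : realConj π ω g.el = g'.el) (φ : ρ.Tr g)
    (T : ρ.Tr g') {p m : Γ} (hp : p = g.el ^ ((π ω : ℤˣ) : ℤ)) (hm : g'.el * ω = m)
    (hm' : ω * p = m)
    (h : ∀ y, ρ.trApp T (ρ.obj ω y) ≫ (ρ.psiApp g'.el ω m hm y).hom =
      (ρ.act ω).map (ρ.signedTr (π ω) p hp φ y) ≫ (ρ.psiApp ω p m hm' y).hom) :
    ρ.beta ω hω φ = T := by
  refine ρ.tr_ext_act ω fun y => ?_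
  rw [← cancel_mono (ρ.psiApp g'.el ω m hm y).hom, h, ρ.trApp_beta ω hω φ hp hm hm']

/-! ## Bending -/

/-- A twisted zigzag identity. Naturality of the cap of `(g, g⁻¹)` along `φ` reduces it to comparing
two ways of contracting `ρ(g) ρ(g⁻¹) ρ(g)` to `ρ(g)`. These differ by associativity for the triple
`(g, g⁻¹, g)`. -/
theorem IsTwisted.map_bend {ρ : RealTwoRepData k π V} {α : Γ → Γ → Γ → kˣ} (hρ : ρ.IsTwisted α)
    {g : Loop π} (φ : ρ.Tr g) (x : V) :
    (ρ.act g.el).map (posHom g.deg (ρ.bend φ x)) =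
      (α g.el g.el⁻¹ g.el : k) • ((ρ.cap g.el g.el⁻¹ (mul_inv_cancel _) x).hom ≫ ρ.trApp φ x) := by
  have h₀ : π g.el⁻¹ = 1 := by rw [map_inv, g.deg, inv_one]
  have h₁ : π 1 = π g.el * π g.el⁻¹ := by rw [← map_mul, mul_inv_cancel]
  have e₁ := ρ.cap_naturality g.el g.el⁻¹ (mul_inv_cancel _) h₁ (ρ.trApp φ x)
  have e₂ := congrArg (fun f => SHom.pos f rfl) (hρ.signed_assoc 1 (mul_inv_cancel g.el)
    (inv_mul_cancel g.el) (one_mul g.el) (mul_one g.el) x)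
  have e₃ := hρ.unit_left g.el (x := x)
  have e₄ := hρ.unit_right g.el (x := x)
  rw [e₃, e₄] at e₂
  -- The two contractions: by the unit laws, both outer composition isomorphisms in the
  -- associativity law become `ψ_e`.
  have e₅ : (ρ.act g.el).map (posHom g.deg (ρ.cap g.el⁻¹ g.el (inv_mul_cancel _) x).hom) =
      (α g.el g.el⁻¹ g.el : k) •
        (ρ.cap g.el g.el⁻¹ (mul_inv_cancel _) (ρ.obj g.el x)).hom := by
    have : (ρ.actIso g.el (ρ.psiApp g.el⁻¹ g.el 1 (inv_mul_cancel _) x)).hom ≫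
        (ρ.actIso g.el (ρ.psiEApp x)).hom = (α g.el g.el⁻¹ g.el : k) •
          ((ρ.psiApp g.el g.el⁻¹ 1 (mul_inv_cancel _) (ρ.obj g.el x)).hom ≫
            (ρ.psiEApp (ρ.obj g.el x)).hom) := by
      simpa using e₂.symm
    simp only [cap, Iso.trans_hom, posHom_comp, Functor.map_comp]
    rw [← this]
    simp only [actIso, Functor.mapIso_hom, iso_hom_eq_posHom g.deg]
  simp only [bend]
  rw [posHom_comp, Functor.map_comp, e₅, Linear.comp_smul, ← e₁]
  congr 4
  rw [ρ.innerMap_pos _ h₀]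
  ext h'
  · rfl
  · exact absurd (g.deg.symm.trans h') (by decide)

/-- The scalar by which bending twice differs from the identity. -/
def flipFactor (α : Γ → Γ → Γ → kˣ) (e : ℤˣ) (γ : Γ) : kˣ := if e = -1 then α γ γ⁻¹ γ else 1

/-- Treats bending and bending back uniformly. For `e = 1` it is the definition of `bend`, with
scalar one; for `e = -1` it is `map_bend`, and the scalar appears. -/
theorem IsTwisted.innerMap_signedTr_cap {ρ : RealTwoRepData k π V} {α : Γ → Γ → Γ → kˣ}
    (hρ : ρ.IsTwisted α) {g : Loop π} (φ : ρ.Tr g) {e e' : ℤˣ} (he : e' = -e) {p p' : Γ}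
    (hp : p = g.el ^ (e : ℤ)) (hp' : p' = g.el ^ (e' : ℤ)) (hpp : p' * p = 1) (h : e = e * π p')
    (x : V) :
    ρ.innerMap p' h (ρ.signedTr e p hp φ x) ≫ (Signed.iso e (ρ.cap p' p hpp x)).hom =
      (flipFactor α e g.el : k) • Signed.flip he (ρ.signedTr e' p' hp' φ x) := by
  subst he
  have hd : π g.el⁻¹ = 1 := by rw [map_inv, g.deg, inv_one]
  rcases Int.units_eq_one_or e with rfl | rfl
  · obtain rfl : p = g.el := by simpa using hp
    obtain rfl : p' = g.el⁻¹ := by simpa using hp'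
    ext h'
    · simp only [Signed.comp_pos, innerMap_pos ρ g.el⁻¹ hd]
      simp [signedTr, castIso, flipFactor, bend, Signed.flip]
    · exact absurd h' (by decide)
  · obtain rfl : p = g.el⁻¹ := by simpa using hp
    obtain rfl : p' = g.el := by simpa using hp'
    ext h'
    · exact absurd h' (by decide)
    · have := hρ.map_bend φ x
      simp only [Signed.comp_neg, innerMap_pos ρ g.el g.deg]
      simp [signedTr, castIso, flipFactor, Signed.flip, this]

end RealTwoRepData

/-! ### Bending and the action of the loop groupoid -/

theorem Signed.iso_trans_hom {C : Type u} [Category.{v} C] (ε : ℤˣ) {x y z : C} (a : x ≅ y)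
    (b : y ≅ z) : (Signed.iso ε (a ≪≫ b)).hom = (Signed.iso ε a).hom ≫ (Signed.iso ε b).hom := rfl

/-- Elimination of `t`: both `f` and `f'` are unit multiples of an isomorphism followed by `t`, so
they agree up to the quotient of the units. -/
theorem inv_comp_eq_smul_inv_comp {k : Type w} [Field k] {C : Type u} [Category.{v} C]
    [Preadditive C] [Linear k C] {x x' y z : C} (a : x ≅ y) (b : x' ≅ y) (f : x ⟶ z) (f' : x' ⟶ z)
    (t : y ⟶ z) (c₁ c₂ c₃ d : kˣ) (h : (c₁ : k) • f = (c₂ : k) • (a.hom ≫ t))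
    (h' : (c₃ : k) • (b.hom ≫ t) = (d : k) • f') :
    a.inv ≫ f = ((d * (c₂ / (c₁ * c₃)) : kˣ) : k) • (b.inv ≫ f') := by
  have h₁ : f = ((c₂ / c₁ : kˣ) : k) • (a.hom ≫ t) := by
    rw [div_eq_mul_inv, mul_comm, Units.val_mul, mul_smul, ← h, smul_smul, ← Units.val_mul,
      inv_mul_cancel, Units.val_one, one_smul]
  have h₂ : f' = ((c₃ / d : kˣ) : k) • (b.hom ≫ t) := by
    rw [div_eq_mul_inv, mul_comm, Units.val_mul, mul_smul, h', smul_smul, ← Units.val_mul,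
      inv_mul_cancel, Units.val_one, one_smul]
  rw [h₁, h₂, Linear.comp_smul, Linear.comp_smul, Iso.inv_hom_id_assoc, Iso.inv_hom_id_assoc,
    smul_smul, ← Units.val_mul]
  congr 2
  rw [div_mul_eq_div_div, mul_comm d, mul_assoc, mul_div_cancel, div_mul_cancel]

namespace RealTwoRepData

variable {k : Type w} [Field k] {Γ : Type u₁} [Group Γ] {π : Γ →* ℤˣ}
  {V : Type u} [Category.{v} V] [Preadditive V] [Linear k V] (ρ : RealTwoRepData k π V)

theorem signedTr_beta_one {g g' : Loop π} (ω : Γ) (hω : realConj π ω g.el = g'.el) (φ : ρ.Tr g)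
    {e : ℤˣ} (he : e = 1 * π ω) {q p m : Γ} (hq : q = g'.el ^ ((1 : ℤˣ) : ℤ))
    (hp : p = g.el ^ (e : ℤ)) (hm : q * ω = m) (hm' : ω * p = m) (y : V) :
    ρ.signedTr 1 q hq (ρ.beta ω hω φ) (ρ.obj ω y) ≫ (Signed.iso 1 (ρ.psiApp q ω m hm y)).hom =
      ρ.innerMap ω he (ρ.signedTr e p hp φ y) ≫ (Signed.iso 1 (ρ.psiApp ω p m hm' y)).hom := by
  obtain rfl : e = π ω := by simpa using he
  obtain rfl : q = g'.el := by simpa using hq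
  have := ρ.trApp_beta ω hω φ hp hm hm' y
  ext h'
  · simp only [Signed.comp_pos, Signed.iso_hom_pos]
    refine Eq.trans ?_ (this.trans ?_)
    · simp [signedTr, castIso]
    · congr 2
  · exact absurd h' (by decide)

/-- The scalar by which bending fails to commute with `β_{γ,ω}`. -/
def bendFactor (π : Γ →* ℤˣ) (α : Γ → Γ → Γ → kˣ) (s : ℤˣ) (ω γ : Γ) : kˣ :=
  if s = 1 then 1 else flipFactor α (π ω) γ *
    (α (ω * γ ^ (-((π ω : ℤˣ) : ℤ)) * ω⁻¹) ω (γ ^ ((π ω : ℤˣ) : ℤ)) /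
      (α (ω * γ ^ (-((π ω : ℤˣ) : ℤ)) * ω⁻¹) (ω * γ ^ ((π ω : ℤˣ) : ℤ) * ω⁻¹) ω *
        α ω (γ ^ (-((π ω : ℤˣ) : ℤ))) (γ ^ ((π ω : ℤˣ) : ℤ))))

/-- The factors of the transgression that involve `ω₂` only through its sign are exactly the failure
of bending to commute with `β_{γ,ω₁}`. The exponent `(π(ω₂) - 1)/2` is `0` or `-1`, and in the
latter case the fraction is inverted, as in `bendFactor`. -/
theorem transgressionFun_eq (α : Γ → Γ → Γ → kˣ) (ω₂ ω₁ γ : Γ) :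
    transgressionFun π α ω₂ ω₁ γ = bendFactor π α (π ω₂) ω₁ γ *
      (α ω₂ ω₁ (γ ^ ((π (ω₂ * ω₁) : ℤˣ) : ℤ)) *
        α (ω₂ * ω₁ * γ ^ ((π (ω₂ * ω₁) : ℤˣ) : ℤ) * (ω₂ * ω₁)⁻¹) ω₂ ω₁ /
        α ω₂ (ω₁ * γ ^ ((π (ω₂ * ω₁) : ℤˣ) : ℤ) * ω₁⁻¹) ω₁) := by
  rw [transgressionFun, bendFactor, flipFactor]
  congr 1
  rcases Int.units_eq_one_or (π ω₂) with h₂ | h₂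
  · simp [h₂]
  · rw [h₂, if_neg (show ¬(-1 : ℤˣ) = 1 by decide)]
    simp only [true_and]
    have : ((((-1 : ℤˣ) : ℤˣ) : ℤ) - 1) / 2 = -1 := by decide
    rw [this, zpow_neg_one, inv_div]
    congr 1
    split_ifs <;> simp

/-- With `T = β_{g,ω}(φ)` and `q = g'⁻¹`, both the bent `T` and `ρ(ω)` of the oppositely bent `φ`
are compared with one middle term, `ρ(m)(F)` contracted by `ψ_{m,p₀}`, where `F` is the signed form
of `φ` entering the definition of `T`. Associativity for `(q, g', ω)` and `(q, ω, p₀)` handles the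
first comparison and for `(ω, p, p₀)` the second. Together with `flipFactor`, these values of `α`
make up `bendFactor`. -/
theorem IsTwisted.signedTr_beta_neg {ρ : RealTwoRepData k π V} {α : Γ → Γ → Γ → kˣ}
    (hρ : ρ.IsTwisted α) {g g' : Loop π} (ω : Γ) (hω : realConj π ω g.el = g'.el)
    (φ : ρ.Tr g) {e : ℤˣ} (he : e = -1 * π ω) {q p m : Γ} (hq : q = g'.el ^ ((-1 : ℤˣ) : ℤ))
    (hp : p = g.el ^ (e : ℤ)) (hm : q * ω = m) (hm' : ω * p = m) (y : V) :
    ρ.signedTr (-1) q hq (ρ.beta ω hω φ) (ρ.obj ω y) ≫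
        (Signed.iso (-1) (ρ.psiApp q ω m hm y)).hom =
      (bendFactor π α (-1) ω g.el : k) • (ρ.innerMap ω he (ρ.signedTr e p hp φ y) ≫
        (Signed.iso (-1) (ρ.psiApp ω p m hm' y)).hom) := by
  have hq' : q * g'.el = 1 := by simp [hq]
  have hee : e = -π ω := by simpa using he
  have hpp : p * g.el ^ ((π ω : ℤˣ) : ℤ) = 1 := by
    rw [hp, hee, ← zpow_add]; simp
  have hdq : π q = 1 := by simp [hq, g'.deg]
  have hdp : π p = 1 := by simp [hp, g.deg]
  have hdm : π m = π ω := by rw [← hm', map_mul, hdp, mul_one]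
  have hg' : g'.el = ω * g.el ^ ((π ω : ℤˣ) : ℤ) * ω⁻¹ := hω.symm
  set p₀ := g.el ^ ((π ω : ℤˣ) : ℤ) with hp₀
  have hmp : m * p₀ = ω := by rw [← hm', mul_assoc, hpp, mul_one]
  have hωp : ω * p₀ = g'.el * ω := by rw [hg']; group
  have hq2 : q * (g'.el * ω) = ω := by rw [← mul_assoc, hq', one_mul]
  have h11 : (1 : ℤˣ) = 1 * π q := by rw [hdq, one_mul]
  set T := ρ.beta ω hω φ
  set F := ρ.signedTr (π ω) p₀ hp₀ φ y
  -- the action of `q` on the characterization of `T`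
  have e₁ := congrArg (ρ.innerMap q h11) (ρ.signedTr_beta_one ω hω φ (one_mul _).symm
    (q := g'.el) (by simp) hp₀ rfl hωp y)
  simp only [innerMap_comp, innerMap_iso] at e₁
  have e₂ := hρ.innerMap_signedTr_cap T (e := 1) (e' := -1) (p := g'.el) (p' := q) rfl
    (by simp) hq hq' h11 (ρ.obj ω y)
  have e₃ := hρ.signed_assoc 1 hq' (rfl : g'.el * ω = _) (one_mul ω) hq2 y
  have e₄ := hρ.signed_assoc 1 hm hωp hmp hq2 y
  have e₅ := ρ.innerMap_naturality q ω m hm h11 (one_mul _).symm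
    (by rw [hdm, one_mul] : π ω = 1 * π m) F
  have e₆ := ρ.innerMap_naturality ω p m hm' (one_mul _).symm
    (by rw [hdp, mul_one] : π ω = π ω * π p) (by rw [hdm, one_mul] : π ω = 1 * π m) F
  have e₇ := hρ.signed_assoc 1 hm' hpp hmp (mul_one ω) y
  have e₈ := congrArg (ρ.innerMap ω (one_mul _).symm) (hρ.innerMap_signedTr_cap φ hee hp₀ hp hpp
    (by rw [hdp, mul_one] : π ω = π ω * π p) y)
  rw [hρ.unit_left] at e₃
  rw [hρ.unit_right] at e₇
  simp only [cap, Signed.iso_trans_hom, innerMap_comp, innerMap_iso, innerMap_smul] at e₂ e₈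
  -- Comparison of the bent `T` with the middle term: `ρ(q)` is applied to the equation
  -- characterizing `T`, then reassociated.
  have hA : ((α q g'.el ω : kˣ) : k) • Signed.flip rfl (ρ.signedTr (-1) q hq T (ρ.obj ω y)) =
      ((α q ω p₀ : kˣ) : k) • ((Signed.iso 1 (ρ.psiApp q ω m hm y)).hom ≫
        ρ.innerMap m (by rw [hdm, one_mul]) F ≫ (Signed.iso 1 (ρ.psiApp m p₀ ω hmp y)).hom) := by
    have e₂' : Signed.flip rfl (ρ.signedTr (-1) q hq T (ρ.obj ω y)) = _ :=
      ((one_smul k _).symm.trans e₂.symm)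
    simp only [Units.val_one, zpow_one] at e₃ e₄
    rw [e₂', ← reassoc_of% e₅, ← Linear.comp_smul _ _ _ (ρ.innerMap q h11 _),
      ← Linear.comp_smul _ _ _ (ρ.innerMap q h11 _), e₃, e₄, reassoc_of% e₁]
  -- Comparison of the bent `φ` with the same middle term: here `flipFactor` enters, since `F` is
  -- itself bent when `π(ω) = -1`.
  have hB : ((α ω p p₀ : kˣ) : k) • ((Signed.iso 1 (ρ.psiApp ω p m hm' y)).hom ≫
        ρ.innerMap m (by rw [hdm, one_mul]) F ≫ (Signed.iso 1 (ρ.psiApp m p₀ ω hmp y)).hom) =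
      (flipFactor α (π ω) g.el : k) •
        ρ.innerMap ω (one_mul _).symm (Signed.flip hee (ρ.signedTr e p hp φ y)) := by
    simp only [Units.val_one, zpow_one] at e₇
    rw [← e₈, ← reassoc_of% e₆, ← Linear.comp_smul _ _ _ (ρ.innerMap ω (one_mul _).symm _), e₇]
  have key := inv_comp_eq_smul_inv_comp (Signed.iso 1 (ρ.psiApp q ω m hm y))
    (Signed.iso 1 (ρ.psiApp ω p m hm' y)) _ _ _ _ _ _ _ hA hB
  -- The goal is in sign `-1`, while `key` was derived in sign `1`; reversing arrows matches them.
  apply Signed.flip_injective (e := 1) rfl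
  rw [Signed.flip_comp, Signed.flip_iso, Signed.flip_smul, Signed.flip_comp, Signed.flip_iso,
    ρ.flip_innerMap ω (one_mul _).symm he hee rfl, key]
  congr 2
  have hpe : g.el ^ (-((π ω : ℤˣ) : ℤ)) = p := by rw [hp, hee, Units.val_neg]
  have hqe : ω * p * ω⁻¹ = q := by rw [hm', ← hm, mul_inv_cancel_right]
  rw [bendFactor, if_neg (by decide), hpe, hqe, ← hp₀, ← hg']

/-- Bending commutes with the characterization of `β_{g,ω}` up to the scalar `bendFactor`. -/
theorem IsTwisted.signedTr_beta {ρ : RealTwoRepData k π V} {α : Γ → Γ → Γ → kˣ}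
    (hρ : ρ.IsTwisted α) (s : ℤˣ) {g g' : Loop π} (ω : Γ) (hω : realConj π ω g.el = g'.el)
    (φ : ρ.Tr g) {e : ℤˣ} (he : e = s * π ω) {q p m : Γ} (hq : q = g'.el ^ (s : ℤ))
    (hp : p = g.el ^ (e : ℤ)) (hm : q * ω = m) (hm' : ω * p = m) (y : V) :
    ρ.signedTr s q hq (ρ.beta ω hω φ) (ρ.obj ω y) ≫ (Signed.iso s (ρ.psiApp q ω m hm y)).hom =
      (bendFactor π α s ω g.el : k) • (ρ.innerMap ω he (ρ.signedTr e p hp φ y) ≫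
        (Signed.iso s (ρ.psiApp ω p m hm' y)).hom) := by
  rcases Int.units_eq_one_or s with rfl | rfl
  · rw [bendFactor, if_pos rfl, Units.val_one, one_smul]
    exact ρ.signedTr_beta_one ω hω φ he hq hp hm hm' y
  · exact hρ.signedTr_beta_neg ω hω φ he hq hp hm hm' y

end RealTwoRepData

/-! ### The character as a transgression-twisted representation -/

namespace RealTwoRepData

variable {k : Type w} [Field k] {Γ : Type u₁} [Group Γ] {π : Γ →* ℤˣ}
  {V : Type u} [Category.{v} V] [Preadditive V] [Linear k V] (ρ : RealTwoRepData k π V)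

theorem signedTr_iso_naturality {g : Loop π} (φ : ρ.Tr g) {ε : ℤˣ} {p : Γ}
    (hp : p = g.el ^ (ε : ℤ)) {x y : V} (E : x ≅ y) :
    (Signed.iso ε E).hom ≫ ρ.signedTr ε p hp φ y =
      ρ.signedTr ε p hp φ x ≫ (Signed.iso ε (ρ.actIso p E)).hom := by
  have hd : π p = 1 := by rw [hp]; exact loop_zpow_deg g _
  refine (ρ.signedTr_naturality p hp hd φ (Signed.iso ε E).hom).trans ?_
  rw [← ρ.innerMap_iso p (by rw [hd, mul_one] : ε = ε * π p), ρ.innerMap_pos p hd]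

/-- `φ` itself satisfies the equation characterizing `β_{g,1}(φ)`: by the unit laws both composition
isomorphisms come from `ψ_e`, and the equation becomes naturality. -/
theorem IsTwisted.beta_one {ρ : RealTwoRepData k π V} {α : Γ → Γ → Γ → kˣ} (hρ : ρ.IsTwisted α)
    {g : Loop π} (h : realConj π 1 g.el = g.el) (φ : ρ.Tr g) : ρ.beta 1 h φ = φ := by
  refine ρ.eq_beta_of_act 1 h φ φ (p := g.el) (by simp) (mul_one _) (one_mul _) fun y => ?_
  rw [hρ.unit_right, hρ.unit_left, ρ.psiEApp_naturality]
  have := ρ.trApp_naturality φ (ρ.psiEApp y).hom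
  simp only [actIso, Functor.mapIso_hom, iso_hom_eq_posHom g.deg]
  rw [← this]
  simp [signedTr, castIso]

theorem smul_inv_cancel_left_of_eq {M : Type*} [AddCommGroup M] [Module k M] {c : kˣ} {x y : M}
    (h : (c : k) • x = y) : x = ((c⁻¹ : kˣ) : k) • y := by
  rw [← h, smul_smul, ← Units.val_mul, inv_mul_cancel, Units.val_one, one_smul]

/-- Both sides are tested at `ρ(ω₂ω₁)(y)`, which `ψ_{ω₂,ω₁}` identifies with `ρ(ω₂)ρ(ω₁)(y)`. The
characterization of `T₂` is used at `ρ(ω₁)(y)`, and then `ρ(ω₂)` is applied to that of `T₁`. The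
latter is needed in sign `π(ω₂)`, which costs `bendFactor`. Reassociating the triples `(g₂, ω₂,
ω₁)`, `(ω₂, q, ω₁)` and `(ω₂, ω₁, p)` gives the other three factors of the transgression. -/
theorem IsTwisted.beta_beta {ρ : RealTwoRepData k π V} {α : Γ → Γ → Γ → kˣ} (hρ : ρ.IsTwisted α)
    {g g₁ g₂ : Loop π} (ω₂ ω₁ : Γ) (h₁ : realConj π ω₁ g.el = g₁.el)
    (h₂ : realConj π ω₂ g₁.el = g₂.el) (h : realConj π (ω₂ * ω₁) g.el = g₂.el) (φ : ρ.Tr g) :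
    ρ.beta ω₂ h₂ (ρ.beta ω₁ h₁ φ) =
      (transgressionFun π α ω₂ ω₁ g.el : k) • ρ.beta (ω₂ * ω₁) h φ := by
  refine ρ.tr_ext_act (ω₂ * ω₁) fun y => ?_
  set T₁ := ρ.beta ω₁ h₁ φ with hT₁
  set T₂ := ρ.beta ω₂ h₂ T₁ with hT₂
  set T := ρ.beta (ω₂ * ω₁) h φ
  obtain ⟨e, he⟩ : ∃ e, e = π ω₂ * π ω₁ := ⟨_, rfl⟩
  obtain ⟨p, hp⟩ : ∃ p, p = g.el ^ (e : ℤ) := ⟨_, rfl⟩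
  obtain ⟨q, hq⟩ : ∃ q, q = g₁.el ^ ((π ω₂ : ℤˣ) : ℤ) := ⟨_, rfl⟩
  have hmul : π (ω₂ * ω₁) = e := by rw [map_mul, he]
  have hg₂ : g₂.el = ω₂ * ω₁ * p * (ω₂ * ω₁)⁻¹ := by rw [← h, realConj, hmul, hp]
  -- The power of `g₁` on which `ω₂` acts is the conjugate by `ω₁` of the power `p` of `g` on which
  -- `ω₂ω₁` acts; the two signs multiply.
  have hq' : q = ω₁ * p * ω₁⁻¹ := by
    rw [hq, ← h₁, realConj, hp, he]
    rcases Int.units_eq_one_or (π ω₂) with h' | h' <;> simp [h', mul_assoc]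
  have hm₁ : q * ω₁ = ω₁ * p := by rw [hq']; group
  have hm₂ : g₂.el * ω₂ = ω₂ * q := by rw [hg₂, hq']; group
  have hm₃ : ω₂ * q * ω₁ = ω₂ * ω₁ * p := by rw [hq']; group
  have hm₄ : g₂.el * (ω₂ * ω₁) = ω₂ * ω₁ * p := by rw [hg₂]; group
  have b₁ := ρ.signedTr_beta_one ω₂ h₂ T₁ (one_mul _).symm (q := g₂.el) (by simp) hq hm₂ rfl
    (ρ.obj ω₁ y)
  have b₂ := congrArg (ρ.innerMap ω₂ (one_mul _).symm)
    (hρ.signedTr_beta (π ω₂) ω₁ h₁ φ he hq hp hm₁ rfl y)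
  have b₃ := ρ.signedTr_beta_one (ω₂ * ω₁) h φ (by rw [he, map_mul, one_mul] : e = _)
    (q := g₂.el) (by simp) hp hm₄ rfl y
  have n₁ := ρ.signedTr_iso_naturality T₂ (ε := 1) (p := g₂.el) (by simp)
    (ρ.psiApp ω₂ ω₁ (ω₂ * ω₁) rfl y)
  have n₂ := ρ.innerMap_naturality ω₂ ω₁ _ rfl (one_mul _).symm he
    (by rw [he, map_mul, one_mul]) (ρ.signedTr e p hp φ y)
  have a₁ := hρ.signed_assoc 1 hm₂ (rfl : ω₂ * ω₁ = _) hm₃ hm₄ y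
  have a₂ := hρ.signed_assoc 1 (rfl : ω₂ * q = _) hm₁ hm₃ (mul_assoc _ _ _).symm y
  have a₃ := hρ.signed_assoc 1 (rfl : ω₂ * ω₁ = _) (rfl : ω₁ * p = _) rfl (mul_assoc _ _ _).symm y
  simp only [Units.val_one, zpow_one] at a₁ a₂ a₃
  simp only [innerMap_comp, innerMap_iso, innerMap_smul] at b₂
  have a₂' := smul_inv_cancel_left_of_eq a₂
  have key : (Signed.iso 1 (ρ.psiApp ω₂ ω₁ (ω₂ * ω₁) rfl y)).hom ≫
      ρ.signedTr 1 g₂.el (by simp) T₂ (ρ.obj (ω₂ * ω₁) y) ≫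
        (Signed.iso 1 (ρ.psiApp g₂.el (ω₂ * ω₁) _ hm₄ y)).hom =
      (transgressionFun π α ω₂ ω₁ g.el : k) •
        ((Signed.iso 1 (ρ.psiApp ω₂ ω₁ (ω₂ * ω₁) rfl y)).hom ≫
          ρ.signedTr 1 g₂.el (by simp) T (ρ.obj (ω₂ * ω₁) y) ≫
            (Signed.iso 1 (ρ.psiApp g₂.el (ω₂ * ω₁) _ hm₄ y)).hom) := by
    rw [b₃, ← reassoc_of% n₂, reassoc_of% n₁, ← a₁, Linear.comp_smul, reassoc_of% b₁, a₂',
      Linear.comp_smul, reassoc_of% b₂, Linear.smul_comp, Category.assoc, ← a₃, Linear.comp_smul,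
      smul_smul, smul_smul, smul_smul, ← Units.val_mul, ← Units.val_mul, ← Units.val_mul,
      transgressionFun_eq, hmul, ← hp, ← hg₂, ← hq']
    congr 2
    rw [div_eq_mul_inv]
    ac_rfl
  have key' : ρ.signedTr 1 g₂.el (by simp) T₂ (ρ.obj (ω₂ * ω₁) y) =
      (transgressionFun π α ω₂ ω₁ g.el : k) •
        ρ.signedTr 1 g₂.el (by simp) T (ρ.obj (ω₂ * ω₁) y) := by
    rw [← cancel_mono (Signed.iso 1 (ρ.psiApp g₂.el (ω₂ * ω₁) _ hm₄ y)).hom,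
      ← cancel_epi (Signed.iso 1 (ρ.psiApp ω₂ ω₁ (ω₂ * ω₁) rfl y)).hom, key, Linear.smul_comp,
      Linear.comp_smul]
  have := congrArg (fun f : SHom (1 : ℤˣ) _ _ => f.pos rfl) key'
  simpa [signedTr, castIso, trApp_smul] using this

/-- The Real categorical character of a twisted Real `2`-representation is a representation of the
unoriented loop groupoid, twisted by the transgression. -/
theorem realCatChar_isTwisted (α : ThreeCocycle k π) (hρ : ρ.IsTwisted α.toFun) :
    ρ.realCatChar.IsTwisted (transgression α) where
  map_id _ := LinearMap.ext fun φ => hρ.beta_one _ φ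
  map_comp f₂ f₁ := LinearMap.ext fun φ => hρ.beta_beta f₂.1 f₁.1 f₁.2 f₂.2 _ φ

end RealTwoRepData

/-! ### Twisted induction along a functor -/

section GroupoidReps

variable {k : Type w} [Field k] {C : Type u₁} [Category.{v₁} C] {D : Type u₂} [Category.{v₂} D]
  (F : C ⥤ D) (θ : TwoCocycle k D) (E : BundleData.{w, v₁, u₁, v₃} k C)

theorem ind_map_indMk {x x' : D} (f : x ⟶ x') {y : C} (s : F.obj y ⟶ x) (v : E.fib y) :
    (ind F θ E).map f (indMk F θ E s v) = (θ.toFun f s : k) • indMk F θ E (s ≫ f) v := by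
  classical
  have h := indPreMap.eq_1 F θ E f
  have h' := congrArg (fun t => Submodule.Quotient.mk (p := indRel F θ E x')
    (t (DirectSum.lof k _ (fun p : (y : C) × (F.obj y ⟶ x) => E.fib p.1) ⟨y, s⟩ v))) h
  simp only [DirectSum.toModule_lof] at h'
  exact h'

theorem indMk_add {x : D} {y : C} (s : F.obj y ⟶ x) (v v' : E.fib y) :
    indMk F θ E s (v + v') = indMk F θ E s v + indMk F θ E s v' := by
  rw [indMk, map_add]; rfl

theorem indMk_smul {x : D} {y : C} (s : F.obj y ⟶ x) (c : k) (v : E.fib y) :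
    indMk F θ E s (c • v) = c • indMk F θ E s v := by
  rw [indMk, map_smul]; rfl

theorem indMk_map {x : D} {y y' : C} (a : y ⟶ y') (s : F.obj y' ⟶ x) (v : E.fib y) :
    indMk F θ E s (E.map a v) = (θ.toFun s (F.map a) : k) • indMk F θ E (F.map a ≫ s) v :=
  (Submodule.Quotient.eq _).2 (Submodule.subset_span ⟨y, y', a, s, v, rfl⟩)

theorem ind_hom_ext {x : D} {M : Type*} [AddCommGroup M] [Module k M]
    {f f' : (ind F θ E).fib x →ₗ[k] M}
    (h : ∀ (y : C) (s : F.obj y ⟶ x) (v : E.fib y),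
      f (indMk F θ E s v) = f' (indMk F θ E s v)) : f = f' := by
  classical
  refine Submodule.linearMap_qext _ (DirectSum.linearMap_ext k fun p => LinearMap.ext fun v => ?_)
  exact h p.1 p.2 v

theorem ind_isTwisted : (ind F θ E).IsTwisted θ where
  map_id x := ind_hom_ext F θ E fun y s v => by
    rw [ind_map_indMk, θ.id_left, Units.val_one, one_smul, Category.comp_id]; rfl
  map_comp f₂ f₁ := ind_hom_ext F θ E fun y s v => by
    rw [LinearMap.comp_apply, ind_map_indMk, map_smul, ind_map_indMk, LinearMap.smul_apply,
      ind_map_indMk, smul_smul, smul_smul, ← Units.val_mul, ← Units.val_mul, Category.assoc]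
    congr 2
    rw [θ.cocycle, mul_comm]

end GroupoidReps

namespace RealTwoRepData

section GeneralIso

variable {k : Type w} [Field k] {Γ : Type u₁} [Group Γ] {π : Γ →* ℤˣ}
  {V : Type u} [Category.{v} V] [Preadditive V] [Linear k V] (ρ : RealTwoRepData k π V)

theorem actIso_trans (ω : Γ) {x y z : V} (E : x ≅ y) (E' : y ≅ z) :
    ρ.actIso ω (E ≪≫ E') = ρ.actIso ω E ≪≫ ρ.actIso ω E' :=
  Iso.ext ((ρ.act ω).map_comp (Signed.iso (π ω) E).hom (Signed.iso (π ω) E').hom)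

theorem actIso_symm (ω : Γ) {x y : V} (E : x ≅ y) : ρ.actIso ω E.symm = (ρ.actIso ω E).symm := rfl

theorem psiApp_iso_naturality (ω₂ ω₁ ω : Γ) (h : ω₂ * ω₁ = ω) {x y : V} (E : x ≅ y) :
    ρ.actIso ω₂ (ρ.actIso ω₁ E) ≪≫ ρ.psiApp ω₂ ω₁ ω h y =
      ρ.psiApp ω₂ ω₁ ω h x ≪≫ ρ.actIso ω E := by
  have h' : π ω = π ω₂ * π ω₁ := by rw [← h, map_mul]
  have := ρ.psiApp_naturality ω₂ ω₁ ω h h' (Signed.iso (π ω) E).hom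
  rw [innerMap_iso] at this
  exact Iso.ext this

end GeneralIso

variable {k : Type w} [Field k] {Γ : Type u₁} [Group Γ] {π : Γ →* ℤˣ} {H : Subgroup Γ}
  {V : Type u} [Category.{v} V] [Preadditive V] [Linear k V]
  (ρ : RealTwoRepData k (π.comp H.subtype) V) (σ : Γ ⧸ H → Γ)
  (hσ : ∀ q, (σ q : Γ ⧸ H) = q)

/-! ## Entries of the Real induction -/

/-- The identification of the `j` component of `RInd(ρ)(ω)(x)` with its `(j, i)` entry, where
`ω i = j`. -/
def rindCast (ω : Γ) (i j : Γ ⧸ H) (h : ω • i = j) (x : RIndCat π V σ) :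
    ((ρ.rindAct σ hσ ω).obj ⟨x⟩ j).un ≅ ρ.obj (trans σ hσ ω i j h) (x i).un :=
  ρ.castIso (x := (x (ω⁻¹ • j)).un) (x' := (x i).un)
    (show trans σ hσ ω (ω⁻¹ • j) j (smul_inv_smul _ _) = trans σ hσ ω i j h by
      subst h; simp only [inv_smul_smul]) (by subst h; rw [inv_smul_smul])

/-- The `i` component of a signed morphism of the product category. -/
def rindComp {ε e : ℤˣ} {i : Γ ⧸ H} (he : e = ε * π (σ i)) {x y : RIndCat π V σ}
    (f : (⟨x⟩ : Signed ε (RIndCat π V σ)) ⟶ ⟨y⟩) : (⟨(x i).un⟩ : Signed e V) ⟶ ⟨(y i).un⟩ :=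
  (Signed.merge he).map
    (⟨fun h => f.pos h i, fun h => f.neg h i⟩ : (⟨x i⟩ : Signed ε (Signed (π (σ i)) V)) ⟶ ⟨y i⟩)

/-- By construction the only source index is `ω⁻¹ • j`. Allowing any `i` with `ω • i = j` costs the
casts on both sides, which become identities once `i` is replaced by `ω⁻¹ • j`. -/
theorem rindAct_map_eq (ω : Γ) {i j : Γ ⧸ H} (h : ω • i = j) {e : ℤˣ} (he : e = π ω * π (σ i))
    (he' : e = π (σ j) * (π.comp H.subtype) (trans σ hσ ω i j h)) {x y : RIndCat π V σ}
    (f : (⟨x⟩ : Signed (π ω) (RIndCat π V σ)) ⟶ ⟨y⟩) :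
    (ρ.rindAct σ hσ ω).map f j =
      (Signed.iso (π (σ j)) (ρ.rindCast σ hσ ω i j h x)).hom ≫
        ρ.innerMap (trans σ hσ ω i j h) he' (rindComp σ he f) ≫
        (Signed.iso (π (σ j)) (ρ.rindCast σ hσ ω i j h y)).inv := by
  obtain rfl : i = ω⁻¹ • j := by rw [← h, inv_smul_smul]
  subst he
  have hr (z : RIndCat π V σ) : ρ.rindCast σ hσ ω (ω⁻¹ • j) j h z = Iso.refl _ := rfl
  rw [hr, hr]
  exact ((Category.id_comp _).trans (Category.comp_id _)).symm

/-- For `ε = -1` the operation on isomorphisms passes to the inverse, hence inverts the scalar. This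
is where the action of `Γ` on `kˣ` through `π` comes from in the associativity law of the Real
induction. -/
theorem rindComp_iso {ε e : ℤˣ} {i : Γ ⧸ H} (he : e = ε * π (σ i)) {x y : RIndCat π V σ}
    (P : x ≅ y) (r : kˣ) (Q : (x i).un ≅ (y i).un)
    (hP : P.hom i = (r : k) • (Signed.iso (π (σ i)) Q).hom) :
    rindComp σ he (Signed.iso ε P).hom =
      ((r ^ (ε : ℤ) : kˣ) : k) • (Signed.iso e Q).hom := by
  have hP' : P.inv i = ((r⁻¹ : kˣ) : k) • (Signed.iso (π (σ i)) Q).inv := by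
    have : (Pi.isoApp P i) = smulIso r (Signed.iso (π (σ i)) Q) := Iso.ext hP
    exact congrArg Iso.inv this
  subst he
  rcases Int.units_eq_one_or ε with rfl | rfl
  · rw [Units.val_one, zpow_one]
    ext h
    · exact congrArg (fun f : SHom (π (σ i)) _ _ => f.pos ((one_mul _).symm.trans h)) hP
    · exact congrArg (fun f : SHom (π (σ i)) _ _ => f.neg ((one_mul _).symm.trans h)) hP
  · rw [Units.val_neg, Units.val_one, zpow_neg_one]
    ext h
    · exact congrArg (fun f : SHom (π (σ i)) _ _ => f.neg
        (neg_eq_iff_eq_neg.1 ((neg_one_mul _).symm.trans h))) hP'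
    · exact congrArg (fun f : SHom (π (σ i)) _ _ => f.pos
        (neg_injective ((neg_one_mul _).symm.trans h))) hP'

variable (α : ThreeCocycle k π)

theorem rind_actIso_hom (ω : Γ) {i j : Γ ⧸ H} (h : ω • i = j) {x y : RIndCat π V σ}
    (P : x ≅ y) (r : kˣ) (Q : (x i).un ≅ (y i).un)
    (hP : P.hom i = (r : k) • (Signed.iso (π (σ i)) Q).hom) :
    ((ρ.rind σ hσ α).actIso ω P).hom j = ((r ^ ((π ω : ℤˣ) : ℤ) : kˣ) : k) •
      (Signed.iso (π (σ j)) (ρ.rindCast σ hσ ω i j h x ≪≫ ρ.actIso (trans σ hσ ω i j h) Q ≪≫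
        (ρ.rindCast σ hσ ω i j h y).symm)).hom := by
  refine (ρ.rindAct_map_eq σ hσ ω h rfl (trans_deg σ hσ ω i j h) (Signed.iso (π ω) P).hom).trans ?_
  rw [rindComp_iso σ rfl P r Q hP, innerMap_smul, innerMap_iso, Linear.smul_comp, Linear.comp_smul]
  rfl

/-- The scalar in the composition isomorphism of the Real induction. -/
def rindFactor (ω₂ ω₁ : Γ) (i j l : Γ ⧸ H) (h₁ : ω₁ • i = j) (h₂ : ω₂ • j = l) : kˣ :=
  α.toFun ω₂ (σ j) (trans σ hσ ω₁ i j h₁ : Γ) / (α.toFun ω₂ ω₁ (σ i) *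
    α.toFun (σ l) (trans σ hσ ω₂ j l h₂ : Γ) (trans σ hσ ω₁ i j h₁ : Γ))

theorem rind_psiApp_hom (ω₂ ω₁ ω : Γ) (hω : ω₂ * ω₁ = ω) {i j l : Γ ⧸ H} (h₁ : ω₁ • i = j)
    (h₂ : ω₂ • j = l) (h : ω • i = l) (x : RIndCat π V σ) :
    ((ρ.rind σ hσ α).psiApp ω₂ ω₁ ω hω x).hom l =
      (rindFactor σ hσ α ω₂ ω₁ i j l h₁ h₂ : k) • (Signed.iso (π (σ l))
        (ρ.rindCast σ hσ ω₂ j l h₂ ((ρ.rind σ hσ α).obj ω₁ x) ≪≫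
          ρ.actIso (trans σ hσ ω₂ j l h₂) (ρ.rindCast σ hσ ω₁ i j h₁ x) ≪≫
          ρ.psiApp (trans σ hσ ω₂ j l h₂) (trans σ hσ ω₁ i j h₁) (trans σ hσ ω i l h)
            (trans_mul σ hσ ω₂ ω₁ ω hω i j l h₁ h₂ h) (x i).un ≪≫
          (ρ.rindCast σ hσ ω i l h x).symm)).hom := by
  obtain rfl : j = ω₂⁻¹ • l := by rw [← h₂, inv_smul_smul]
  obtain rfl : i = ω₁⁻¹ • ω₂⁻¹ • l := by rw [← h₁, inv_smul_smul]
  change (ρ.rindPsiApp σ hσ α ω₂ ω₁ ω hω _ _ _ l _ _ _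
    (by rw [← hω, mul_inv_rev, mul_smul]) x).hom = _
  rw [rindPsiApp, smulIso_hom]
  refine congrArg (fun f => (_ : k) • (Signed.iso (π (σ l)) f).hom) ?_
  have hr₂ : ρ.rindCast σ hσ ω₂ (ω₂⁻¹ • l) l h₂ ((ρ.rind σ hσ α).obj ω₁ x) = Iso.refl _ := rfl
  have hr₁ : ρ.rindCast σ hσ ω₁ (ω₁⁻¹ • ω₂⁻¹ • l) (ω₂⁻¹ • l) h₁ x = Iso.refl _ := rfl
  have ha : ∀ (η : H) (z : V), ρ.actIso η (Iso.refl z) = Iso.refl _ := fun η z =>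
    Iso.ext ((ρ.act η).map_id ⟨z⟩)
  rw [hr₁, hr₂]
  refine Eq.trans ?_ ((Iso.refl_trans _).trans ((congrArg (· ≪≫ _) (ha _ _)).trans
    (Iso.refl_trans _))).symm
  congr 1

theorem rind_psiEApp_hom (l : Γ ⧸ H) (h : (1 : Γ) • l = l) (x : RIndCat π V σ) :
    ((ρ.rind σ hσ α).psiEApp x).hom l = (Signed.iso (π (σ l)) (ρ.rindCast σ hσ 1 l l h x ≪≫
      ρ.castIso (trans_one σ hσ l l h) rfl ≪≫ ρ.psiEApp (x l).un)).hom := by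
  change (ρ.rindPsiEApp σ hσ _ l _ (by rw [inv_one, one_smul]) x).hom = _
  rw [rindPsiEApp]
  refine congrArg (fun f => (Signed.iso (π (σ l)) f).hom) ?_
  rw [← Iso.trans_assoc]
  congr 1
  simp only [rindCast, castIso]
  exact (eqToIso_trans _ _).symm

end RealTwoRepData

/-! ### The twisted laws for the Real induction -/

namespace RealTwoRepData

section Entries

variable {k : Type w} [Field k] {Γ : Type u₁} [Group Γ] {π : Γ →* ℤˣ}
  {V : Type u} [Category.{v} V] [Preadditive V] [Linear k V] {ρ : RealTwoRepData k π V}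
  {α : Γ → Γ → Γ → kˣ}

/-- One entry of the associativity law. The casts occur only as isomorphisms that cancel in pairs or
conjugate both sides equally, so arbitrary isomorphisms may replace them. What remains is the law
for `ρ` in sign `s` and the scalar identity `hr`. -/
theorem IsTwisted.assoc_entries (hρ : ρ.IsTwisted α) (s : ℤˣ) {c b a cb ba m : Γ}
    (hcb : c * b = cb) (hba : b * a = ba) (h : cb * a = m) (h' : c * ba = m)
    {x xa xba xcba ya yb yc yd : V} (Ka : xa ≅ ρ.obj a x) (Kb : xba ≅ ρ.obj b xa)
    (Kc : xcba ≅ ρ.obj c xba) (La : ya ≅ ρ.obj cb xa) (Lb : yb ≅ ρ.obj ba x)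
    (Lc : yc ≅ ρ.obj c yb) (Ld : yd ≅ ρ.obj m x) (t r₁ r₂ r₃ r₄ : kˣ)
    (hr : t * (r₁ * r₂) = r₃ * r₄ * α c b a ^ (s : ℤ)) :
    (t : k) • (((r₁ : k) • (Signed.iso s (Kc ≪≫ ρ.actIso c Kb ≪≫ ρ.psiApp c b cb hcb xa ≪≫
          La.symm)).hom) ≫
        ((r₂ : k) • (Signed.iso s (La ≪≫ ρ.actIso cb Ka ≪≫ ρ.psiApp cb a m h x ≪≫
          Ld.symm)).hom)) =
      ((r₃ : k) • (Signed.iso s (Kc ≪≫ ρ.actIso c (Kb ≪≫ ρ.actIso b Ka ≪≫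
          ρ.psiApp b a ba hba x ≪≫ Lb.symm) ≪≫ Lc.symm)).hom) ≫
        ((r₄ : k) • (Signed.iso s (Lc ≪≫ ρ.actIso c Lb ≪≫ ρ.psiApp c ba m h' x ≪≫
          Ld.symm)).hom) := by
  have n := ρ.psiApp_iso_naturality c b cb hcb Ka
  have A := hρ.signed_assoc s hcb hba h h' x
  have e₁ : (Kc ≪≫ ρ.actIso c Kb ≪≫ ρ.psiApp c b cb hcb xa ≪≫ La.symm) ≪≫
      (La ≪≫ ρ.actIso cb Ka ≪≫ ρ.psiApp cb a m h x ≪≫ Ld.symm) =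
      (Kc ≪≫ ρ.actIso c Kb ≪≫ ρ.actIso c (ρ.actIso b Ka)) ≪≫
        (ρ.psiApp c b cb hcb (ρ.obj a x) ≪≫ ρ.psiApp cb a m h x) ≪≫ Ld.symm := by
    have n' := congrArg Iso.hom n
    simp only [Iso.trans_hom] at n'
    ext
    simp [reassoc_of% n']
  have e₂ : (Kc ≪≫ ρ.actIso c (Kb ≪≫ ρ.actIso b Ka ≪≫ ρ.psiApp b a ba hba x ≪≫ Lb.symm) ≪≫
        Lc.symm) ≪≫ (Lc ≪≫ ρ.actIso c Lb ≪≫ ρ.psiApp c ba m h' x ≪≫ Ld.symm) =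
      (Kc ≪≫ ρ.actIso c Kb ≪≫ ρ.actIso c (ρ.actIso b Ka)) ≪≫
        (ρ.actIso c (ρ.psiApp b a ba hba x) ≪≫ ρ.psiApp c ba m h' x) ≪≫ Ld.symm := by
    ext
    simp [actIso_trans, actIso_symm]
  rw [Linear.smul_comp, Linear.comp_smul, Linear.smul_comp, Linear.comp_smul,
    ← Signed.iso_trans_hom, ← Signed.iso_trans_hom, e₁, e₂]
  simp only [Signed.iso_trans_hom, Category.assoc]
  rw [← reassoc_of% A]
  simp only [Linear.smul_comp, Linear.comp_smul, Category.assoc, smul_smul, ← Units.val_mul]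
  rw [hr, mul_assoc r₃]

theorem IsTwisted.unit_left_entries (hρ : ρ.IsTwisted α) (s : ℤˣ) {η ω : Γ} (hη : η = 1)
    (h : η * ω = ω) {x y z : V} (Ka : y ≅ ρ.obj ω x) (Kb : z ≅ ρ.obj η y) (r : kˣ) (hr : r = 1) :
    (r : k) • (Signed.iso s (Kb ≪≫ ρ.actIso η Ka ≪≫ ρ.psiApp η ω ω h x ≪≫ Ka.symm)).hom =
      (Signed.iso s (Kb ≪≫ ρ.castIso hη rfl ≪≫ ρ.psiEApp y)).hom := by
  subst hη hr
  have n := ρ.psiEApp_naturality (Signed.iso (π 1) Ka).hom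
  rw [hρ.unit_left, Units.val_one, one_smul]
  congr 2
  ext
  simp only [castIso, eqToIso_refl, Iso.refl_trans, Iso.trans_hom, Iso.symm_hom, actIso,
    Functor.mapIso_hom]
  rw [reassoc_of% n]
  simp

theorem IsTwisted.unit_right_entries (hρ : ρ.IsTwisted α) (s : ℤˣ) {η ω : Γ} (hη : η = 1)
    (h : ω * η = ω) {x y z t : V} (Ka : y ≅ ρ.obj η x) (Kb : z ≅ ρ.obj ω y) (L : t ≅ ρ.obj ω x)
    (r r' : kˣ) (hr : r = r') :
    (r : k) • (Signed.iso s (Kb ≪≫ ρ.actIso ω Ka ≪≫ ρ.psiApp ω η ω h x ≪≫ L.symm)).hom =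
      (r' : k) • (Signed.iso s (Kb ≪≫ ρ.actIso ω (Ka ≪≫ ρ.castIso hη rfl ≪≫ ρ.psiEApp x) ≪≫
        L.symm)).hom := by
  subst hη hr
  rw [hρ.unit_right]
  simp [castIso, actIso_trans]

end Entries

variable {k : Type w} [Field k] {Γ : Type u₁} [Group Γ] {π : Γ →* ℤˣ} {H : Subgroup Γ}
  {V : Type u} [Category.{v} V] [Preadditive V] [Linear k V]
  (ρ : RealTwoRepData k (π.comp H.subtype) V) (σ : Γ ⧸ H → Γ)
  (hσ : ∀ q, (σ q : Γ ⧸ H) = q) (α : ThreeCocycle k π)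

theorem mul_trans (ω : Γ) (i j : Γ ⧸ H) (h : ω • i = j) :
    σ j * (trans σ hσ ω i j h : Γ) = ω * σ i := by simp [trans]

/-- The representative moves past the three elements one at a time. Writing `η` for the resulting
elements of `H`, the cocycle identity is taken at `[c|b|a|σ_i]`, `[c|b|σ_j|η_a]`, `[c|σ_l|η_b|η_a]`
and `[σ_m|η_c|η_b|η_a]`, with alternating signs. Since `σ_j η_a = a σ_i` and so on, all mixed terms
cancel except those collected in `rindFactor`. The exponent `π(σ_m)` comes from the last identity.
-/
theorem rindFactor_cocycle (c b a : Γ) {i j l m : Γ ⧸ H} (h₁ : a • i = j) (h₂ : b • j = l)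
    (h₃ : c • l = m) (hba : (b * a) • i = l) (hcb : (c * b) • j = m) :
    α.toFun c b a * (rindFactor σ hσ α c b j l m h₂ h₃ *
        rindFactor σ hσ α (c * b) a i j m h₁ hcb) =
      rindFactor σ hσ α b a i j l h₁ h₂ ^ ((π c : ℤˣ) : ℤ) *
        rindFactor σ hσ α c (b * a) i l m hba h₃ *
        α.toFun (trans σ hσ c l m h₃) (trans σ hσ b j l h₂) (trans σ hσ a i j h₁) ^
          ((π (σ m) : ℤˣ) : ℤ) := by
  apply Additive.ofMul.injective
  have r₁ := α.additive c b a (σ i)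
  have r₂ := α.additive c b (σ j) (trans σ hσ a i j h₁)
  have r₃ := α.additive c (σ l) (trans σ hσ b j l h₂) (trans σ hσ a i j h₁)
  have r₄ := α.additive (σ m) (trans σ hσ c l m h₃) (trans σ hσ b j l h₂) (trans σ hσ a i j h₁)
  rw [mul_trans] at r₂ r₃ r₄
  have t₁ := congrArg (Subtype.val : H → Γ) (trans_mul σ hσ b a (b * a) rfl i j l h₁ h₂ hba)
  have t₂ := congrArg (Subtype.val : H → Γ) (trans_mul σ hσ c b (c * b) rfl j l m h₂ h₃ hcb)
  rw [Subgroup.coe_mul] at t₁ t₂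
  rw [t₁] at r₃ r₄
  rw [t₂] at r₄
  simp only [rindFactor, ofMul_mul, ofMul_div, ofMul_zpow]
  linear_combination (norm := module) r₂ - r₁ - r₃ + r₄

theorem rind_assoc (hρ : ρ.IsTwisted (α.restrict H).toFun) (c b a : Γ) (x : RIndCat π V σ) :
    (α.toFun c b a : k) • (((ρ.rind σ hσ α).psiApp c b (c * b) rfl
          ((ρ.rind σ hσ α).obj a x)).hom ≫
        ((ρ.rind σ hσ α).psiApp (c * b) a (c * b * a) rfl x).hom) =
      ((ρ.rind σ hσ α).actIso c ((ρ.rind σ hσ α).psiApp b a (b * a) rfl x)).hom ≫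
        ((ρ.rind σ hσ α).psiApp c (b * a) (c * b * a) (mul_assoc _ _ _).symm x).hom := by
  funext m
  -- In the component `m` only one path of cosets `i ↦ j ↦ l ↦ m` contributes.
  obtain ⟨l, h₃⟩ : ∃ l, c • l = m := ⟨c⁻¹ • m, smul_inv_smul _ _⟩
  obtain ⟨j, h₂⟩ : ∃ j, b • j = l := ⟨b⁻¹ • l, smul_inv_smul _ _⟩
  obtain ⟨i, h₁⟩ : ∃ i, a • i = j := ⟨a⁻¹ • j, smul_inv_smul _ _⟩
  have hba : (b * a) • i = l := by rw [mul_smul, h₁, h₂]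
  have hcb : (c * b) • j = m := by rw [mul_smul, h₂, h₃]
  have hcba : (c * b * a) • i = m := by rw [mul_smul, h₁, hcb]
  change (α.toFun c b a : k) • (((ρ.rind σ hσ α).psiApp c b (c * b) rfl
          ((ρ.rind σ hσ α).obj a x)).hom m ≫
        ((ρ.rind σ hσ α).psiApp (c * b) a (c * b * a) rfl x).hom m) =
      ((ρ.rind σ hσ α).actIso c ((ρ.rind σ hσ α).psiApp b a (b * a) rfl x)).hom m ≫
        ((ρ.rind σ hσ α).psiApp c (b * a) (c * b * a) (mul_assoc _ _ _).symm x).hom m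
  have e₁ := ρ.rind_psiApp_hom σ hσ α c b (c * b) rfl h₂ h₃ hcb ((ρ.rind σ hσ α).obj a x)
  have e₂ := ρ.rind_psiApp_hom σ hσ α (c * b) a (c * b * a) rfl h₁ hcb hcba x
  have e₃ := ρ.rind_actIso_hom σ hσ α c h₃ _ _ _
    (ρ.rind_psiApp_hom σ hσ α b a (b * a) rfl h₁ h₂ hba x)
  have e₄ := ρ.rind_psiApp_hom σ hσ α c (b * a) (c * b * a) (mul_assoc _ _ _).symm hba h₃ hcba x
  rw [e₁, e₂, e₃, e₄]
  exact hρ.assoc_entries (π (σ m)) (trans_mul σ hσ c b (c * b) rfl j l m h₂ h₃ hcb)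
    (trans_mul σ hσ b a (b * a) rfl i j l h₁ h₂ hba)
    (trans_mul σ hσ (c * b) a (c * b * a) rfl i j m h₁ hcb hcba)
    (trans_mul σ hσ c (b * a) (c * b * a) (mul_assoc _ _ _).symm i l m hba h₃ hcba)
    _ _ _ _ _ _ _ _ _ _ _ _ (rindFactor_cocycle σ hσ α c b a h₁ h₂ h₃ hba hcb)

theorem rind_isTwisted (hρ : ρ.IsTwisted (α.restrict H).toFun) :
    (ρ.rind σ hσ α).IsTwisted α.toFun where
  -- Supplied by `act_isEquivalence`, which needs only the composition and unit isomorphisms of the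
  -- Real induction.
  isEquivalence ω := inferInstance
  assoc := ρ.rind_assoc σ hσ α hρ
  unit_left ω x := by
    refine Iso.ext (funext fun l => ?_)
    obtain ⟨i, h⟩ : ∃ i, ω • i = l := ⟨ω⁻¹ • l, smul_inv_smul _ _⟩
    -- By normalization of `α`, the factor is trivial once one of the two elements is the unit.
    have hf : rindFactor σ hσ α 1 ω i l l h (one_smul _ l) = 1 := by
      simp [rindFactor, α.one_left, trans_one σ hσ l l, α.one_mid]
    rw [ρ.rind_psiApp_hom σ hσ α 1 ω ω _ h (one_smul _ l) h x,
      ρ.rind_psiEApp_hom σ hσ α l (one_smul _ l)]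
    exact hρ.unit_left_entries _ (trans_one σ hσ l l (one_smul _ l)) _ _ _ _ hf
  unit_right ω x := by
    refine Iso.ext (funext fun l => ?_)
    obtain ⟨i, h⟩ : ∃ i, ω • i = l := ⟨ω⁻¹ • l, smul_inv_smul _ _⟩
    have hf : rindFactor σ hσ α ω 1 i i l (one_smul _ i) h = 1 := by
      simp [rindFactor, α.one_mid, trans_one σ hσ i i, α.one_right]
    rw [ρ.rind_psiApp_hom σ hσ α ω 1 ω _ (one_smul _ i) h h x,
      ρ.rind_actIso_hom σ hσ α ω h _ 1 _ ((ρ.rind_psiEApp_hom σ hσ α i (one_smul _ i) x).trans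
        (one_smul k _).symm)]
    exact hρ.unit_right_entries _ (trans_one σ hσ i i (one_smul _ i)) _ _ _ _ _ _
      (hf.trans (one_zpow _).symm)

end RealTwoRepData

theorem comp_inv_eq_of_square {C : Type u} [Category.{v} C] {x y x₁ y₁ x₂ y₂ : C} {a : x ⟶ y}
    {s : x ⟶ x₁} {t : y ⟶ y₁} {b : x₁ ⟶ y₁} (K : x₂ ≅ x₁) (L : y₂ ≅ y₁) (h : a ≫ t = s ≫ b) :
    a ≫ t ≫ L.inv = (s ≫ K.inv) ≫ K.hom ≫ b ≫ L.inv := by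
  rw [Category.assoc, Iso.inv_hom_id_assoc, reassoc_of% h]

/-! ### Bending and the loop action on single entries -/

namespace RealTwoRepData

section Entries

variable {k : Type w} [Field k] {Γ : Type u₁} [Group Γ] {π : Γ →* ℤˣ}
  {V : Type u} [Category.{v} V] [Preadditive V] [Linear k V] {ρ : RealTwoRepData k π V}
  {α : Γ → Γ → Γ → kˣ}

/-- One entry of a bending in the Real induction, with the casts replaced by arbitrary isomorphisms.
The scalar `r` stands for the factor of the composition isomorphism; `flipFactor` appears because
the entry `signedTr s` may already be bent. -/
theorem IsTwisted.bend_entries (hρ : ρ.IsTwisted α) {s e : ℤˣ} (he : e = -s) {g : Loop π}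
    (φ : ρ.Tr g) {η η' μ : Γ} (hη : η = g.el ^ (s : ℤ)) (hη' : η' = g.el ^ (e : ℤ))
    (hμ : η' * η = μ) (hμ' : μ = 1) (hs : s = s * π η') {x xa xb xc xd : V}
    (K : xa ≅ ρ.obj η' x) (K' : xb ≅ ρ.obj η x) (L : xc ≅ ρ.obj η' xb) (M : xd ≅ ρ.obj μ x)
    (r : kˣ) :
    ((Signed.iso s K).hom ≫ ρ.innerMap η' hs (ρ.signedTr s η hη φ x ≫ (Signed.iso s K').inv) ≫
        (Signed.iso s L).inv) ≫
      ((r : k) • (Signed.iso s (L ≪≫ ρ.actIso η' K' ≪≫ ρ.psiApp η' η μ hμ x ≪≫ M.symm)).hom) ≫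
        (Signed.iso s (M ≪≫ ρ.castIso hμ' rfl ≪≫ ρ.psiEApp x)).hom =
      ((flipFactor α s g.el * r : kˣ) : k) •
        ((Signed.iso s K).hom ≫ Signed.flip he (ρ.signedTr e η' hη' φ x)) := by
  subst hμ'
  have h₁ := hρ.innerMap_signedTr_cap φ he hη hη' hμ hs x
  have h₂ : ρ.innerMap η' hs ((Signed.iso s K').inv) = (Signed.iso s (ρ.actIso η' K')).inv :=
    ρ.innerMap_iso η' hs K'.symm
  simp only [cap, Signed.iso_trans_hom] at h₁
  rw [mul_comm, Units.val_mul, mul_smul, ← Linear.comp_smul, ← h₁]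
  simp only [castIso, eqToIso_refl, Iso.refl_trans, innerMap_comp, h₂, Signed.iso_trans_hom,
    Linear.smul_comp, Linear.comp_smul, Category.assoc, Iso.inv_hom_id_assoc]
  congr 5
  exact Iso.inv_hom_id_assoc (Signed.iso s M) _

/-- One entry of the equation characterizing `β` in the Real induction, deduced from the
corresponding equation for `ρ` in sign `s`. The scalar identity `hr` isolates what has to be checked
for the cocycle. -/
theorem IsTwisted.beta_entries (hρ : ρ.IsTwisted α) {s e : ℤˣ} {a : Γ} (he : e = s * π a)
    {g g' : Loop π} (ha : realConj π a g.el = g'.el) (φ : ρ.Tr g) {q p μ : Γ}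
    (hq : q = g'.el ^ (s : ℤ)) (hp : p = g.el ^ (e : ℤ)) (hμ : q * a = μ) (hμ' : a * p = μ)
    {x xa xb xc xd xe : V} (K : xa ≅ ρ.obj a x) (L : xb ≅ ρ.obj q xa) (M : xc ≅ ρ.obj μ x)
    (N : xd ≅ ρ.obj p x) (P : xe ≅ ρ.obj a xd) (f : (⟨x⟩ : Signed e V) ⟶ ⟨xd⟩)
    (t r₁ r₂ d : kˣ) (hf : f ≫ (Signed.iso e N).hom = (d : k) • ρ.signedTr e p hp φ x)
    (hr : t * r₁ * bendFactor π α s a g.el = d * r₂) :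
    ((t : k) • (ρ.signedTr s q hq (ρ.beta a ha φ) xa ≫ (Signed.iso s L).inv)) ≫
        ((r₁ : k) • (Signed.iso s (L ≪≫ ρ.actIso q K ≪≫ ρ.psiApp q a μ hμ x ≪≫ M.symm)).hom) =
      ((Signed.iso s K).hom ≫ ρ.innerMap a he f ≫ (Signed.iso s P).inv) ≫
        ((r₂ : k) • (Signed.iso s (P ≪≫ ρ.actIso a N ≪≫ ρ.psiApp a p μ hμ' x ≪≫ M.symm)).hom) := by
  have h₁ := ρ.signedTr_iso_naturality (ρ.beta a ha φ) hq K
  have h₂ := hρ.signedTr_beta s a ha φ he hq hp hμ hμ' x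
  have h₃ := congrArg (ρ.innerMap a he) hf
  rw [innerMap_comp, innerMap_iso, innerMap_smul] at h₃
  simp only [Signed.iso_trans_hom, Linear.smul_comp, Linear.comp_smul, Category.assoc,
    Iso.inv_hom_id_assoc, smul_smul, ← Units.val_mul]
  rw [← reassoc_of% h₁, reassoc_of% h₂, reassoc_of% h₃]
  simp only [Linear.smul_comp, Linear.comp_smul, Category.assoc, smul_smul, ← Units.val_mul]
  rw [mul_comm r₁, hr, mul_comm d]

end Entries

variable {k : Type w} [Field k] {Γ : Type u₁} [Group Γ] {π : Γ →* ℤˣ} {H : Subgroup Γ}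
  {V : Type u} [Category.{v} V] [Preadditive V] [Linear k V]
  (ρ : RealTwoRepData k (π.comp H.subtype) V) (σ : Γ ⧸ H → Γ)
  (hσ : ∀ q, (σ q : Γ ⧸ H) = q) (α : ThreeCocycle k π)

/-! ## The summands of the categorical trace of the Real induction -/

theorem trans_eq_fixedLoop_zpow (g : Loop π) (q : Γ ⧸ H) (hq : g.el • q = q) :
    trans σ hσ g.el q q hq = (fixedLoop σ hσ g q hq).el ^ ((π (σ q) : ℤˣ) : ℤ) := by
  rcases Int.units_eq_one_or (π (σ q)) with h | h <;> simp [fixedLoop, h]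

/-- The `q` component of the natural transformation attached to `v`. -/
def summandEntry (g : Loop π) (q : Γ ⧸ H) (hq : g.el • q = q) (v : ρ.Tr (fixedLoop σ hσ g q hq))
    (x : RIndCat π V σ) : x q ⟶ (ρ.rind σ hσ α).obj g.el x q :=
  (ρ.signedTr (π (σ q)) (trans σ hσ g.el q q hq) (trans_eq_fixedLoop_zpow σ hσ g q hq) v (x q).un :
      (⟨(x q).un⟩ : Signed (π (σ q)) V) ⟶ _) ≫
    (Signed.iso (π (σ q)) (ρ.rindCast σ hσ g.el q q hq x)).inv

set_option linter.unusedSectionVars false in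
theorem rindComp_of_eq_one {ε : ℤˣ} {i : Γ ⧸ H} (hε : ε = 1) (he : π (σ i) = ε * π (σ i))
    {x y : RIndCat π V σ} (f : (⟨x⟩ : Signed ε (RIndCat π V σ)) ⟶ ⟨y⟩) :
    rindComp σ he f = f.pos hε i := by
  subst hε
  ext h <;> rfl

theorem summandEntry_naturality (g : Loop π) (q : Γ ⧸ H) (hq : g.el • q = q)
    (v : ρ.Tr (fixedLoop σ hσ g q hq)) {x y : RIndCat π V σ}
    (f : (⟨x⟩ : Signed (π g.el) (RIndCat π V σ)) ⟶ ⟨y⟩) :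
    f.pos g.deg q ≫ ρ.summandEntry σ hσ α g q hq v y =
      ρ.summandEntry σ hσ α g q hq v x ≫ (ρ.rindAct σ hσ g.el).map f q := by
  have hd : π (σ q) = π g.el * π (σ q) := by rw [g.deg, one_mul]
  have hd' := hd.trans (trans_deg σ hσ g.el q q hq)
  have hη : (π.comp H.subtype) (trans σ hσ g.el q q hq) = 1 := by
    rw [trans_eq_fixedLoop_zpow]; exact loop_zpow_deg _ _
  have h₁ := ρ.signedTr_naturality _ (trans_eq_fixedLoop_zpow σ hσ g q hq) hη v (f.pos g.deg q)
  have h₂ := ρ.rindAct_map_eq σ hσ g.el hq hd hd' f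
  rw [rindComp_of_eq_one σ g.deg hd, ρ.innerMap_pos _ hη] at h₂
  exact (comp_inv_eq_of_square _ _ h₁).trans
    (congrArg (ρ.summandEntry σ hσ α g q hq v x ≫ ·) h₂).symm

theorem summandEntry_add (g : Loop π) (q : Γ ⧸ H) (hq : g.el • q = q)
    (v v' : ρ.Tr (fixedLoop σ hσ g q hq)) (x : RIndCat π V σ) :
    ρ.summandEntry σ hσ α g q hq (v + v') x =
      ρ.summandEntry σ hσ α g q hq v x + ρ.summandEntry σ hσ α g q hq v' x := by
  refine (congrArg (· ≫ (Signed.iso (π (σ q)) (ρ.rindCast σ hσ g.el q q hq x)).inv)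
    (ρ.signedTr_add _ _ _ v v' _)).trans ?_
  exact Preadditive.add_comp _ _ _ _ _ _

theorem summandEntry_smul (g : Loop π) (q : Γ ⧸ H) (hq : g.el • q = q) (c : k)
    (v : ρ.Tr (fixedLoop σ hσ g q hq)) (x : RIndCat π V σ) :
    ρ.summandEntry σ hσ α g q hq (c • v) x = c • ρ.summandEntry σ hσ α g q hq v x := by
  refine (congrArg (· ≫ (Signed.iso (π (σ q)) (ρ.rindCast σ hσ g.el q q hq x)).inv)
    (ρ.signedTr_smul _ _ _ c v _)).trans ?_
  exact Linear.smul_comp _ _ _ _ _ _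

open scoped Classical in
/-- The natural transformation from `1` to `RInd(ρ)(g)` attached to an element of the categorical
trace of `ρ` over `σ_q⁻¹ g^{π(σ_q)} σ_q`. -/
noncomputable def summand (g : Loop π) (q : Γ ⧸ H) (hq : g.el • q = q) :
    ρ.Tr (fixedLoop σ hσ g q hq) →ₗ[k] (ρ.rind σ hσ α).Tr g where
  toFun v :=
    { app x := Pi.single (M := fun l => x.un l ⟶ (ρ.rind σ hσ α).obj g.el x.un l) q
        (ρ.summandEntry σ hσ α g q hq v x.un)
      naturality x y f := by
        refine funext fun l => ?_
        change f.pos g.deg l ≫ Pi.single (M := fun l => y.un l ⟶ (ρ.rind σ hσ α).obj g.el y.un l) q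
            (ρ.summandEntry σ hσ α g q hq v y.un) l =
          Pi.single (M := fun l => x.un l ⟶ (ρ.rind σ hσ α).obj g.el x.un l) q
            (ρ.summandEntry σ hσ α g q hq v x.un) l ≫ (ρ.rindAct σ hσ g.el).map f l
        by_cases h : l = q
        · subst h
          rw [Pi.single_eq_same, Pi.single_eq_same]
          exact ρ.summandEntry_naturality σ hσ α g l hq v f
        · rw [Pi.single_eq_of_ne h, Pi.single_eq_of_ne h]
          exact Limits.comp_zero.trans Limits.zero_comp.symm }
  map_add' v v' := (ρ.rind σ hσ α).tr_ext fun x =>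
    (congrArg (Pi.single q) (ρ.summandEntry_add σ hσ α g q hq v v' x)).trans (Pi.single_add _ _ _)
  map_smul' c v := (ρ.rind σ hσ α).tr_ext fun x =>
    (congrArg (Pi.single q) (ρ.summandEntry_smul σ hσ α g q hq c v x)).trans (Pi.single_smul _ _ _)

theorem trApp_summand_self (g : Loop π) (q : Γ ⧸ H) (hq : g.el • q = q)
    (v : ρ.Tr (fixedLoop σ hσ g q hq)) (x : RIndCat π V σ) :
    (ρ.rind σ hσ α).trApp (ρ.summand σ hσ α g q hq v) x q = ρ.summandEntry σ hσ α g q hq v x := by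
  classical
  exact Pi.single_eq_same (M := fun l => x l ⟶ (ρ.rind σ hσ α).obj g.el x l) q _

theorem trApp_summand_of_ne (g : Loop π) (q : Γ ⧸ H) (hq : g.el • q = q)
    (v : ρ.Tr (fixedLoop σ hσ g q hq)) (x : RIndCat π V σ) {r : Γ ⧸ H} (hr : r ≠ q) :
    (ρ.rind σ hσ α).trApp (ρ.summand σ hσ α g q hq v) x r = 0 := by
  classical
  exact Pi.single_eq_of_ne (M := fun l => x l ⟶ (ρ.rind σ hσ α).obj g.el x l) hr _

theorem summand_isSummandOf (g : Loop π) (q : Γ ⧸ H) (hq : g.el • q = q)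
    (v : ρ.Tr (fixedLoop σ hσ g q hq)) :
    IsSummandOf σ hσ ρ α g q hq v (ρ.summand σ hσ α g q hq v) where
  diagonal x _ := by
    rw [trApp_summand_self]
    refine (Category.assoc _ _ _).trans (Eq.trans (congrArg (_ ≫ ·) ?_) (Category.comp_id _))
    exact (Signed.iso (π (σ q)) (ρ.rindCast σ hσ g.el q q hq x)).inv_hom_id
  off_diagonal x _ hr := ρ.trApp_summand_of_ne σ hσ α g q hq v x hr

end RealTwoRepData

theorem comp_comp_eq_zero {C : Type u} [Category.{v} C] [Preadditive C] {x y z t r : C}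
    (a : x ⟶ y) {f : y ⟶ z} (b : z ⟶ t) (c : t ⟶ r) (hf : f = 0) : (a ≫ f ≫ b) ≫ c = 0 := by
  rw [hf, Limits.zero_comp, Limits.comp_zero, Limits.zero_comp]

theorem smul_comp_eq_zero {k : Type w} [Field k] {C : Type u} [Category.{v} C] [Preadditive C]
    [Linear k C] {x y z : C} {f : x ⟶ y} (c : k) (a : y ⟶ z) (hf : f = 0) : (c • f) ≫ a = 0 := by
  rw [hf, smul_zero, Limits.zero_comp]

theorem inv_comp_smul_hom_comp {k : Type w} [Field k] {C : Type u} [Category.{v} C] [Preadditive C]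
    [Linear k C] {x y z : C} (K : x ≅ y) (f : y ⟶ z) (c : k) :
    K.inv ≫ (c • (K.hom ≫ f)) = c • f := by
  rw [Linear.comp_smul, Iso.inv_hom_id_assoc]

namespace RealTwoRepData

variable {k : Type w} [Field k] {Γ : Type u₁} [Group Γ] {π : Γ →* ℤˣ} {H : Subgroup Γ}
  {V : Type u} [Category.{v} V] [Preadditive V] [Linear k V]
  (ρ : RealTwoRepData k (π.comp H.subtype) V) (σ : Γ ⧸ H → Γ)
  (hσ : ∀ q, (σ q : Γ ⧸ H) = q) (α : ThreeCocycle k π)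

theorem innerMap_zero {Γ : Type u₁} [Group Γ] {π : Γ →* ℤˣ} (ρ : RealTwoRepData k π V) {ε ε₂ : ℤˣ}
    (ω : Γ) (h : ε = ε₂ * π ω) (x y : V) :
    ρ.innerMap ω h (0 : (⟨x⟩ : Signed ε V) ⟶ ⟨y⟩) = 0 := by
  have := ρ.innerMap_smul ω h (0 : k) (0 : (⟨x⟩ : Signed ε V) ⟶ ⟨y⟩)
  rwa [zero_smul, zero_smul] at this

theorem trans_eq_fixedLoop_zpow_of_eq (g : Loop π) (q : Γ ⧸ H) (hq : g.el • q = q) {ε e : ℤˣ}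
    {p : Γ} (hp : p = g.el ^ (ε : ℤ)) (hpq : p • q = q) (he : e = ε * π (σ q)) :
    trans σ hσ p q q hpq = (fixedLoop σ hσ g q hq).el ^ (e : ℤ) := by
  subst he
  rcases Int.units_eq_one_or ε with rfl | rfl
  · obtain rfl : p = g.el := by simpa using hp
    rw [one_mul]
    exact trans_eq_fixedLoop_zpow σ hσ g q hq
  · obtain rfl : p = g.el⁻¹ := by simpa using hp
    have h := trans_eq_fixedLoop_zpow σ hσ g q hq
    rw [neg_one_mul, Units.val_neg, zpow_neg, ← h]
    apply Subtype.ext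
    simp [trans, mul_assoc]

set_option linter.unusedSectionVars false in
theorem flip_rindComp {ε e : ℤˣ} {i : Γ ⧸ H} (hε : ε = -1) (he : e = ε * π (σ i))
    (he' : e = -π (σ i)) {x y : RIndCat π V σ} (f : (⟨x⟩ : Signed ε (RIndCat π V σ)) ⟶ ⟨y⟩) :
    Signed.flip he' (rindComp σ he f) = f.neg hε i := by
  subst hε
  ext h <;> rfl

theorem signedTr_pos {Γ : Type u₁} [Group Γ] {π : Γ →* ℤˣ} (ρ : RealTwoRepData k π V) {g : Loop π}
    (hp : g.el = g.el ^ ((1 : ℤˣ) : ℤ)) (φ : ρ.Tr g) (x : V) (h : (1 : ℤˣ) = 1) :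
    (ρ.signedTr 1 g.el hp φ x).pos h = ρ.trApp φ x := by
  simp [signedTr, castIso]

theorem signedTr_neg {Γ : Type u₁} [Group Γ] {π : Γ →* ℤˣ} (ρ : RealTwoRepData k π V) {g : Loop π}
    (hp : g.el⁻¹ = g.el ^ ((-1 : ℤˣ) : ℤ)) (φ : ρ.Tr g) (x : V) (h : (-1 : ℤˣ) = -1) :
    (ρ.signedTr (-1) g.el⁻¹ hp φ x).neg h = ρ.bend φ x := by
  simp [signedTr, castIso]

/-- The `i` component of the bending of an element of the categorical trace of the Real
induction. -/
theorem rind_bend_apply {g : Loop π} (T : (ρ.rind σ hσ α).Tr g) (x : RIndCat π V σ)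
    {i j : Γ ⧸ H} (h' : g.el⁻¹ • j = i)
    (hi : π (σ j) = π (σ i) * (π.comp H.subtype) (trans σ hσ g.el⁻¹ j i h')) :
    (ρ.rind σ hσ α).bend T x i =
      ((Signed.iso (π (σ i)) (ρ.rindCast σ hσ g.el⁻¹ j i h' x)).hom ≫
        ρ.innerMap (trans σ hσ g.el⁻¹ j i h') hi ((ρ.rind σ hσ α).trApp T x j) ≫
        (Signed.iso (π (σ i)) (ρ.rindCast σ hσ g.el⁻¹ j i h'
          ((ρ.rind σ hσ α).obj g.el x))).inv) ≫
      ((ρ.rind σ hσ α).cap g.el⁻¹ g.el (inv_mul_cancel _) x).hom i := by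
  have hd : π g.el⁻¹ = 1 := by rw [map_inv, g.deg, inv_one]
  have he : π (σ j) = π g.el⁻¹ * π (σ j) := by rw [hd, one_mul]
  have h₁ := ρ.rindAct_map_eq σ hσ g.el⁻¹ h' he hi (posHom hd ((ρ.rind σ hσ α).trApp T x))
  rw [rindComp_of_eq_one σ hd he] at h₁
  exact congrArg (· ≫ ((ρ.rind σ hσ α).cap g.el⁻¹ g.el (inv_mul_cancel _) x).hom i) h₁

/-- Bending preserves the support: the `i` component of the bent transformation is built from the `g
• i` component, and `g` fixes `q`, so `i ≠ q` implies `g • i ≠ q`. -/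
theorem rindComp_signedTr_summand_of_ne (g : Loop π) (q : Γ ⧸ H) (hq : g.el • q = q)
    (v : ρ.Tr (fixedLoop σ hσ g q hq)) {ε e : ℤˣ} {p : Γ} (hp : p = g.el ^ (ε : ℤ)) {i : Γ ⧸ H}
    (hi : i ≠ q) (he : e = ε * π (σ i)) (y : RIndCat π V σ) :
    rindComp σ he ((ρ.rind σ hσ α).signedTr ε p hp (ρ.summand σ hσ α g q hq v) y) = 0 := by
  rcases Int.units_eq_one_or ε with rfl | rfl
  · obtain rfl : p = g.el := by simpa using hp
    obtain rfl : e = π (σ i) := by simpa using he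
    rw [rindComp_of_eq_one σ rfl he, signedTr_pos]
    exact ρ.trApp_summand_of_ne σ hσ α g q hq v y hi
  · obtain rfl : p = g.el⁻¹ := by simpa using hp
    have he' : e = -π (σ i) := by simpa using he
    have hj : g.el • i ≠ q := fun h => hi (smul_left_cancel g.el (h.trans hq.symm))
    have hd : π (σ (g.el • i)) = π (σ i) *
        (π.comp H.subtype) (trans σ hσ g.el⁻¹ (g.el • i) i (inv_smul_smul _ _)) := by
      rw [← trans_deg σ hσ g.el⁻¹, map_inv, g.deg, inv_one, one_mul]
    apply Signed.flip_injective he'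
    rw [flip_rindComp σ rfl he he', signedTr_neg,
      ρ.rind_bend_apply σ hσ α _ y (inv_smul_smul _ _) hd,
      ρ.trApp_summand_of_ne σ hσ α g q hq v y hj]
    exact comp_comp_eq_zero _ _ _ (ρ.innerMap_zero _ hd _ _)

/-- Bending in the Real induction and bending in `ρ` differ by `flipFactor` and the factor of the
composition isomorphism for `(g⁻¹, g)`. Their product is precisely the `bendFactor` of `σ_q`, so the
summand behaves under bending as if it were the image of `v` under `σ_q`. -/
theorem rindComp_signedTr_summand (hρ : ρ.IsTwisted (α.restrict H).toFun) (g : Loop π) (q : Γ ⧸ H)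
    (hq : g.el • q = q) (v : ρ.Tr (fixedLoop σ hσ g q hq)) {ε e : ℤˣ} {p : Γ}
    (hp : p = g.el ^ (ε : ℤ)) (hpq : p • q = q) (he : e = ε * π (σ q)) (y : RIndCat π V σ) :
    (rindComp σ he ((ρ.rind σ hσ α).signedTr ε p hp (ρ.summand σ hσ α g q hq v) y) ≫
        (Signed.iso e (ρ.rindCast σ hσ p q q hpq y)).hom :
          (⟨(y q).un⟩ : Signed e V) ⟶ ⟨ρ.obj (trans σ hσ p q q hpq) (y q).un⟩) =
      (bendFactor π α.toFun ε (σ q) (fixedLoop σ hσ g q hq).el : k) •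
        ρ.signedTr e (trans σ hσ p q q hpq)
          (trans_eq_fixedLoop_zpow_of_eq σ hσ g q hq hp hpq he) v (y q).un := by
  have hη := trans_eq_fixedLoop_zpow_of_eq σ hσ g q hq hp hpq he
  rcases Int.units_eq_one_or ε with rfl | rfl
  · obtain rfl : p = g.el := by simpa using hp
    obtain rfl : e = π (σ q) := by simpa using he
    rw [rindComp_of_eq_one σ rfl he, signedTr_pos, trApp_summand_self, bendFactor, if_pos rfl,
      Units.val_one, one_smul]
    exact (Category.assoc _ _ _).trans ((congrArg (_ ≫ ·) (Iso.inv_hom_id _)).trans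
      (Category.comp_id _))
  · obtain rfl : p = g.el⁻¹ := by simpa using hp
    have he' : e = -π (σ q) := by simpa using he
    have hd : π (σ q) = π (σ q) * (π.comp H.subtype) (trans σ hσ g.el⁻¹ q q hpq) := by
      rw [← trans_deg σ hσ g.el⁻¹, map_inv, g.deg, inv_one, one_mul]
    have h₁ := hρ.bend_entries he' v (trans_eq_fixedLoop_zpow σ hσ g q hq) hη
      (trans_mul σ hσ g.el⁻¹ g.el 1 (inv_mul_cancel _) q q q hq hpq (one_smul _ q))
      (trans_one σ hσ q q (one_smul _ q)) hd (ρ.rindCast σ hσ g.el⁻¹ q q hpq y)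
      (ρ.rindCast σ hσ g.el q q hq y)
      (ρ.rindCast σ hσ g.el⁻¹ q q hpq ((ρ.rind σ hσ α).obj g.el y))
      (ρ.rindCast σ hσ 1 q q (one_smul _ q) y) (rindFactor σ hσ α g.el⁻¹ g.el q q q hq hpq)
    have h₂ : (ρ.rind σ hσ α).bend (ρ.summand σ hσ α g q hq v) y q =
        ((flipFactor (α.restrict H).toFun (π (σ q)) (fixedLoop σ hσ g q hq).el *
          rindFactor σ hσ α g.el⁻¹ g.el q q q hq hpq : kˣ) : k) •
        ((Signed.iso (π (σ q)) (ρ.rindCast σ hσ g.el⁻¹ q q hpq y)).hom ≫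
          Signed.flip he' (ρ.signedTr e (trans σ hσ g.el⁻¹ q q hpq) hη v (y q).un)) := by
      rw [ρ.rind_bend_apply σ hσ α _ y hpq hd, trApp_summand_self]
      refine (congrArg (_ ≫ ·) ?_).trans h₁
      exact (congrArg₂ (· ≫ ·) (ρ.rind_psiApp_hom σ hσ α g.el⁻¹ g.el 1 (inv_mul_cancel _) hq hpq
        (one_smul _ q) y) (ρ.rind_psiEApp_hom σ hσ α q (one_smul _ q) y))
    -- With `η = σ_q⁻¹ g σ_q = h_q^{π(σ_q)}`, the two products of values of `α` coincide term by
    -- term.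
    have h₃ : flipFactor (α.restrict H).toFun (π (σ q)) (fixedLoop σ hσ g q hq).el *
        rindFactor σ hσ α g.el⁻¹ g.el q q q hq hpq =
        bendFactor π α.toFun (-1) (σ q) (fixedLoop σ hσ g q hq).el := by
      have hη₀ := congrArg (Subtype.val : H → Γ) (trans_eq_fixedLoop_zpow σ hσ g q hq)
      have hη₁ := congrArg (Subtype.val : H → Γ) hη
      rw [Subgroup.coe_zpow] at hη₀ hη₁
      rw [he', Units.val_neg] at hη₁
      rw [bendFactor, if_neg (by decide), ← hη₀, ← hη₁, mul_trans, mul_trans,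
        mul_inv_cancel_right, mul_inv_cancel_right]
      rfl
    apply Signed.flip_injective he'
    have h₄ := flip_rindComp σ rfl he he'
      ((ρ.rind σ hσ α).signedTr (-1) g.el⁻¹ hp (ρ.summand σ hσ α g q hq v) y)
    rw [signedTr_neg, h₂, h₃] at h₄
    refine Eq.trans (congrArg
      ((Signed.iso (π (σ q)) (ρ.rindCast σ hσ g.el⁻¹ q q hpq y)).inv ≫ ·) h₄) ?_
    exact inv_comp_smul_hom_comp _ _ _

/-! ## The action of the loop groupoid on the summands -/

/-- After Real conjugation by `σ_l`, which is injective, both sides equal `g'`: indeed `σ_l η = f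
σ_q`, and `σ_q` carries `h_q` to `g`. -/
theorem realConj_trans_fixedLoop {g g' : Loop π} (f : Γ) (hf : realConj π f g.el = g'.el)
    {q l : Γ ⧸ H} (hq : g.el • q = q) (hl : g'.el • l = l) (hql : f • q = l) :
    realConj (π.comp H.subtype) (trans σ hσ f q l hql) (fixedLoop σ hσ g q hq).el =
      (fixedLoop σ hσ g' l hl).el := by
  apply Subtype.ext
  have h₁ := (fixedLoopHom σ hσ g q hq).2
  have h₂ := (fixedLoopHom σ hσ g' l hl).2
  have h₃ : ((realConj (π.comp H.subtype) (trans σ hσ f q l hql) (fixedLoop σ hσ g q hq).el : H) :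
      Γ) = realConj π (trans σ hσ f q l hql : Γ) ((fixedLoop σ hσ g q hq).el : Γ) := by
    simp [realConj]
  have h₄ : realConj π (σ l) (realConj π (trans σ hσ f q l hql : Γ)
      ((fixedLoop σ hσ g q hq).el : Γ)) = realConj π (σ l) ((fixedLoop σ hσ g' l hl).el : Γ) := by
    rw [← realConj_mul, mul_trans, realConj_mul]
    exact (congrArg (realConj π f) h₁).trans (hf.trans h₂.symm)
  have h₅ := congrArg (realConj π (σ l)⁻¹) h₄
  rw [← realConj_mul, ← realConj_mul π (σ l)⁻¹, inv_mul_cancel, realConj_one, realConj_one] at h₅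
  exact h₃.trans h₅

/-- Once each transgression is split as `bendFactor` times three values of `α`, the two sides have
the same factors after cancellation. The cocycle identity is not needed here; the scalars of the
Real induction are exactly those that make this a tautology. -/
theorem transgression_rindFactor {g g' : Loop π} (f : Γ) (hf : realConj π f g.el = g'.el)
    {q l : Γ ⧸ H} (hq : g.el • q = q) (hl : g'.el • l = l) (hql : f • q = l) {p : Γ}
    (hp : p = g.el ^ ((π f : ℤˣ) : ℤ)) (hpq : p • q = q) :
    transgressionFun π α.toFun f (σ q) (fixedLoop σ hσ g q hq).el /
          transgressionFun π α.toFun (σ l) (trans σ hσ f q l hql) (fixedLoop σ hσ g q hq).el *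
        rindFactor σ hσ α g'.el f q l l hql hl *
        bendFactor (π.comp H.subtype) (α.restrict H).toFun (π (σ l)) (trans σ hσ f q l hql)
          (fixedLoop σ hσ g q hq).el =
      bendFactor π α.toFun (π f) (σ q) (fixedLoop σ hσ g q hq).el *
        rindFactor σ hσ α f p q q l hpq hql := by
  have hP := congrArg (Subtype.val : H → Γ)
    (trans_eq_fixedLoop_zpow_of_eq σ hσ g q hq hp hpq (map_mul π f (σ q)))
  rw [Subgroup.coe_zpow] at hP
  have hb : bendFactor (π.comp H.subtype) (α.restrict H).toFun (π (σ l)) (trans σ hσ f q l hql)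
      (fixedLoop σ hσ g q hq).el = bendFactor π α.toFun (π (σ l)) (trans σ hσ f q l hql : Γ)
        ((fixedLoop σ hσ g q hq).el : Γ) := by
    simp [bendFactor, flipFactor]
  have hσp : σ q * (trans σ hσ p q q hpq : Γ) * (σ q)⁻¹ = p := by
    rw [mul_trans, mul_inv_cancel_right]
  have hg' : f * σ q * (trans σ hσ p q q hpq : Γ) * (f * σ q)⁻¹ = g'.el := by
    rw [mul_assoc f, mul_trans, ← hf, realConj, hp]
    group
  have hQ : (trans σ hσ f q l hql : Γ) * (trans σ hσ p q q hpq : Γ) *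
      (trans σ hσ f q l hql : Γ)⁻¹ = (trans σ hσ g'.el l l hl : Γ) := by
    have : (trans σ hσ g'.el l l hl : Γ) = (σ l)⁻¹ * (g'.el * σ l) := rfl
    rw [this, ← hg', ← mul_trans σ hσ f q l hql]
    group
  rw [transgressionFun_eq, transgressionFun_eq, mul_trans, ← hP, hg', hσp, hQ, hb, rindFactor,
    rindFactor]
  apply Additive.ofMul.injective
  simp only [ofMul_mul, ofMul_div]
  abel

/-- The scalar is the one forced in the induced representation, where `f` sends `σ_q ⊗ v` to `θ(f,
σ_q) fσ_q ⊗ v`, and `fσ_q = σ_l η` turns this into a multiple of `σ_l ⊗ η v`. The right-hand side is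
checked against the equation characterizing `β`: at the component `l` by `beta_entries`, and
elsewhere because both sides vanish. -/
theorem beta_summand (hρ : ρ.IsTwisted (α.restrict H).toFun) {g g' : Loop π} (f : Γ)
    (hf : realConj π f g.el = g'.el) {q l : Γ ⧸ H} (hq : g.el • q = q) (hl : g'.el • l = l)
    (hql : f • q = l) (v : ρ.Tr (fixedLoop σ hσ g q hq)) :
    (ρ.rind σ hσ α).beta f hf (ρ.summand σ hσ α g q hq v) =
      ((transgressionFun π α.toFun f (σ q) (fixedLoop σ hσ g q hq).el /
        transgressionFun π α.toFun (σ l) (trans σ hσ f q l hql)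
          (fixedLoop σ hσ g q hq).el : kˣ) : k) •
      ρ.summand σ hσ α g' l hl (ρ.beta (trans σ hσ f q l hql)
        (realConj_trans_fixedLoop σ hσ f hf hq hl hql) v) := by
  obtain ⟨p, hp⟩ : ∃ p, p = g.el ^ ((π f : ℤˣ) : ℤ) := ⟨_, rfl⟩
  have hm : g'.el * f = f * p := by rw [← hf, realConj, hp, inv_mul_cancel_right]
  have hpq : p • q = q := by
    apply smul_left_cancel f
    rw [← mul_smul, ← hm, mul_smul, hql, hl]
  have hmq : (f * p) • q = l := by rw [mul_smul, hpq, hql]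
  have hc := transgression_rindFactor σ hσ α f hf hq hl hql hp hpq
  generalize transgressionFun π α.toFun f (σ q) (fixedLoop σ hσ g q hq).el /
    transgressionFun π α.toFun (σ l) (trans σ hσ f q l hql) (fixedLoop σ hσ g q hq).el = c at hc ⊢
  refine (ρ.rind σ hσ α).eq_beta_of_act f hf _ _ hp hm rfl fun y => ?_
  rw [trApp_smul]
  refine funext fun l' => ?_
  obtain ⟨i, hi⟩ : ∃ i, f • i = l' := ⟨f⁻¹ • l', smul_inv_smul _ _⟩
  have hmap := ρ.rindAct_map_eq σ hσ f hi rfl (trans_deg σ hσ f i l' hi)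
    ((ρ.rind σ hσ α).signedTr (π f) p hp (ρ.summand σ hσ α g q hq v) y)
  by_cases hl' : l' = l
  · subst hl'
    obtain rfl : i = q := smul_left_cancel f (hi.trans hql.symm)
    have hψ₁ := ρ.rind_psiApp_hom σ hσ α g'.el f (f * p) hm hql hl hmq y
    have hψ₂ := ρ.rind_psiApp_hom σ hσ α f p (f * p) rfl hpq hql hmq y
    refine Eq.trans ?_ ((hρ.beta_entries (trans_deg σ hσ f i l' hi)
      (realConj_trans_fixedLoop σ hσ f hf hq hl hql) v
      (trans_eq_fixedLoop_zpow σ hσ g' l' hl)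
      (trans_eq_fixedLoop_zpow_of_eq σ hσ g i hq hp hpq rfl)
      (trans_mul σ hσ g'.el f (f * p) hm i l' l' hql hl hmq)
      (trans_mul σ hσ f p (f * p) rfl i i l' hpq hql hmq)
      (ρ.rindCast σ hσ f i l' hi y) (ρ.rindCast σ hσ g'.el l' l' hl ((ρ.rind σ hσ α).obj f y))
      (ρ.rindCast σ hσ (f * p) i l' hmq y) (ρ.rindCast σ hσ p i i hpq y)
      (ρ.rindCast σ hσ f i l' hi ((ρ.rind σ hσ α).obj p y)) _ _ _ _ _
      (ρ.rindComp_signedTr_summand σ hσ α hρ g i hq v hp hpq rfl y)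
      hc).trans
      (congrArg₂ (· ≫ ·) hmap hψ₂).symm)
    exact congrArg₂ (fun a b => ((c : k) • a) ≫ b) (ρ.trApp_summand_self σ hσ α g' l' hl _ _) hψ₁
  -- Away from `l`, the source coset is not `q`, so the (possibly bent) summand vanishes there.
  · have hiq : i ≠ q := fun h => hl' (by rw [← hi, h, hql])
    rw [ρ.rindComp_signedTr_summand_of_ne σ hσ α g q hq v hp hiq rfl y] at hmap
    refine Eq.trans ?_ ((congrArg (· ≫ _) hmap).trans
      (comp_comp_eq_zero _ _ _ (ρ.innerMap_zero _ _ _ _))).symm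
    exact smul_comp_eq_zero (c : k) _ (ρ.trApp_summand_of_ne σ hσ α g' l hl _ _ hl')

end RealTwoRepData

theorem comp_comp_comp_eq_zero {C : Type u} [Category.{v} C] [Preadditive C] {x y z t r : C}
    (a : x ⟶ y) (b : y ⟶ z) {f : z ⟶ t} (c : t ⟶ r) (hf : f = 0) : a ≫ b ≫ f ≫ c = 0 := by
  rw [hf, Limits.zero_comp, Limits.comp_zero, Limits.comp_zero]

theorem comp_hom_eq_of_comp_inv {C : Type u} [Category.{v} C] {x y z t z' t' : C} {f : x ⟶ y}
    {b : y ⟶ t} {a : x ⟶ z} (K : z ≅ z') (L : t ≅ t') {m : z' ⟶ t'}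
    (h : f ≫ b = a ≫ K.hom ≫ m ≫ L.inv) : f ≫ b ≫ L.hom = (a ≫ K.hom) ≫ m := by
  rw [← Category.assoc, h]
  simp

theorem eq_comp_inv_of_id_comp {C : Type u} [Category.{v} C] {x y z : C} {b : x ⟶ y}
    {a : x ⟶ z} (K : y ≅ z) {m : z ⟶ z} (hm : m = 𝟙 z) (h : 𝟙 x ≫ b ≫ K.hom = a ≫ m) :
    b = a ≫ K.inv := by
  rw [hm, Category.id_comp, Category.comp_id] at h
  rw [← h, Category.assoc, Iso.hom_inv_id, Category.comp_id]

namespace RealTwoRepData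

/-! ### Bending is a bijection -/

section Bend

variable {k : Type w} [Field k] {Γ : Type u₁} [Group Γ] {π : Γ →* ℤˣ}
  {V : Type u} [Category.{v} V] [Preadditive V] [Linear k V] (ρ : RealTwoRepData k π V)

set_option linter.unusedSectionVars false in
theorem posHom_injective {ε : ℤˣ} (h : ε = 1) {x y : V} :
    Function.Injective (posHom h : (x ⟶ y) → ((⟨x⟩ : Signed ε V) ⟶ ⟨y⟩)) := fun _ _ hf =>
  congrArg (fun a : SHom ε x y => a.pos h) hf

set_option linter.unusedSectionVars false in
theorem posHom_pos {ε : ℤˣ} (h : ε = 1) {x y : V} (f : (⟨x⟩ : Signed ε V) ⟶ ⟨y⟩) :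
    posHom h (f.pos h) = f := by
  ext h'
  · rfl
  · exact absurd (h.symm.trans h') (by decide)

theorem innerMap_id {ε ε₂ : ℤˣ} (ω : Γ) (h : ε = ε₂ * π ω) (x : V) :
    ρ.innerMap ω h (𝟙 (⟨x⟩ : Signed ε V)) = 𝟙 _ :=
  ((Signed.split h) ⋙ Signed.functor ε₂ (ρ.act ω)).map_id _

/-- Bending is injective. -/
theorem eq_of_signedTr_eq {s : ℤˣ} {g : Loop π} {p : Γ} (hp : p = g.el ^ (s : ℤ)) {φ φ' : ρ.Tr g}
    (h : ∀ x, ρ.signedTr s p hp φ x = ρ.signedTr s p hp φ' x) : φ = φ' := by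
  refine ρ.tr_ext fun x => ?_
  rcases Int.units_eq_one_or s with rfl | rfl
  · obtain rfl : p = g.el := by simpa using hp
    rw [← ρ.signedTr_pos hp φ x rfl, ← ρ.signedTr_pos hp φ' x rfl, h]
  · obtain rfl : p = g.el⁻¹ := by simpa using hp
    have hx : ρ.bend φ x = ρ.bend φ' x := by
      rw [← ρ.signedTr_neg hp φ x rfl, ← ρ.signedTr_neg hp φ' x rfl, h]
    exact posHom_injective _ ((ρ.act g.el⁻¹).map_injective ((cancel_mono _).1 hx))

/-- Bending is surjective: every natural family of signed morphisms comes from the categorical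
trace. -/
theorem exists_signedTr_eq {s : ℤˣ} {g : Loop π} {p : Γ} (hp : p = g.el ^ (s : ℤ))
    (hs : s = s * π p) (t : ∀ x : V, (⟨x⟩ : Signed s V) ⟶ ⟨ρ.obj p x⟩)
    (ht : ∀ (x y : V) (f : (⟨x⟩ : Signed s V) ⟶ ⟨y⟩), f ≫ t y = t x ≫ ρ.innerMap p hs f) :
    ∃ φ : ρ.Tr g, ∀ x, ρ.signedTr s p hp φ x = t x := by
  rcases Int.units_eq_one_or s with rfl | rfl
  · obtain rfl : p = g.el := by simpa using hp
    refine ⟨⟨fun x => (t x.un).pos rfl, fun x y f => ?_⟩, fun x => ?_⟩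
    · have := congrArg (fun a : SHom (1 : ℤˣ) _ _ => a.pos rfl)
        (ht x.un y.un (posHom rfl (f.pos g.deg)))
      refine this.trans ?_
      rw [ρ.innerMap_pos g.el g.deg]
      exact congrArg (fun a => (t x.un).pos rfl ≫ (ρ.act g.el).map a) (posHom_pos g.deg f)
    · ext h
      · exact ρ.signedTr_pos hp _ x h
      · exact absurd h (by decide)
  · obtain rfl : p = g.el⁻¹ := by simpa using hp
    have hd : π g.el⁻¹ = 1 := by rw [map_inv, g.deg, inv_one]
    have h₀ : π 1 = π g.el⁻¹ * π g.el := by rw [← map_mul, inv_mul_cancel]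
    -- Undoing the bending: `ρ(g⁻¹)(a)` followed by the cap has to be `t x`, and fullness of
    -- `ρ(g⁻¹)` provides such an `a`.
    have hex (x : V) : ∃ a : x ⟶ ρ.obj g.el x, (ρ.act g.el⁻¹).map (posHom hd a) =
        (t x).neg rfl ≫ (ρ.cap g.el⁻¹ g.el (inv_mul_cancel _) x).inv := by
      obtain ⟨a, ha⟩ := (ρ.act g.el⁻¹).map_surjective (X := ⟨x⟩) (Y := ⟨ρ.obj g.el x⟩)
        ((t x).neg rfl ≫ (ρ.cap g.el⁻¹ g.el (inv_mul_cancel _) x).inv)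
      exact ⟨a.pos hd, by rw [posHom_pos, ha]⟩
    choose a ha using hex
    -- Naturality of the chosen family can be tested after applying the faithful functor `ρ(g⁻¹)`,
    -- where it follows from naturality of `t` and of the cap.
    have hnat {x y : V} (f : x ⟶ y) : f ≫ a y = a x ≫ (ρ.act g.el).map (posHom g.deg f) := by
      apply posHom_injective hd
      apply (ρ.act g.el⁻¹).map_injective
      have h₁ := ρ.cap_naturality g.el⁻¹ g.el (inv_mul_cancel _) h₀ f
      have h₂ : ρ.innerMap g.el h₀ (posHom (map_one π) f) =
          posHom hd ((ρ.act g.el).map (posHom g.deg f)) := by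
        rw [ρ.innerMap_pos g.el g.deg]
        ext h'
        · rfl
        · exact absurd (hd.symm.trans h') (by decide)
      rw [h₂] at h₁
      have h₃ := congrArg (fun a : SHom (-1 : ℤˣ) _ _ => a.neg rfl) (ht y x
        ⟨fun h => absurd h (by decide), fun _ => f⟩)
      rw [ρ.innerMap_pos g.el⁻¹ hd] at h₃
      have h₃' : (t x).neg rfl ≫ f = (ρ.act g.el⁻¹).map (posHom hd f) ≫ (t y).neg rfl := h₃
      have h₄ : f ≫ (ρ.cap g.el⁻¹ g.el (inv_mul_cancel _) y).inv =
          (ρ.cap g.el⁻¹ g.el (inv_mul_cancel _) x).inv ≫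
            (ρ.act g.el⁻¹).map (posHom hd ((ρ.act g.el).map (posHom g.deg f))) := by
        rw [Iso.comp_inv_eq, Category.assoc, h₁, Iso.inv_hom_id_assoc]
      rw [posHom_comp, posHom_comp, Functor.map_comp, Functor.map_comp, ha, ha, ← reassoc_of% h₃',
        Category.assoc, h₄]
    refine ⟨⟨fun x => a x.un, fun x y f => ?_⟩, fun x => ?_⟩
    · exact (hnat (f.pos g.deg)).trans
        (congrArg (fun b => a x.un ≫ (ρ.act g.el).map b) (posHom_pos g.deg f))
    · ext h
      · exact absurd h (by decide)
      · rw [signedTr_neg]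
        change (ρ.act g.el⁻¹).map (posHom hd (a x)) ≫ _ = _
        rw [ha, Category.assoc, Iso.inv_hom_id, Category.comp_id]

end Bend

variable {k : Type w} [Field k] {Γ : Type u₁} [Group Γ] {π : Γ →* ℤˣ} {H : Subgroup Γ}
  {V : Type u} [Category.{v} V] [Preadditive V] [Linear k V]
  (ρ : RealTwoRepData k (π.comp H.subtype) V) (σ : Γ ⧸ H → Γ)
  (hσ : ∀ q, (σ q : Γ ⧸ H) = q) (α : ThreeCocycle k π)

/-! ## Decomposition of the categorical trace of the Real induction -/

section Decomposition

variable {g : Loop π} (T : (ρ.rind σ hσ α).Tr g)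

theorem trApp_rind_naturality {x y : RIndCat π V σ} (f : x ⟶ y) {i j : Γ ⧸ H} (h : g.el • i = j)
    (hi : π (σ i) = π (σ j) * (π.comp H.subtype) (trans σ hσ g.el i j h)) :
    f j ≫ (ρ.rind σ hσ α).trApp T y j = (ρ.rind σ hσ α).trApp T x j ≫
      (Signed.iso (π (σ j)) (ρ.rindCast σ hσ g.el i j h x)).hom ≫
        ρ.innerMap (trans σ hσ g.el i j h) hi (f i) ≫
        (Signed.iso (π (σ j)) (ρ.rindCast σ hσ g.el i j h y)).inv := by
  have he : π (σ i) = π g.el * π (σ i) := by rw [g.deg, one_mul]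
  have h₁ := ρ.rindAct_map_eq σ hσ g.el h he hi (posHom g.deg f)
  rw [rindComp_of_eq_one σ g.deg he] at h₁
  have h₂ := congrFun ((ρ.rind σ hσ α).trApp_naturality T f) j
  exact h₂.trans (congrArg ((ρ.rind σ hσ α).trApp T x j ≫ ·) h₁)

/-- Naturality along the projection onto the factor `l`: it acts as the identity on the source of
the `l` component, but as zero on its target, which depends only on the factor `g⁻¹ l ≠ l`. -/
theorem trApp_rind_eq_zero (x : RIndCat π V σ) {l : Γ ⧸ H} (hl : g.el • l ≠ l) :
    (ρ.rind σ hσ α).trApp T x l = 0 := by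
  classical
  obtain ⟨i, hi⟩ : ∃ i, g.el • i = l := ⟨g.el⁻¹ • l, smul_inv_smul _ _⟩
  have hil : i ≠ l := fun h => hl (by rw [← h, hi, h])
  have hd : π (σ i) = π (σ l) * (π.comp H.subtype) (trans σ hσ g.el i l hi) := by
    rw [← trans_deg σ hσ g.el, g.deg, one_mul]
  let f : x ⟶ x := Pi.single (M := fun j => x j ⟶ x j) l (𝟙 _)
  have h := ρ.trApp_rind_naturality σ hσ α T f hi hd
  have h₁ : f l = 𝟙 _ := Pi.single_eq_same (M := fun j => x j ⟶ x j) l _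
  have h₂ : f i = 0 := Pi.single_eq_of_ne (M := fun j => x j ⟶ x j) hil _
  rw [h₁, h₂, Category.id_comp] at h
  exact h.trans (comp_comp_comp_eq_zero _ _ _ (ρ.innerMap_zero _ hd _ _))

/-- Naturality along morphisms supported in the factor `q` shows that the `q` component of `T`
depends only on the `q` coordinate of the object and is natural in it. It is therefore a natural
family on `V` in sign `π(σ_q)`, and `exists_signedTr_eq` applies. -/
theorem exists_eq_summandEntry (q : Γ ⧸ H) (hq : g.el • q = q) :
    ∃ v : ρ.Tr (fixedLoop σ hσ g q hq), ∀ x,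
      (ρ.rind σ hσ α).trApp T x q = ρ.summandEntry σ hσ α g q hq v x := by
  classical
  have hd : π (σ q) = π (σ q) * (π.comp H.subtype) (trans σ hσ g.el q q hq) := by
    rw [← trans_deg σ hσ g.el, g.deg, one_mul]
  let t (x : RIndCat π V σ) : (⟨(x q).un⟩ : Signed (π (σ q)) V) ⟶
      ⟨ρ.obj (trans σ hσ g.el q q hq) (x q).un⟩ :=
    (ρ.rind σ hσ α).trApp T x q ≫ (Signed.iso (π (σ q)) (ρ.rindCast σ hσ g.el q q hq x)).hom
  have ht {x y : RIndCat π V σ} (f : x q ⟶ y q) :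
      f ≫ t y = t x ≫ ρ.innerMap (trans σ hσ g.el q q hq) hd f := by
    let f' : x ⟶ y := Pi.single (M := fun j => x j ⟶ y j) q f
    have h := ρ.trApp_rind_naturality σ hσ α T f' hq hd
    have h₁ : f' q = f := Pi.single_eq_same (M := fun j => x j ⟶ y j) q _
    rw [h₁] at h
    exact comp_hom_eq_of_comp_inv _ _ h
  obtain ⟨v, hv⟩ := ρ.exists_signedTr_eq (trans_eq_fixedLoop_zpow σ hσ g q hq) hd
    -- Any object with `q` coordinate `z` would do; the constant family is a canonical choice.
    (fun z => t (fun _ => ⟨z⟩)) (fun z z' f =>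
      ht (x := fun _ => ⟨z⟩) (y := fun _ => ⟨z'⟩) f)
  refine ⟨v, fun x => ?_⟩
  -- The morphism that is the identity at `q` and zero elsewhere compares the constant family with
  -- `x`.
  have h₁ := ht (x := fun _ => ⟨(x q).un⟩) (y := x) (𝟙 (x q))
  refine eq_comp_inv_of_id_comp _ (ρ.innerMap_id _ hd (x q).un) (h₁.trans ?_)
  exact congrArg (· ≫ _) (hv _).symm

end Decomposition
end RealTwoRepData

/-! ## The fibres of an induced representation -/

section IndFibre

variable {k : Type w} [Field k] {C : Type u₁} [Category.{v₁} C] {D : Type u₂} [Category.{v₂} D]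
  {F : C ⥤ D} {x : D} {ι : Type*} {c : ι → C} {t : ∀ i, F.obj (c i) ⟶ x}

/-- The family `t` of morphisms `F (c i) ⟶ x` is a transversal: each morphism `F y ⟶ x` factors
uniquely through a member of the family. -/
def IsTransversal (F : C ⥤ D) (t : ∀ i, F.obj (c i) ⟶ x) : Prop :=
  ∀ (y : C) (s : F.obj y ⟶ x), ∃! p : (i : ι) × (y ⟶ c i), F.map p.2 ≫ t p.1 = s

variable (θ : TwoCocycle k D) (E : BundleData.{w, v₁, u₁, v₃} k C)

open scoped Classical in
/-- The coordinates of `s ⊗ v` with respect to a transversal. -/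
noncomputable def indCoordSymbol (ht : IsTransversal F t) (p : (y : C) × (F.obj y ⟶ x)) :
    E.fib p.1 →ₗ[k] ∀ i, E.fib (c i) :=
  (((θ.toFun (t (ht p.1 p.2).choose.1) (F.map (ht p.1 p.2).choose.2))⁻¹ : kˣ) : k) •
    LinearMap.single k (fun i => E.fib (c i)) (ht p.1 p.2).choose.1 ∘ₗ
      E.map (ht p.1 p.2).choose.2

open scoped Classical in
-- Unique factorization makes the coordinates independent of the chosen factorization of `s`.
theorem indCoordSymbol_apply (ht : IsTransversal F t) {y : C} {i : ι} (a : y ⟶ c i) {s : F.obj y ⟶ x}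
    (hs : F.map a ≫ t i = s) (v : E.fib y) :
    indCoordSymbol θ E ht ⟨y, s⟩ v = (((θ.toFun (t i) (F.map a))⁻¹ : kˣ) : k) •
      (Pi.single i (E.map a v) : ∀ i, E.fib (c i)) := by
  have h : (ht y s).choose = ⟨i, a⟩ :=
    (ht y s).unique (ht y s).choose_spec.1 (y₂ := ⟨i, a⟩) hs
  exact congrArg (fun p : (i : ι) × (y ⟶ c i) => (((θ.toFun (t p.1) (F.map p.2))⁻¹ : kˣ) : k) •
    (Pi.single p.1 (E.map p.2 v) : ∀ i, E.fib (c i))) h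

open scoped DirectSum Classical in
-- If `s` factors as `t i ∘ F b`, then `s ∘ F a` factors through the same `t i` by `b ∘ a`. The
-- relation then reduces to the `2`-cocycle identity for `(t i, F b, F a)`, together with the
-- hypothesis that the twist of `E` is the restriction of `θ`.
theorem indRel_le_ker_indCoordSymbol (ht : IsTransversal F t) {θ' : TwoCocycle k C} (hE : E.IsTwisted θ')
    (hθ : ∀ {y y' y'' : C} (b : y' ⟶ y'') (a : y ⟶ y'),
      θ'.toFun b a = θ.toFun (F.map b) (F.map a)) :
    indRel F θ E x ≤ LinearMap.ker (DirectSum.toModule k _ (∀ i, E.fib (c i))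
      (indCoordSymbol θ E ht)) := by
  refine Submodule.span_le.2 ?_
  rintro z ⟨y, y', a, s, v, rfl⟩
  obtain ⟨⟨i, b⟩, rfl, -⟩ := ht y' s
  have hs : F.map (a ≫ b) ≫ t i = F.map a ≫ F.map b ≫ t i := by
    rw [F.map_comp, Category.assoc]
  have hab := LinearMap.congr_fun (hE.map_comp b a) v
  rw [LinearMap.comp_apply, LinearMap.smul_apply] at hab
  rw [SetLike.mem_coe, LinearMap.mem_ker, map_sub, map_smul, DirectSum.toModule_lof,
    DirectSum.toModule_lof, indCoordSymbol_apply θ E ht b rfl,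
    indCoordSymbol_apply θ E ht (a ≫ b) hs, hab, Pi.single_smul, smul_smul, smul_smul,
    ← Units.val_mul, ← Units.val_mul, sub_eq_zero, hθ]
  congr 2
  have := θ.cocycle (t i) (F.map b) (F.map a)
  rw [← F.map_comp] at this
  rw [inv_mul_eq_iff_eq_mul, ← mul_assoc, this, mul_comm, inv_mul_cancel_left]

/-- The coordinates of the elements of the fibre of an induced representation. -/
noncomputable def indCoord (ht : IsTransversal F t) {θ' : TwoCocycle k C} (hE : E.IsTwisted θ')
    (hθ : ∀ {y y' y'' : C} (b : y' ⟶ y'') (a : y ⟶ y'),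
      θ'.toFun b a = θ.toFun (F.map b) (F.map a)) :
    (ind F θ E).fib x →ₗ[k] ∀ i, E.fib (c i) := by
  classical
  exact Submodule.liftQ _ _ (indRel_le_ker_indCoordSymbol θ E ht hE hθ)

open scoped Classical in
theorem indCoord_indMk (ht : IsTransversal F t) {θ' : TwoCocycle k C} (hE : E.IsTwisted θ')
    (hθ : ∀ {y y' y'' : C} (b : y' ⟶ y'') (a : y ⟶ y'),
      θ'.toFun b a = θ.toFun (F.map b) (F.map a))
    (i : ι) (v : E.fib (c i)) :
    indCoord θ E ht hE hθ (indMk F θ E (t i) v) = Pi.single i v := by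
  have h : indCoord θ E ht hE hθ (indMk F θ E (t i) v) = indCoordSymbol θ E ht ⟨c i, t i⟩ v :=
    DirectSum.toModule_lof k _ _
  rw [h, indCoordSymbol_apply θ E ht (𝟙 (c i)) (by rw [F.map_id, Category.id_comp]), F.map_id,
    θ.id_right, inv_one, Units.val_one, one_smul, hE.map_id]
  rfl

/-- Every symbol `s ⊗ v` is a unit multiple of some `t i ⊗ a v`, so the symbols on the transversal
already span the fibre. -/
theorem ind_hom_ext_of_isTransversal (ht : IsTransversal F t) {M : Type*} [AddCommGroup M] [Module k M]
    {f f' : (ind F θ E).fib x →ₗ[k] M}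
    (h : ∀ (i : ι) (v : E.fib (c i)), f (indMk F θ E (t i) v) = f' (indMk F θ E (t i) v)) :
    f = f' := by
  refine ind_hom_ext F θ E fun y s v => ?_
  obtain ⟨⟨i, a⟩, rfl, -⟩ := ht y s
  have h₁ := h i (E.map a v)
  rw [indMk_map, map_smul, map_smul] at h₁
  have h₂ := congrArg (fun z => (((θ.toFun (t i) (F.map a))⁻¹ : kˣ) : k) • z) h₁
  simpa only [smul_smul, ← Units.val_mul, inv_mul_cancel, Units.val_one, one_smul] using h₂

theorem indCoord_bijective [Finite ι] (ht : IsTransversal F t) {θ' : TwoCocycle k C}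
    (hE : E.IsTwisted θ')
    (hθ : ∀ {y y' y'' : C} (b : y' ⟶ y'') (a : y ⟶ y'),
      θ'.toFun b a = θ.toFun (F.map b) (F.map a)) :
    Function.Bijective (indCoord θ E ht hE hθ) := by
  classical
  have := Fintype.ofFinite ι
  let mk (i : ι) : E.fib (c i) →ₗ[k] (ind F θ E).fib x :=
    { toFun := indMk F θ E (t i)
      map_add' := indMk_add F θ E (t i)
      map_smul' := indMk_smul F θ E (t i) }
  -- The inverse sends a family `v` to the sum of the `t i ⊗ v i`; finiteness of the transversal
  -- makes this sum meaningful on the whole product.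
  let A : (∀ i, E.fib (c i)) →ₗ[k] (ind F θ E).fib x := LinearMap.lsum k _ k mk
  have hA (i : ι) (v : E.fib (c i)) : A (Pi.single i v) = indMk F θ E (t i) v :=
    LinearMap.lsum_piSingle ..
  have h₁ : A ∘ₗ indCoord θ E ht hE hθ = LinearMap.id :=
    ind_hom_ext_of_isTransversal θ E ht fun i v => by
      rw [LinearMap.comp_apply, indCoord_indMk, hA, LinearMap.id_apply]
  have h₂ : indCoord θ E ht hE hθ ∘ₗ A = LinearMap.id := LinearMap.pi_ext fun i v => by
    rw [LinearMap.comp_apply, hA, indCoord_indMk, LinearMap.id_apply]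
  exact Function.bijective_iff_has_inverse.2
    ⟨A, fun z => LinearMap.congr_fun h₁ z, fun z => LinearMap.congr_fun h₂ z⟩

end IndFibre


/-! ### The comparison isomorphism -/

variable {k : Type w} [Field k] {Γ : Type u₁} [Group Γ] {π : Γ →* ℤˣ} {H : Subgroup Γ}
  {V : Type u} [Category.{v} V] [Preadditive V] [Linear k V]
  (ρ : RealTwoRepData k (π.comp H.subtype) V) (σ : Γ ⧸ H → Γ)
  (hσ : ∀ q, (σ q : Γ ⧸ H) = q) (α : ThreeCocycle k π)

theorem mul_eq_of_realConj_eq {ω γ γ' : Γ} (h : realConj π ω γ = γ') :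
    γ' * ω = ω * γ ^ ((π ω : ℤˣ) : ℤ) := by
  rw [← h, realConj, inv_mul_cancel_right]

theorem transgression_restrict {y y' y'' : Loop (π.comp H.subtype)} (b : y' ⟶ y'') (a : y ⟶ y') :
    (transgression (α.restrict H)).toFun b a =
      (transgression α).toFun ((loopInclusion π H).map b) ((loopInclusion π H).map a) := by
  simp only [transgression, transgressionFun, loopInclusion, ThreeCocycle.restrict_toFun,
    MonoidHom.comp_apply, Subgroup.subtype_apply, Subgroup.coe_mul, Subgroup.coe_inv,
    Subgroup.coe_zpow]
  rfl

/-- The representatives of the cosets fixed by a loop form a transversal. -/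
theorem isTransversal_fixedLoopHom (g : Loop π) :
    IsTransversal (loopInclusion π H)
      fun q : {q : Γ ⧸ H // g.el • q = q} => fixedLoopHom σ hσ g q.1 q.2 := by
  intro y s
  have hs : g.el * s.1 = s.1 * (y.el : Γ) ^ ((π s.1 : ℤˣ) : ℤ) :=
    mul_eq_of_realConj_eq s.2
  -- The coset of `s` is fixed because `g s` is `s` times a power of a loop of `H`. Hence `s` can
  -- only factor through the representative of its own coset.
  have hq : g.el • (s.1 : Γ ⧸ H) = s.1 := by
    change ((g.el * s.1 : Γ) : Γ ⧸ H) = s.1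
    rw [hs, eq_comm, QuotientGroup.eq, inv_mul_cancel_left]
    exact H.zpow_mem y.el.2 _
  have hm : (σ s.1)⁻¹ * s.1 ∈ H := by rw [← QuotientGroup.eq, hσ]
  have hc : realConj (π.comp H.subtype) ⟨(σ s.1)⁻¹ * s.1, hm⟩ y.el =
      (fixedLoop σ hσ g s.1 hq).el := by
    apply Subtype.ext
    have h := (fixedLoopHom σ hσ g s.1 hq).2
    -- Both loops of `H` are carried to `g` by `σ_q`, and Real conjugation by `σ_q` is injective.
    have h' : realConj π (σ s.1) ((realConj (π.comp H.subtype) ⟨(σ s.1)⁻¹ * s.1, hm⟩ y.el : H)) =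
        realConj π (σ s.1) ((fixedLoop σ hσ g s.1 hq).el : Γ) := by
      refine Eq.trans ?_ h.symm
      have := ((loopInclusion π H).map (X := y) (Y := ⟨realConj (π.comp H.subtype)
        ⟨(σ s.1)⁻¹ * s.1, hm⟩ y.el, realConj_deg _ _ y.deg⟩) ⟨⟨(σ s.1)⁻¹ * s.1, hm⟩, rfl⟩).2
      refine (congrArg _ this.symm).trans ?_
      rw [← realConj_mul]
      change realConj π (σ s.1 * ((σ s.1)⁻¹ * s.1)) _ = _
      rw [mul_inv_cancel_left]
      exact s.2
    have h'' := congrArg (realConj π (σ s.1)⁻¹) h'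
    rwa [← realConj_mul, ← realConj_mul, inv_mul_cancel, realConj_one, realConj_one] at h''
  refine ⟨⟨⟨s.1, hq⟩, ⟨⟨(σ s.1)⁻¹ * s.1, hm⟩, hc⟩⟩, Subtype.ext (mul_inv_cancel_left _ _), ?_⟩
  rintro ⟨⟨q, hq'⟩, a⟩ ha
  have ha' : σ q * (a.1 : Γ) = s.1 := congrArg Subtype.val ha
  obtain rfl : q = s.1 := by
    rw [← hσ q, QuotientGroup.eq, ← ha', inv_mul_cancel_left]
    exact a.1.2
  congr 1
  apply Subtype.ext
  apply Subtype.ext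
  change (a.1 : Γ) = (σ s.1)⁻¹ * s.1
  rw [eq_inv_mul_iff_mul_eq, ha']

namespace RealTwoRepData

/-- The sum of the summands of the categorical trace of the Real induction. -/
noncomputable def summandSum [Finite Γ] (g : Loop π) :
    (∀ q : {q : Γ ⧸ H // g.el • q = q}, ρ.Tr (fixedLoop σ hσ g q.1 q.2)) →ₗ[k]
      (ρ.rind σ hσ α).Tr g := by
  classical
  have := Fintype.ofFinite {q : Γ ⧸ H // g.el • q = q}
  exact LinearMap.lsum k _ k fun q => ρ.summand σ hσ α g q.1 q.2

theorem summandSum_single [Finite Γ] (g : Loop π)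
    [DecidableEq {q : Γ ⧸ H // g.el • q = q}] (q : {q : Γ ⧸ H // g.el • q = q})
    (v : ρ.Tr (fixedLoop σ hσ g q.1 q.2)) :
    ρ.summandSum σ hσ α g (Pi.single q v) = ρ.summand σ hσ α g q.1 q.2 v := by
  let := Fintype.ofFinite {q : Γ ⧸ H // g.el • q = q}
  convert LinearMap.lsum_piSingle (R := k)
    (φ := fun q : {q : Γ ⧸ H // g.el • q = q} => ρ.Tr (fixedLoop σ hσ g q.1 q.2))
    (S := k) (f := fun q => ρ.summand σ hσ α g q.1 q.2) (i := q) (x := v)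
  rfl

theorem trApp_summandSum [Finite Γ] (g : Loop π)
    (v : ∀ q : {q : Γ ⧸ H // g.el • q = q}, ρ.Tr (fixedLoop σ hσ g q.1 q.2))
    (x : RIndCat π V σ) (q : Γ ⧸ H) (hq : g.el • q = q) :
    (ρ.rind σ hσ α).trApp (ρ.summandSum σ hσ α g v) x q =
      ρ.summandEntry σ hσ α g q hq (v ⟨q, hq⟩) x := by
  classical
  have := Fintype.ofFinite {q : Γ ⧸ H // g.el • q = q}
  let ev : (ρ.rind σ hσ α).Tr g →+ (x q ⟶ (ρ.rind σ hσ α).obj g.el x q) :=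
    { toFun T := (ρ.rind σ hσ α).trApp T x q
      map_zero' := rfl
      map_add' _ _ := rfl }
  have h : ρ.summandSum σ hσ α g v =
      ∑ r : {q : Γ ⧸ H // g.el • q = q}, ρ.summand σ hσ α g r.1 r.2 (v r) := by
    rw [summandSum, LinearMap.lsum_apply, LinearMap.sum_apply]
    exact Finset.sum_congr (by ext; simp) fun _ _ => rfl
  change ev (ρ.summandSum σ hσ α g v) = _
  rw [h, map_sum, Finset.sum_eq_single ⟨q, hq⟩]
  · exact ρ.trApp_summand_self σ hσ α g q hq _ x
  · intro r _ hr
    exact ρ.trApp_summand_of_ne σ hσ α g r.1 r.2 _ x fun h => hr (Subtype.ext h.symm)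
  · exact fun h => absurd (Finset.mem_univ _) h

theorem summandEntry_injective {g : Loop π} {q : Γ ⧸ H} {hq : g.el • q = q}
    {v v' : ρ.Tr (fixedLoop σ hσ g q hq)}
    (h : ∀ x, ρ.summandEntry σ hσ α g q hq v x = ρ.summandEntry σ hσ α g q hq v' x) : v = v' :=
  ρ.eq_of_signedTr_eq (trans_eq_fixedLoop_zpow σ hσ g q hq) fun z =>
    (cancel_mono (Signed.iso (π (σ q)) (ρ.rindCast σ hσ g.el q q hq fun _ => ⟨z⟩)).inv).1
      (h fun _ => ⟨z⟩)

/-- The component at a fixed coset recovers the corresponding entry, which determines `v` because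
bending is injective. Surjectivity holds because each component of `T` at a fixed coset is an entry
of some `v`, and the other components vanish. -/
theorem summandSum_bijective [Finite Γ] (g : Loop π) :
    Function.Bijective (ρ.summandSum σ hσ α g) := by
  refine ⟨fun v v' h => funext fun q => ρ.summandEntry_injective σ hσ α fun x => ?_, fun T => ?_⟩
  · rw [← ρ.trApp_summandSum σ hσ α g v x q.1 q.2, h, ρ.trApp_summandSum]
  · choose v hv using fun q : {q : Γ ⧸ H // g.el • q = q} =>
      ρ.exists_eq_summandEntry σ hσ α T q.1 q.2
    refine ⟨v, (ρ.rind σ hσ α).tr_ext fun x => funext fun q => ?_⟩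
    by_cases hq : g.el • q = q
    · rw [ρ.trApp_summandSum σ hσ α g v x q hq]
      exact (hv ⟨q, hq⟩ x).symm
    · rw [ρ.trApp_rind_eq_zero σ hσ α T x hq, ρ.trApp_rind_eq_zero σ hσ α _ x hq]

/-- The isomorphism between the fibre of the induced representation and the categorical trace of
the Real induction. -/
noncomputable def indEquivRind [Finite Γ] (hρ : ρ.IsTwisted (α.restrict H).toFun) (g : Loop π) :
    (ind (loopInclusion π H) (transgression α) ρ.realCatChar).fib g ≃ₗ[k]
      (ρ.rind σ hσ α).realCatChar.fib g :=
  (LinearEquiv.ofBijective (indCoord (transgression α) ρ.realCatChar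
      (isTransversal_fixedLoopHom σ hσ g) (ρ.realCatChar_isTwisted (α.restrict H) hρ)
      (transgression_restrict α))
    (indCoord_bijective (transgression α) ρ.realCatChar _ _ _)).trans
    (LinearEquiv.ofBijective (ρ.summandSum σ hσ α g) (ρ.summandSum_bijective σ hσ α g))

theorem indEquivRind_indMk [Finite Γ] (hρ : ρ.IsTwisted (α.restrict H).toFun) (g : Loop π)
    (q : Γ ⧸ H) (hq : g.el • q = q) (v : ρ.Tr (fixedLoop σ hσ g q hq)) :
    ρ.indEquivRind σ hσ α hρ g (indMk (loopInclusion π H) (transgression α) ρ.realCatChar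
      (fixedLoopHom σ hσ g q hq) v) = ρ.summand σ hσ α g q hq v := by
  classical
  let : DecidableEq {q : Γ ⧸ H // g.el • q = q} := fun _ _ => Classical.propDecidable _
  refine Eq.trans ?_ (ρ.summandSum_single σ hσ α g ⟨q, hq⟩ v)
  exact congrArg (ρ.summandSum σ hσ α g) (indCoord_indMk (transgression α) ρ.realCatChar
    (isTransversal_fixedLoopHom σ hσ g) (ρ.realCatChar_isTwisted (α.restrict H) hρ)
    (transgression_restrict α) ⟨q, hq⟩ v)

/-- It suffices to test on the symbols `σ_q ⊗ v`. There the action on the induced side is rewritten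
in terms of the representative of the coset `f q`, and its scalar is the one in `beta_summand`. -/
theorem indEquivRind_map [Finite Γ] (hρ : ρ.IsTwisted (α.restrict H).toFun) {g g' : Loop π}
    (f : g ⟶ g') (z : (ind (loopInclusion π H) (transgression α) ρ.realCatChar).fib g) :
    ρ.indEquivRind σ hσ α hρ g'
        ((ind (loopInclusion π H) (transgression α) ρ.realCatChar).map f z) =
      (ρ.rind σ hσ α).realCatChar.map f (ρ.indEquivRind σ hσ α hρ g z) := by
  suffices h : (ρ.indEquivRind σ hσ α hρ g').toLinearMap ∘ₗ
      (ind (loopInclusion π H) (transgression α) ρ.realCatChar).map f =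
      (ρ.rind σ hσ α).realCatChar.map f ∘ₗ (ρ.indEquivRind σ hσ α hρ g).toLinearMap from
    LinearMap.congr_fun h z
  refine ind_hom_ext_of_isTransversal _ _ (isTransversal_fixedLoopHom σ hσ g) fun q v => ?_
  obtain ⟨q, hq⟩ := q
  have hl : g'.el • f.1 • q = f.1 • q := by
    rw [← mul_smul, mul_eq_of_realConj_eq f.2, mul_smul]
    congr 1
    rcases Int.units_eq_one_or (π f.1) with h | h <;> rw [h]
    · simpa using hq
    · simpa [inv_smul_eq_iff] using hq.symm
  let a : fixedLoop σ hσ g q hq ⟶ fixedLoop σ hσ g' (f.1 • q) hl :=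
    ⟨trans σ hσ f.1 q (f.1 • q) rfl, realConj_trans_fixedLoop σ hσ f.1 f.2 hq hl rfl⟩
  -- The relation `σ_{fq} η = f σ_q`, read in the loop groupoid.
  have ha : (loopInclusion π H).map a ≫ fixedLoopHom σ hσ g' (f.1 • q) hl =
      fixedLoopHom σ hσ g q hq ≫ f := Subtype.ext (mul_inv_cancel_left _ _)
  have h₁ := ind_map_indMk (loopInclusion π H) (transgression α) ρ.realCatChar f
    (fixedLoopHom σ hσ g q hq) v
  have h₂ := indMk_map (loopInclusion π H) (transgression α) ρ.realCatChar a
    (fixedLoopHom σ hσ g' (f.1 • q) hl) v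
  rw [ha] at h₂
  -- One factor is from the action of `f` on the symbol, the other from moving `η` across the tensor
  -- sign.
  have h₃ : (ind (loopInclusion π H) (transgression α) ρ.realCatChar).map f
      (indMk (loopInclusion π H) (transgression α) ρ.realCatChar (fixedLoopHom σ hσ g q hq) v) =
      (((transgression α).toFun f (fixedLoopHom σ hσ g q hq) /
        (transgression α).toFun (fixedLoopHom σ hσ g' (f.1 • q) hl)
          ((loopInclusion π H).map a) : kˣ) : k) •
        indMk (loopInclusion π H) (transgression α) ρ.realCatChar
          (fixedLoopHom σ hσ g' (f.1 • q) hl) (ρ.realCatChar.map a v) := by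
    rw [h₁, h₂, smul_smul, ← Units.val_mul, div_mul_cancel]
  refine (congrArg (ρ.indEquivRind σ hσ α hρ g') h₃).trans ?_
  rw [map_smul]
  refine (congrArg (_ • ·) (ρ.indEquivRind_indMk σ hσ α hρ g' _ hl _)).trans ?_
  refine Eq.trans ?_ (congrArg ((ρ.rind σ hσ α).realCatChar.map f)
    (ρ.indEquivRind_indMk σ hσ α hρ g q hq v)).symm
  exact (ρ.beta_summand σ hσ α hρ f.1 f.2 hq hl rfl v).symm

end RealTwoRepData
end RealTwoRep

theorem mainTheorem4 {k : Type w} [Field k] {Γ : Type u₁} [Group Γ] [Finite Γ] (π : Γ →* ℤˣ)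
    (H : Subgroup Γ) (hH : Function.Surjective (π.comp H.subtype)) (α : ThreeCocycle k π)
    (σ : Γ ⧸ H → Γ) (hσ : ∀ q, (σ q : Γ ⧸ H) = q)
    {V : Type u} [Category.{v} V] [Preadditive V] [Linear k V]
    (ρ : RealTwoRepData k (π.comp H.subtype) V) (hρ : ρ.IsTwisted (α.restrict H).toFun) :
    (ρ.rind σ hσ α).IsTwisted α.toFun ∧
    ρ.realCatChar.IsTwisted (transgression (α.restrict H)) ∧
    (ρ.rind σ hσ α).realCatChar.IsTwisted (transgression α) ∧
    (ind (loopInclusion π H) (transgression α) ρ.realCatChar).IsTwisted (transgression α) ∧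
    ∃ Φ : BundleData.Iso (ρ.rind σ hσ α).realCatChar
        (ind (loopInclusion π H) (transgression α) ρ.realCatChar),
      ∀ (g : Loop π) (q : Γ ⧸ H) (hq : g.el • q = q) (v : ρ.Tr (fixedLoop σ hσ g q hq)),
        IsSummandOf σ hσ ρ α g q hq v ((Φ.equiv g).symm
          (indMk (loopInclusion π H) (transgression α) ρ.realCatChar
            (fixedLoopHom σ hσ g q hq) v)) := by
  have hR := ρ.rind_isTwisted σ hσ α hρ
  refine ⟨hR, ρ.realCatChar_isTwisted (α.restrict H) hρ,
    (ρ.rind σ hσ α).realCatChar_isTwisted α hR, ind_isTwisted _ _ _,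
    -- The isomorphism is constructed starting from the induced representation, where its values on
    -- the `σ_q ⊗ v` are prescribed, and is inverted here.
    { equiv := fun g => (ρ.indEquivRind σ hσ α hρ g).symm
      comm := fun f e => ?_ }, fun g q hq v => ?_⟩
  · rw [LinearEquiv.symm_apply_eq, ρ.indEquivRind_map σ hσ α hρ f, LinearEquiv.apply_symm_apply]
  · have h := ρ.indEquivRind_indMk σ hσ α hρ g q hq v
    exact h ▸ ρ.summand_isSummandOf σ hσ α g q hq v
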